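/- **Conventions.** A finite ringed space $(X,\mathcal O)$ is a finite $T_0$ topological space with a sheaf of commutative rings; equivalently, a finite poset $X$ ($p\le q$ iff $U_q\subseteq U_p$, where $U_p=\{q : q\ge p\}$ is the smallest open neighbourhood of $p$), a commutative ring $\mathcal O_p$ for each $p$, and ring homomorphisms $r_{pq}\colon\mathcal O_p\to\mathcal O_q$ for $p\le q$ with $r_{pp}=\mathrm{id}$ and $r_{pl}=r_{ql}\circ r_{pq}$. An $\mathcal O$-module $\mathcal M$ is, equivalently, a family of $\mathcal O_p$-modules $\mathcal M_p=\mathcal M(U_p)$ with compatible $\mathcal O_p$-linear maps $\mathcal M_p\to\mathcal M_q$ for $p\le q$. $X$ is a *finite space* if every $r_{pq}$ is flat. $\mathcal M$ is *quasi-coherent* if $\mathcal M_p\otimes_{\mathcal O_p}\mathcal O_q\to\mathcal M_q$ is an isomorphism for all $p\le q$. The product $X\times X$ is the product poset with rings $\mathcal O_x\otimes_{\mathbb Z}\mathcal O_y$, and $\delta\colon X\to X\times X$ is the diagonal morphism. A finite space $X$ is *semi-separated* if $R^i\delta_*\mathcal O$ is quasi-coherent for all $i\ge 0$ and $R^i\delta_*\mathcal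 O=0$ for all $i>0$. The dimension of $X$ is the supremum of the lengths $n$ of chains $x_0<\dots<x_n$ in $X$ (and $-\infty$ if $X=\emptyset$). For an $\mathcal O$-module $\mathcal M$ and $i\ge 0$, $\mathcal C^i\mathcal M$ is the module with $$(\mathcal C^i\mathcal M)(U)=\prod_{x_0<\dots<x_i,\ x_j\in U}\mathcal M_{x_i},$$ and $d\colon\mathcal C^i\mathcal M\to\mathcal C^{i+1}\mathcal M$ is $$(ds)(x_0<\dots<x_{i+1})=\sum_{k=0}^{i}(-1)^k s(x_0<\dots<\widehat{x_k}<\dots<x_{i+1})+(-1)^{i+1}\,\overline{s(x_0<\dots<x_i)},$$ the bar denoting the image under $\mathcal M_{x_i}\to\mathcal M_{x_{i+1}}$. For a complex $\mathcal M$ of $\mathcal O$-modules, $\mathcal C^{\bullet}\mathcal M$ is the simple complex of the bicomplex $\mathcal C^p\mathcal M^q$; the restriction maps $\mathcal M\to\mathcal C^0\mathcal M$ induce a natural morphism $\mathcal M\to\mathcal C^\bullet\mathcal M$. Let $\operatorname{Qc}\colon\operatorname{Mod}(X)\to\operatorname{Qcoh}(X)$ denote a right adjoint of the inclusion of the category of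 quasi-coherent modules in that of $\mathcal O$-modules, $R^i\operatorname{Qc}$ its right derived functors, and $\mathbb R\operatorname{Qc}\colon D(X)\to D\operatorname{Qcoh}(X)$ its total right derived functor from the derived category of (unbounded) complexes of $\mathcal O$-modules to that of complexes of quasi-coherent modules, with its natural morphism $\operatorname{Qc}(\mathcal M)\to\mathbb R\operatorname{Qc}(\mathcal M)$. A complex $\mathcal M$ is $\operatorname{Qc}$-acyclic if this morphism is an isomorphism in $D\operatorname{Qcoh}(X)$; a module $\mathcal M$ is $\operatorname{Qc}$-acyclic if $R^j\operatorname{Qc}(\mathcal M)=0$ for all $j>0$. **Theorem.** Let $X$ be a semi-separated finite space. Then $\operatorname{Qc}$ exists, and $\mathcal C^i\mathcal M$ is $\operatorname{Qc}$-acyclic for every $\mathcal O$-module $\mathcal M$ and every $i\ge 0$. Moreover: 1. $R^i\operatorname{Qc}(\mathcal M)=0$ for every $i>\dim X$ and every $\mathcal O$-module $\mathcal M$. 2. $\mathbb R\operatorname{Qc}$ exists, and for every complex $\mathcal M$ of $\mathcal O$-modules there is an isomorphism in $D\operatorname{Qcoh}(X)$ $$\mathbb R\operatorname{Qc}(\mathcal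 M)\simeq\operatorname{Qc}(\mathcal C^{\bullet}\mathcal M),$$ natural in $\mathcal M$ and compatible with the natural morphisms from $\operatorname{Qc}(\mathcal M)$ to both sides. In particular, every complex $\mathcal M$ of quasi-coherent modules is $\operatorname{Qc}$-acyclic, and the natural morphism $\mathcal M\to\operatorname{Qc}(\mathcal M)\to\mathbb R\operatorname{Qc}(\mathcal M)$ is an isomorphism in $D\operatorname{Qcoh}(X)$. -/

import Mathlib

open CategoryTheory Limits Opposite

universe u w₁ w₂

/-- A finite ringed space whose underlying topological space is T0. The topology of a finite T0
space is the same thing as the partial order `p ≤ q ↔ U_q ⊆ U_p`, where `U_p = {q | p ≤ q}` is the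
smallest open set containing `p`; a sheaf of commutative rings is the same thing as the rings
`O_p = O(U_p)` (which are the stalks) together with functorial restriction morphisms
`r_{pq} : O_p → O_q` for `p ≤ q`. -/
structure FiniteRingedSpace : Type (u + 1) where
  /-- the underlying set of points -/
  carrier : Type u
  [partialOrder : PartialOrder carrier]
  [finite : Finite carrier]
  /-- the structure sheaf, `p ↦ O_p` -/
  O : carrier ⥤ CommRingCat.{u}

open scoped TensorProduct
noncomputable section
namespace FiniteRingedSpace

attribute [instance] partialOrder finite

variable (X Y : FiniteRingedSpace.{u})

/-- The structure sheaf, as a functor to rings on the opposite of the category `carrierᵒᵖ`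
(`carrierᵒᵖ` is the poset of the minimal open sets `U_p`, ordered by inclusion). -/
abbrev ringSheaf : X.carrierᵒᵖᵒᵖ ⥤ RingCat.{u} :=
  (unopUnop X.carrier ⋙ X.O) ⋙ forget₂ CommRingCat RingCat

/-- The category of `O`-modules: an `O`-module is the same thing as a family of `O_p`-modules
`M_p = M(U_p)` with functorial semilinear restriction maps `r_{pq} : M_p → M_q` for `p ≤ q`. -/
abbrev Mod : Type (u + 1) := PresheafOfModules.{u} X.ringSheaf

/-- The stalk functor `M ↦ M_x`. -/
def stalk (x : X.carrier) : X.Mod ⥤ ModuleCat.{u} (X.O.obj x) :=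
  PresheafOfModules.evaluation X.ringSheaf (op (op x))

instance (x : X.carrier) : PreservesFiniteLimits (X.stalk x) :=
  inferInstanceAs (PreservesFiniteLimits (PresheafOfModules.evaluation X.ringSheaf (op (op x))))

instance (x : X.carrier) : PreservesFiniteColimits (X.stalk x) :=
  inferInstanceAs (PreservesFiniteColimits (PresheafOfModules.evaluation X.ringSheaf (op (op x))))

instance (x : X.carrier) : (X.stalk x).Additive :=
  inferInstanceAs (PresheafOfModules.evaluation X.ringSheaf (op (op x))).Additive

variable {X} in
/-- The restriction map `r_{xy} : M_x → M_y`. -/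
def res (M : X.Mod) {x y : X.carrier} (h : x ≤ y) :
    (X.stalk x).obj M →+ (X.stalk y).obj M :=
  (M.restrictₛₗ (homOfLE h).op.op).toAddMonoidHom

variable {X} in
lemma res_smul (M : X.Mod) {x y : X.carrier} (h : x ≤ y) (a : X.O.obj x)
    (m : (X.stalk x).obj M) :
    res M h (a • m) = (X.O.map (homOfLE h)).hom a • res M h m :=
  (M.restrictₛₗ (homOfLE h).op.op).map_smul' a m

variable {X} in
lemma res_self (M : X.Mod) {x : X.carrier} (h : x ≤ x) (m : (X.stalk x).obj M) :
    res M h m = m := by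
  change M.map (𝟙 _) m = m
  rw [M.map_id]; rfl

variable {X} in
lemma res_res (M : X.Mod) {x y z : X.carrier} (h : x ≤ y) (h' : y ≤ z)
    (m : (X.stalk x).obj M) :
    res M h' (res M h m) = res M (h.trans h') m :=
  (M.map_comp_apply (homOfLE h).op.op (homOfLE h').op.op m).symm

variable {X} in
lemma res_app {M N : X.Mod} (f : M ⟶ N) {x y : X.carrier} (h : x ≤ y)
    (m : (X.stalk x).obj M) :
    res N h ((X.stalk x).map f m) = (X.stalk y).map f (res M h m) :=
  (PresheafOfModules.naturality_apply f (homOfLE h).op.op m).symm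

/-- An elementary presentation of the data of an `O`-module. -/
structure ModData where
  /-- the stalks -/
  stalk (x : X.carrier) : Type u
  [addCommGroup (x : X.carrier) : AddCommGroup (stalk x)]
  [module (x : X.carrier) : Module (X.O.obj x) (stalk x)]
  /-- the restriction maps -/
  res {x y : X.carrier} (h : x ≤ y) : stalk x →+ stalk y
  res_smul {x y : X.carrier} (h : x ≤ y) (a : X.O.obj x) (m : stalk x) :
    res h (a • m) = (X.O.map (homOfLE h)).hom a • res h m
  res_self {x : X.carrier} (m : stalk x) : res le_rfl m = m
  res_res {x y z : X.carrier} (h : x ≤ y) (h' : y ≤ z) (m : stalk x) :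
    res h' (res h m) = res (h.trans h') m

attribute [instance] ModData.addCommGroup ModData.module
variable {X}

/-- The `O`-module attached to such data. -/
def ModData.toMod (D : X.ModData) : X.Mod where
  obj p := ModuleCat.of (X.O.obj p.unop.unop) (D.stalk p.unop.unop)
  map {p q} f := ModuleCat.ofHom
    (Y := (ModuleCat.restrictScalars (X.ringSheaf.map f).hom).obj
      (ModuleCat.of (X.O.obj q.unop.unop) (D.stalk q.unop.unop)))
    { toFun := D.res f.unop.unop.le
      map_add' := map_add _
      map_smul' := fun a m => D.res_smul f.unop.unop.le a m }
  map_id p := by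
    ext m
    exact D.res_self m
  map_comp f g := by
    ext m
    exact (D.res_res f.unop.unop.le g.unop.unop.le m).symm

/-- A morphism of `O`-modules is a family of linear maps on stalks that commutes with restrictions. -/
def homMk {M N : X.Mod}
    (φ : ∀ x, (X.stalk x).obj M →ₗ[X.O.obj x] (X.stalk x).obj N)
    (hφ : ∀ {x y : X.carrier} (h : x ≤ y) (m : (X.stalk x).obj M),
      res N h (φ x m) = φ y (res M h m)) : M ⟶ N where
  app p := ModuleCat.ofHom (φ p.unop.unop)
  naturality {p q} f := by
    ext m
    exact (hφ f.unop.unop.le m).symm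

variable (X)

instance : AB5 X.Mod where
  ofShape J _ _ := by
    refine ⟨⟨fun K _ _ => ⟨fun {F} => ⟨fun {c} hc => ⟨?_⟩⟩⟩⟩⟩
    apply PresheafOfModules.evaluationJointlyReflectsLimits
    intro x
    let ev := PresheafOfModules.evaluation.{u} X.ringSheaf x
    let e : colim (J := J) ⋙ ev ≅ (Functor.whiskeringRight J _ _).obj ev ⋙ colim :=
      preservesColimitNatIso (J := J) ev
    exact (IsLimit.postcomposeHomEquiv (Functor.isoWhiskerLeft F e) _).1
        (IsLimit.ofIsoLimit
          (isLimitOfPreserves ((Functor.whiskeringRight J _ _).obj ev ⋙ colim) hc)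
          (Cone.ext (e.symm.app _) (fun k ↦ (NatIso.naturality_2 e.symm _).symm)))

instance : HasSeparator X.Mod where
  hasSeparator := ⟨_, (PresheafOfModules.freeYoneda.isSeparating X.ringSheaf).isSeparator_coproduct⟩

instance : IsGrothendieckAbelian.{u} X.Mod where

/-- A finite space is a finite ringed space with flat restriction morphisms `O_x → O_y`. -/
class IsFiniteSpace : Prop where
  flat {x y : X.carrier} (f : x ⟶ y) : (X.O.map f).hom.Flat

/-- The natural morphism of `O_y`-modules `O_y ⊗_{O_x} M_x → M_y` induced by the restriction map. -/
def tensorRes {x y : X.carrier} (f : x ⟶ y) :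
    X.stalk x ⋙ ModuleCat.extendScalars (X.O.map f).hom ⟶ X.stalk y :=
  Functor.whiskerRight
      (show X.stalk x ⟶ X.stalk y ⋙ ModuleCat.restrictScalars (X.O.map f).hom from
        PresheafOfModules.restriction X.ringSheaf f.op.op)
      (ModuleCat.extendScalars (X.O.map f).hom) ≫
    Functor.whiskerLeft (X.stalk y)
      (ModuleCat.extendRestrictScalarsAdj (X.O.map f).hom).counit

/-- An `O`-module `M` is quasi-coherent if `O_y ⊗_{O_x} M_x → M_y` is an isomorphism for all
`x ≤ y`. -/
def IsQcoh : ObjectProperty X.Mod := fun M =>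
  ∀ ⦃x y : X.carrier⦄ (f : x ⟶ y), IsIso ((X.tensorRes f).app M)


/-- The points of the product, with the product order (that is, the product topology). -/
def ProdCarrier : Type u := X.carrier × Y.carrier

instance : PartialOrder (X.ProdCarrier Y) := inferInstanceAs (PartialOrder (X.carrier × Y.carrier))
instance : Finite (X.ProdCarrier Y) := inferInstanceAs (Finite (X.carrier × Y.carrier))


/-- The ring morphism `f ⊗ g`. -/
def tensorMap {A A' B B' : Type u} [CommRing A] [CommRing A'] [CommRing B] [CommRing B']
    (f : A →+* A') (g : B →+* B') : TensorProduct ℤ A B →+* TensorProduct ℤ A' B' :=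
  (Algebra.TensorProduct.map f.toIntAlgHom g.toIntAlgHom).toRingHom

lemma ringHom_ext_tensor {A B C : Type u} [CommRing A] [CommRing B] [CommRing C]
    {f g : TensorProduct ℤ A B →+* C} (h : ∀ a b, f (a ⊗ₜ b) = g (a ⊗ₜ b)) : f = g := by
  apply RingHom.ext
  intro t
  induction t with
  | zero => simp
  | add a b ha hb => rw [map_add, map_add, ha, hb]
  | tmul a b => exact h a b

/-- The product of finite ringed spaces (over `ℤ`), with `O_{(x,y)} = O_x ⊗_ℤ O_y`. -/
def prod : FiniteRingedSpace.{u} where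
  carrier := X.ProdCarrier Y
  O :=
    { obj p := CommRingCat.of (TensorProduct ℤ (X.O.obj p.1) (Y.O.obj p.2))
      map f := CommRingCat.ofHom
        (tensorMap (X.O.map (homOfLE f.le.1)).hom (Y.O.map (homOfLE f.le.2)).hom)
      map_id p := by
        apply CommRingCat.hom_ext
        apply ringHom_ext_tensor
        intro a b
        change (X.O.map (𝟙 p.1)).hom a ⊗ₜ[ℤ] (Y.O.map (𝟙 p.2)).hom b = a ⊗ₜ b
        simp
      map_comp {p q r} f g := by
        apply CommRingCat.hom_ext
        apply ringHom_ext_tensor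
        intro a b
        change (X.O.map (homOfLE f.le.1 ≫ homOfLE g.le.1)).hom a ⊗ₜ[ℤ]
            (Y.O.map (homOfLE f.le.2 ≫ homOfLE g.le.2)).hom b =
          (X.O.map (homOfLE g.le.1)).hom ((X.O.map (homOfLE f.le.1)).hom a) ⊗ₜ
            (Y.O.map (homOfLE g.le.2)).hom ((Y.O.map (homOfLE f.le.2)).hom b)
        rw [X.O.map_comp, Y.O.map_comp]
        rfl }

/-- A morphism of finite ringed spaces: a continuous (that is, monotone) map `f` with compatible
ring morphisms `O_{Y,f(x)} → O_{X,x}`. -/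
structure Hom where
  /-- the continuous map -/
  base : X.carrier →o Y.carrier
  /-- the morphism of sheaves of rings, on stalks -/
  comap : base.monotone.functor ⋙ Y.O ⟶ X.O

/-- The diagonal morphism `δ : X → X × X`, with `O_x ⊗ O_x → O_x` the multiplication. -/
def diag : Hom X (X.prod X) where
  base :=
    { toFun x := (show X.ProdCarrier X from (x, x))
      monotone' _ _ h := ⟨h, h⟩ }
  comap :=
    { app x := CommRingCat.ofHom (Algebra.TensorProduct.lmul' ℤ (S := X.O.obj x)).toRingHom
      naturality x y f := by
        apply CommRingCat.hom_ext
        apply ringHom_ext_tensor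
        intro a b
        exact ((X.O.map f).hom.map_mul a b).symm }

variable {X Y}

/-- The ring morphism `O_{Y,y} → O_{X,x}` for `x ∈ f⁻¹(U_y)`. -/
def Hom.ringMap (f : Hom X Y) {x : X.carrier} {y : Y.carrier} (h : y ≤ f.base x) :
    Y.O.obj y →+* X.O.obj x :=
  (f.comap.app x).hom.comp (Y.O.map (homOfLE h)).hom

lemma Hom.ringMap_res (f : Hom X Y) {x x' : X.carrier} {y : Y.carrier} (h : y ≤ f.base x)
    (h' : x ≤ x') (a : Y.O.obj y) :
    (X.O.map (homOfLE h')).hom (f.ringMap h a) = f.ringMap (h.trans (f.base.monotone h')) a := by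
  have := congr($(f.comap.naturality (homOfLE h')) (Y.O.map (homOfLE h) a))
  refine this.symm.trans ?_
  change (f.comap.app x').hom ((Y.O.map (homOfLE (f.base.monotone h'))).hom
    ((Y.O.map (homOfLE h)).hom a)) = _
  rw [← CommRingCat.comp_apply, ← Y.O.map_comp]
  rfl

lemma Hom.ringMap_map (f : Hom X Y) {x : X.carrier} {y y' : Y.carrier} (h : y' ≤ f.base x)
    (h' : y ≤ y') (a : Y.O.obj y) :
    f.ringMap h ((Y.O.map (homOfLE h')).hom a) = f.ringMap (h'.trans h) a := by
  change (f.comap.app x).hom ((Y.O.map (homOfLE h)).hom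
    ((Y.O.map (homOfLE h')).hom a)) = _
  rw [← CommRingCat.comp_apply, ← Y.O.map_comp]
  rfl

/-- The `O_{Y,y}`-module `Γ(f⁻¹(U_y), M)` of sections of `M`: families of elements of the stalks
`M_x`, `x ∈ f⁻¹(U_y)`, that are compatible with the restriction maps. -/
def sectionsOver (f : Hom X Y) (M : X.Mod) (y : Y.carrier) :
    Submodule (Y.O.obj y) (∀ x : {x : X.carrier // y ≤ f.base x},
      (ModuleCat.restrictScalars (f.ringMap x.2)).obj ((X.stalk x.1).obj M)) where
  carrier := {s | ∀ (x x' : {x : X.carrier // y ≤ f.base x}) (h : x.1 ≤ x'.1),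
    res M h (s x) = s x'}
  add_mem' {s t} hs ht x x' h := by
    have h1 := hs x x' h
    have h2 := ht x x' h
    exact ((res M h).map_add (s x) (t x)).trans (congrArg₂ _ h1 h2)
  zero_mem' x x' h := (res M h).map_zero
  smul_mem' a s hs x x' h := by
    refine (res_smul M h (f.ringMap x.2 a) (s x)).trans ?_
    rw [f.ringMap_res, hs x x' h]
    rfl

/-- The data of the direct image `f_* M`, with `(f_* M)_y = Γ(f⁻¹(U_y), M)`. -/
def pushforwardData (f : Hom X Y) (M : X.Mod) : Y.ModData where
  stalk y := sectionsOver f M y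
  res {y y'} h :=
    { toFun s := ⟨fun x => s.1 ⟨x.1, h.trans x.2⟩, fun x x' hx =>
        s.2 ⟨x.1, h.trans x.2⟩ ⟨x'.1, h.trans x'.2⟩ hx⟩
      map_zero' := rfl
      map_add' _ _ := rfl }
  res_smul {y y'} h a s := by
    apply Subtype.ext
    funext x
    change f.ringMap (h.trans x.2) a • (show (X.stalk x.1).obj M from s.1 ⟨x.1, h.trans x.2⟩) =
      f.ringMap x.2 ((Y.O.map (homOfLE h)).hom a) •
        (show (X.stalk x.1).obj M from s.1 ⟨x.1, h.trans x.2⟩)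
    rw [f.ringMap_map]
  res_self _ := rfl
  res_res _ _ _ := rfl

/-- The direct image functor `f_*`. -/
def pushforward (f : Hom X Y) : X.Mod ⥤ Y.Mod where
  obj M := (pushforwardData f M).toMod
  map {_ N} g := homMk
    (fun y =>
      { toFun s := (⟨fun x => (X.stalk x.1).map g (s.1 x), fun x x' h =>
          (res_app g h (s.1 x)).trans (congrArg ((X.stalk x'.1).map g) (s.2 x x' h))⟩ :
            sectionsOver f N y)
        map_add' s t := Subtype.ext (funext fun x =>
          map_add ((X.stalk x.1).map g).hom (s.1 x) (t.1 x))
        map_smul' a s := Subtype.ext (funext fun x =>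
          map_smul ((X.stalk x.1).map g).hom (f.ringMap x.2 a) (s.1 x)) })
    (fun _ _ => rfl)
  map_id _ := rfl
  map_comp _ _ := rfl

instance (f : Hom X Y) : (pushforward f).Additive where
  map_add := rfl

/-- `O` as an `O`-module. -/
def structureModule (X : FiniteRingedSpace.{u}) : X.Mod := PresheafOfModules.unit _

/-- A schematic finite space: a finite space such that `R^i δ_* O` is quasi-coherent for all
`i ≥ 0`. -/
class IsSchematic (X : FiniteRingedSpace.{u}) : Prop extends IsFiniteSpace X where
  isQcoh (i : ℕ) :
    (X.prod X).IsQcoh (((pushforward X.diag).rightDerived i).obj X.structureModule)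

/-- A semi-separated finite space: a schematic finite space such that `R^i δ_* O = 0` for all
`i > 0`. -/
class IsSemiSeparated (X : FiniteRingedSpace.{u}) : Prop extends IsSchematic X where
  isZero (i : ℕ) (hi : 0 < i) :
    IsZero (((pushforward X.diag).rightDerived i).obj X.structureModule)

/-- The chains `x_0 < ... < x_p` of points that belong to `U_y`. -/
def Chain (X : FiniteRingedSpace.{u}) (p : ℕ) (y : X.carrier) : Type u :=
  {c : Fin (p + 1) → X.carrier // StrictMono c ∧ y ≤ c 0}

namespace Chain
variable {p : ℕ} {y : X.carrier}
/-- The last point `x_p` of a chain. -/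
def last (c : Chain X p y) : X.carrier := c.1 (Fin.last p)

lemma le_last (c : Chain X p y) : y ≤ c.last :=
  c.2.2.trans (c.2.1.monotone (Fin.zero_le _))

/-- The chain obtained by omitting `x_k`. -/
def face (k : Fin (p + 2)) (c : Chain X (p + 1) y) : Chain X p y :=
  ⟨c.1 ∘ k.succAbove, c.2.1.comp (Fin.strictMono_succAbove k),
    c.2.2.trans (c.2.1.monotone (Fin.zero_le _))⟩

lemma last_face_le (k : Fin (p + 2)) (c : Chain X (p + 1) y) : (c.face k).last ≤ c.last :=
  c.2.1.monotone (Fin.le_last _)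

/-- A chain in `U_{y'}` is a chain in `U_y` if `y ≤ y'`. -/
def restrict {y y' : X.carrier} (h : y ≤ y') (c : Chain X p y') : Chain X p y :=
  ⟨c.1, c.2.1, h.trans c.2.2⟩

end Chain

lemma O_map_map {x y z : X.carrier} (h : x ≤ y) (h' : y ≤ z) (a : X.O.obj x) :
    (X.O.map (homOfLE h')).hom ((X.O.map (homOfLE h)).hom a) =
      (X.O.map (homOfLE (h.trans h'))).hom a := by
  rw [← CommRingCat.comp_apply, ← X.O.map_comp]
  rfl

/-- The data of the module `C^p M`, with `(C^p M)(U_y) = ∏_{(x_0 < ... < x_p) ∈ U_y} M_{x_p}`. -/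
def standardData (p : ℕ) (M : X.Mod) : X.ModData where
  stalk y := ∀ c : Chain X p y,
    (ModuleCat.restrictScalars (X.O.map (homOfLE c.le_last)).hom).obj ((X.stalk c.last).obj M)
  res {y y'} h :=
    { toFun s c := s (c.restrict h)
      map_zero' := rfl
      map_add' _ _ := rfl }
  res_smul {y y'} h a s := by
    funext c
    change (X.O.map (homOfLE (h.trans c.le_last))).hom a •
        (show (X.stalk c.last).obj M from s (c.restrict h)) =
      (X.O.map (homOfLE c.le_last)).hom ((X.O.map (homOfLE h)).hom a) •
        (show (X.stalk c.last).obj M from s (c.restrict h))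
    rw [O_map_map]
  res_self _ := rfl
  res_res _ _ _ := rfl

variable (X) in
/-- The functor `M ↦ C^p M`. -/
def standard (p : ℕ) : X.Mod ⥤ X.Mod where
  obj M := (standardData p M).toMod
  map {M N} g := homMk
    (fun y =>
      { toFun (s : (standardData p M).stalk y) :=
          (fun c => (X.stalk c.last).map g (s c) : (standardData p N).stalk y)
        map_add' s t := funext fun c =>
          map_add ((X.stalk c.last).map g).hom (s c) (t c)
        map_smul' a s := funext fun c =>
          map_smul ((X.stalk c.last).map g).hom ((X.O.map (homOfLE c.le_last)).hom a) (s c) })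
    (fun _ _ => rfl)
  map_id _ := rfl
  map_comp _ _ := rfl

instance (p : ℕ) : (standard X p).Additive where
  map_add := rfl

variable (X) in
/-- The `k`-th term of the differential: it sends `s` to the family whose component at
`x_0 < ... < x_{p+1}` is the image in `M_{x_{p+1}}` of the component of `s` at the chain with `x_k`
omitted. The restriction map that is involved is the identity unless `k = p + 1`. -/
def coface (p : ℕ) (k : Fin (p + 2)) : standard X p ⟶ standard X (p + 1) where
  app M := homMk
    (fun y =>
      { toFun (s : (standardData p M).stalk y) :=
          (fun c => res M (c.last_face_le k) (s (c.face k)) : (standardData (p + 1) M).stalk y)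
        map_add' s t := funext fun c =>
          map_add (res M (c.last_face_le k)) (s (c.face k)) (t (c.face k))
        map_smul' a s := funext fun c => by
          refine (res_smul M (c.last_face_le k) ((X.O.map (homOfLE (c.face k).le_last)).hom a)
            (s (c.face k))).trans ?_
          rw [O_map_map]
          rfl })
    (fun _ _ => rfl)
  naturality M N g := by
    ext y s
    exact funext fun c => res_app g (c.last_face_le k) (s (c.face k))

variable (X) in
/-- The differential `C^p M → C^{p+1} M`, an alternating sum. -/
def differential (p : ℕ) : standard X p ⟶ standard X (p + 1) :=
  ∑ k : Fin (p + 2), (-1 : ℤ) ^ (k : ℕ) • coface X p k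

variable (X) in
/-- The natural morphism `M → C^0 M`. -/
def augmentation : 𝟭 X.Mod ⟶ standard X 0 where
  app M := homMk
    (fun y =>
      { toFun (m : (X.stalk y).obj M) :=
          (fun c => res M c.le_last m : (standardData 0 M).stalk y)
        map_add' s t := funext fun c => map_add (res M c.le_last) s t
        map_smul' a s := funext fun c => res_smul M c.le_last a s })
    (fun h m => funext fun c => (res_res M h c.le_last m).symm)
  naturality M N g := by
    ext y s
    exact funext fun c => res_app g c.le_last s
lemma coface_comp_coface {p : ℕ} {i j : Fin (p + 2)} (h : i ≤ j) :
    coface X p j ≫ coface X (p + 1) i.castSucc = coface X p i ≫ coface X (p + 1) j.succ := by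
  have key : ∀ (M : X.Mod) (y : X.carrier) (s : (standardData p M).stalk y)
      (c₁ c₂ : Chain X p y) (z : X.carrier) (h₁ : c₁.last ≤ z) (h₂ : c₂.last ≤ z),
      c₁ = c₂ → res M h₁ (s c₁) = res M h₂ (s c₂) := by
    rintro M y s c₁ _ z h₁ h₂ rfl
    rfl
  ext M y s
  refine funext fun c => ?_
  refine (res_res M _ _ _).trans (Eq.trans ?_ (res_res M _ _ _).symm)
  refine key M y.unop.unop s _ _ _ _ _ ?_
  apply Subtype.ext
  funext a
  exact congrArg c.1 (congr($(SimplexCategory.δ_comp_δ h).toOrderHom a)).symm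

variable (X) in
lemma differential_comp_differential (p : ℕ) :
    differential X p ≫ differential X (p + 1) = 0 := by
  simp only [differential, Preadditive.comp_sum, Preadditive.sum_comp, ← Finset.sum_product']
  let P := Fin (p + 3) × Fin (p + 2)
  let S : Finset P := {ij : P | (ij.1 : ℕ) ≤ (ij.2 : ℕ)}
  rw [Finset.univ_product_univ, ← Finset.sum_add_sum_compl S, ← eq_neg_iff_add_eq_zero,
    ← Finset.sum_neg_distrib]
  let φ : ∀ ij : P, ij ∈ S → P := fun ij hij =>
    (ij.2.succ, Fin.castLT ij.1 (lt_of_le_of_lt (Finset.mem_filter.mp hij).right (Fin.is_lt ij.2)))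
  apply Finset.sum_bij φ
  · intro ij hij
    simp_rw [S, φ, Finset.compl_filter, Finset.mem_filter_univ, Fin.val_succ,
      Fin.val_castLT] at hij ⊢
    lia
  · rintro ⟨i, j⟩ hij ⟨i', j'⟩ hij' h
    have h1 := congrArg (fun t => (t.1 : ℕ)) h
    have h2 := congrArg (fun t => (t.2 : ℕ)) h
    simp only [φ, Fin.val_succ, Fin.val_castLT] at h1 h2
    refine Prod.ext (Fin.ext ?_) (Fin.ext ?_)
    · exact h2
    · exact Nat.succ_injective h1
  · rintro ⟨i', j'⟩ hij'
    simp_rw [S, Finset.compl_filter, Finset.mem_filter_univ, not_le] at hij'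
    refine ⟨(j'.castSucc, i'.pred ?_), ?_, ?_⟩
    · rintro rfl
      simp only [Fin.val_zero, not_lt_zero] at hij'
    · simp only [S, Finset.mem_filter_univ, Fin.val_castSucc, Fin.val_pred]
      lia
    · simp only [φ, Fin.castLT_castSucc, Fin.succ_pred]
  · rintro ⟨i, j⟩ hij
    have hij' : (i : ℕ) ≤ j := by simpa [S] using hij
    have h := coface_comp_coface (X := X) (p := p) (i := i.castLT (by lia)) (j := j)
      (by simpa [Fin.le_def] using hij')
    simp only [Fin.castSucc_castLT] at h
    simp only [φ, Preadditive.zsmul_comp, Preadditive.comp_zsmul, smul_smul, ← neg_smul, h]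
    congr 1
    simp only [Fin.val_succ, Fin.val_castLT]
    ring

variable (X) in
lemma differential_comp_differential_app (M : X.Mod) (p : ℕ) :
    (differential X p).app M ≫ (differential X (p + 1)).app M = 0 :=
  congrArg (fun α => NatTrans.app α M) (differential_comp_differential X p)

variable (X) in
/-- The standard complex `C^• M` of an `O`-module, as a functor. -/
def standardComplex : X.Mod ⥤ CochainComplex X.Mod ℕ where
  obj M := CochainComplex.of (fun p => (standard X p).obj M) (fun p => (differential X p).app M)
    (differential_comp_differential_app X M)
  map f := CochainComplex.ofHom (fun p => (standard X p).map f) (fun p => by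
    have h (M : X.Mod) := CochainComplex.of_d (fun p => (standard X p).obj M)
      (fun p => (differential X p).app M) p
    exact (congrArg (_ ≫ ·) (h _)).trans (((differential X p).naturality f).trans
      (congrArg (· ≫ _) (h _).symm)))
  map_id _ := by
    apply HomologicalComplex.hom_ext
    intro p
    exact (standard X p).map_id _
  map_comp _ _ := by
    apply HomologicalComplex.hom_ext
    intro p
    exact (standard X p).map_comp _ _

instance : (standardComplex X).Additive where
  map_add := by
    intros
    apply HomologicalComplex.hom_ext
    intro p
    exact (standard X p).map_add

/-- The total degree `q + p` and the signs `1`, `(-1)^q` of the simple complex of a bicomplex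
indexed by `q : ℤ` and `p : ℕ`. -/
instance totalShape : TotalComplexShape (ComplexShape.up ℤ) (ComplexShape.up ℕ)
    (ComplexShape.up ℤ) where
  π := fun ⟨q, p⟩ => q + p
  ε₁ := fun _ => 1
  ε₂ := fun ⟨q, _⟩ => q.negOnePow
  rel₁ {q q'} h p := by
    obtain rfl : q + 1 = q' := h
    change q + p + 1 = q + 1 + p
    ring
  rel₂ q {p p'} h := by
    obtain rfl : p + 1 = p' := h
    change q + p + 1 = q + (p + 1 : ℕ)
    push_cast
    ring
  ε₂_ε₁ {q q'} {p p'} h h' := by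
    obtain rfl : q + 1 = q' := h
    simp [Int.negOnePow_succ]

variable (X)

instance hasTotal (K : HomologicalComplex₂ X.Mod (ComplexShape.up ℤ) (ComplexShape.up ℕ)) :
    K.HasTotal (ComplexShape.up ℤ) := fun _ => inferInstance


lemma augmentation_comp_differential : augmentation X ≫ differential X 0 = 0 := by
  have h : augmentation X ≫ coface X 0 0 = augmentation X ≫ coface X 0 1 := by
    ext M y m
    refine funext fun c => ?_
    exact (res_res M _ _ _).trans (res_res M _ _ _).symm
  simp [differential, Fin.sum_univ_two, h]

/-- The bicomplex `C^p M^q` of a complex `M` of `O`-modules. -/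
abbrev bicomplex : CochainComplex X.Mod ℤ ⥤
    HomologicalComplex₂ X.Mod (ComplexShape.up ℤ) (ComplexShape.up ℕ) :=
  (standardComplex X).mapHomologicalComplex (ComplexShape.up ℤ)

/-- The functor `M ↦ C^• M` on complexes of `O`-modules: the simple complex of the bicomplex
`C^p M^q`. -/
def totalStandard : CochainComplex X.Mod ℤ ⥤ CochainComplex X.Mod ℤ :=
  X.bicomplex ⋙ HomologicalComplex₂.totalFunctor X.Mod (ComplexShape.up ℤ) (ComplexShape.up ℕ)
      (ComplexShape.up ℤ)



/-- The morphism `M^q → C^0 M^q`. -/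
def augmentationAt (M : CochainComplex X.Mod ℤ) (q : ℤ) :
    M.X q ⟶ ((X.bicomplex.obj M).X q).X 0 :=
  (augmentation X).app (M.X q)

/-- The natural morphism `M → C^• M`, in degree `q`. -/
def toTotalStandardApp (M : CochainComplex X.Mod ℤ) (q : ℤ) :
    M.X q ⟶ ((X.bicomplex.obj M).total (ComplexShape.up ℤ)).X q :=
  X.augmentationAt M q ≫ (X.bicomplex.obj M).ιTotal (ComplexShape.up ℤ) q 0 q (add_zero q)

lemma augmentationAt_comp_d (M : CochainComplex X.Mod ℤ) (q : ℤ) :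
    X.augmentationAt M q ≫ ((X.bicomplex.obj M).X q).d 0 1 = 0 :=
  (congrArg (_ ≫ ·) (CochainComplex.of_d (fun p => (standard X p).obj (M.X q))
      (fun p => (differential X p).app (M.X q)) 0)).trans
    (congrArg (fun α => NatTrans.app α (M.X q)) (augmentation_comp_differential X))

lemma augmentationAt_comp_d_f (M : CochainComplex X.Mod ℤ) (q q' : ℤ) :
    X.augmentationAt M q ≫ ((X.bicomplex.obj M).d q q').f 0 =
      M.d q q' ≫ X.augmentationAt M q' :=
  ((augmentation X).naturality (M.d q q')).symm

lemma augmentationAt_naturality {M N : CochainComplex X.Mod ℤ} (f : M ⟶ N) (q : ℤ) :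
    X.augmentationAt M q ≫ ((X.bicomplex.map f).f q).f 0 = f.f q ≫ X.augmentationAt N q :=
  ((augmentation X).naturality (f.f q)).symm

lemma toTotalStandardApp_comm (M : CochainComplex X.Mod ℤ) (q : ℤ) :
    X.toTotalStandardApp M q ≫ ((X.bicomplex.obj M).total (ComplexShape.up ℤ)).d q (q + 1) =
      M.d q (q + 1) ≫ X.toTotalStandardApp M (q + 1) := by
  rw [HomologicalComplex₂.total_d, toTotalStandardApp, Category.assoc, Preadditive.comp_add,
    HomologicalComplex₂.ι_D₁, HomologicalComplex₂.ι_D₂,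
    HomologicalComplex₂.d₁_eq (i₁' := q + 1) (h := rfl) (h' := add_zero (q + 1)),
    HomologicalComplex₂.d₂_eq _ (ComplexShape.up ℤ) q (i₂ := 0) (i₂' := 1) rfl (q + 1) rfl]
  have e : ComplexShape.ε₁ (ComplexShape.up ℤ) (ComplexShape.up ℕ) (ComplexShape.up ℤ)
    (q, 0) = 1 := rfl
  rw [e, one_smul, Preadditive.comp_add, Linear.comp_units_smul, ← Category.assoc, ← Category.assoc,
    augmentationAt_comp_d, augmentationAt_comp_d_f, zero_comp, smul_zero, add_zero,
    toTotalStandardApp, Category.assoc]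

/-- The natural morphism `M → C^• M` of complexes of `O`-modules. -/
def toTotalStandard : 𝟭 (CochainComplex X.Mod ℤ) ⟶ X.totalStandard where
  app M := CochainComplex.ofHom (X.toTotalStandardApp M) (X.toTotalStandardApp_comm M)
  naturality M N f := by
    apply HomologicalComplex.hom_ext
    intro q
    change f.f q ≫ X.toTotalStandardApp N q = X.toTotalStandardApp M q ≫
      (HomologicalComplex₂.total.map (X.bicomplex.map f) (ComplexShape.up ℤ)).f q
    rw [toTotalStandardApp, toTotalStandardApp, Category.assoc, HomologicalComplex₂.ιTotal_map,
      ← Category.assoc, ← augmentationAt_naturality, Category.assoc]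

lemma isIso_app_of_isLimit {C D : Type*} [Category* C] [Category* D] {F G : C ⥤ D} (τ : F ⟶ G)
    {J : Type*} [Category* J] {K : J ⥤ C} [PreservesLimit K F] [PreservesLimit K G]
    {c : Cone K} (hc : IsLimit c) (h : ∀ j, IsIso (τ.app (K.obj j))) : IsIso (τ.app c.pt) := by
  have : IsIso (Functor.whiskerLeft K τ) := by
    have : ∀ j, IsIso ((Functor.whiskerLeft K τ).app j) := h
    exact NatIso.isIso_of_isIso_app _
  have e : τ.app c.pt = ((isLimitOfPreserves F hc).conePointsIsoOfNatIso
      (isLimitOfPreserves G hc) (asIso (Functor.whiskerLeft K τ))).hom := by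
    refine (isLimitOfPreserves G hc).hom_ext fun j => ?_
    rw [IsLimit.conePointsIsoOfNatIso_hom_comp]
    exact (τ.naturality (c.π.app j)).symm
  rw [e]
  infer_instance

lemma isIso_app_of_isColimit {C D : Type*} [Category* C] [Category* D] {F G : C ⥤ D} (τ : F ⟶ G)
    {J : Type*} [Category* J] {K : J ⥤ C} [PreservesColimit K F] [PreservesColimit K G]
    {c : Cocone K} (hc : IsColimit c) (h : ∀ j, IsIso (τ.app (K.obj j))) :
    IsIso (τ.app c.pt) := by
  have : IsIso (Functor.whiskerLeft K τ) := by
    have : ∀ j, IsIso ((Functor.whiskerLeft K τ).app j) := h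
    exact NatIso.isIso_of_isIso_app _
  have e : τ.app c.pt = ((isColimitOfPreserves F hc).coconePointsIsoOfNatIso
      (isColimitOfPreserves G hc) (asIso (Functor.whiskerLeft K τ))).hom := by
    refine (isColimitOfPreserves F hc).hom_ext fun j => ?_
    rw [IsColimit.comp_coconePointsIsoOfNatIso_hom]
    exact τ.naturality (c.ι.app j)
  rw [e]
  infer_instance

section
variable [X.IsFiniteSpace]

instance {x y : X.carrier} (f : x ⟶ y) :
    PreservesFiniteLimits (ModuleCat.extendScalars.{u, u, u} (X.O.map f).hom) :=
  ModuleCat.preservesFiniteLimits_extendScalars_of_flat (IsFiniteSpace.flat f)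

instance {x y : X.carrier} (f : x ⟶ y) :
    PreservesColimitsOfSize.{0, 0} (ModuleCat.extendScalars.{u, u, u} (X.O.map f).hom) :=
  (ModuleCat.extendRestrictScalarsAdj (X.O.map f).hom).leftAdjoint_preservesColimits

instance isQcoh_limits (J : Type) [SmallCategory J] [FinCategory J] :
    X.IsQcoh.IsClosedUnderLimitsOfShape J where
  limitsOfShape_le := by
    rintro M ⟨h⟩ x y f
    have := PreservesFiniteLimits.preservesFiniteLimits (F := X.stalk x ⋙
      ModuleCat.extendScalars.{u, u, u} (X.O.map f).hom) J
    have := PreservesFiniteLimits.preservesFiniteLimits (F := X.stalk y) J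
    exact isIso_app_of_isLimit (X.tensorRes f) (c := Cone.mk M h.π) h.isLimit
      (fun j => h.prop_diag_obj j f)

instance : X.IsQcoh.IsClosedUnderFiniteProducts where
  isClosedUnderLimitsOfShape J _ := by
    have := Fintype.ofFinite J
    infer_instance

instance : X.IsQcoh.IsClosedUnderKernels where
  kernels_le := by
    rintro M ⟨f, k, hk, hf⟩ x y g
    refine isIso_app_of_isLimit (X.tensorRes g) hk ?_
    rintro (_ | _)
    exacts [hf.1 g, hf.2 g]

instance : X.IsQcoh.IsClosedUnderCokernels where
  cokernels_le := by
    rintro M ⟨f, k, hk, hf⟩ x y g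
    refine isIso_app_of_isColimit (X.tensorRes g) hk ?_
    rintro (_ | _)
    exacts [hf.1 g, hf.2 g]

instance : X.IsQcoh.ContainsZero where
  exists_zero := ⟨⊤_ X.Mod, (isZero_zero _).of_iso (terminalIsTerminal.uniqueUpToIso (isZero_zero _).isTerminal), X.IsQcoh.prop_terminal⟩

/-- The category of quasi-coherent modules on a finite space, an abelian subcategory of the
category of `O`-modules. -/
abbrev Qcoh : Type (u + 1) := X.IsQcoh.FullSubcategory

/-- A quasi-coherentation functor `Qc`: a right adjoint of the inclusion of the quasi-coherent
modules into the `O`-modules (it is unique up to a unique isomorphism). -/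
structure Quasicoherator where
  /-- the functor `Qc` -/
  functor : X.Mod ⥤ X.Qcoh
  /-- the adjunction -/
  adj : X.IsQcoh.ι ⊣ functor

instance (Qc : X.Quasicoherator) : Qc.functor.Additive :=
  Qc.adj.right_adjoint_additive

/-- The inclusion of the complexes of quasi-coherent modules into the complexes of `O`-modules. -/
abbrev inclusionComplex : CochainComplex X.Qcoh ℤ ⥤ CochainComplex X.Mod ℤ :=
  X.IsQcoh.ι.mapHomologicalComplex (ComplexShape.up ℤ)

namespace Quasicoherator
variable {X} (Qc : X.Quasicoherator)

/-- `Qc` applied degreewise to a complex. -/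
abbrev onComplex : CochainComplex X.Mod ℤ ⥤ CochainComplex X.Qcoh ℤ :=
  Qc.functor.mapHomologicalComplex (ComplexShape.up ℤ)

/-- The natural morphism `M → Qc(M)` for a complex `M` of quasi-coherent modules. -/
def unitComplex : 𝟭 (CochainComplex X.Qcoh ℤ) ⟶ X.inclusionComplex ⋙ Qc.onComplex where
  app M :=
    { f n := Qc.adj.unit.app (M.X n)
      comm' m n _ := (Qc.adj.unit.naturality (M.d m n)).symm }
  naturality M N f := by
    apply HomologicalComplex.hom_ext
    intro n
    exact Qc.adj.unit.naturality (f.f n)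

end Quasicoherator

end

end FiniteRingedSpace

end

/-! The argument separates a general fact about additive functors `F` on `O`-modules from two facts
about `Qc`.

General fact. `C^p M` is a finite direct sum, over the chains `x_0 < … < x_p`, of skyscrapers at
`x_0` with value `M_{x_p}` (`sum_proj_comp_incl`). The standard resolution of a skyscraper at `x`
has an `O`-linear contraction, which appends `x` to chains, so every additive `F` keeps the standard
resolution of `C^p M` exact (`standard_isGood`). On the stalk at `y` the standard resolution of any
module contracts by prepending `y` (`stalk_isContractible`), so `M → C^• M` is a resolution. If `F`
is exact on skyscrapers (`SkyExact`), every `F ∘ C^p` is exact; as `X` is finite, only finitely many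
`C^p` are nonzero, and `F(C^• -)` preserves quasi-isomorphisms of unbounded complexes
(`SkyExact.quasiIso`). Hence `F(C^• -)` computes the right derived functors of `F`. A module is
called good for `F` (`IsGood`) if `F` keeps its standard resolution exact. It remains to show that
`Qc` exists, is exact on skyscrapers, and has all quasi-coherent modules good.

Local modules. Let `j : U_x → X` be the inclusion. The functor `j_* j^*` (`nearby x`) is the slice
of `δ_*` over `{x} × X`, so semi-separatedness says that `j_* j^* O` is quasi-coherent and that its
higher analogues vanish. This passes from `O` to `O ⊗ N` with `N` free, because the functors
involved are determined by finitely many stalks (`Finitary`), and then to every `O_x`-module `N` by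
free presentations and descending induction on the degree. Thus `N ↦ j_*(O ⊗ N)` is exact with
quasi-coherent values (`spread_nearby_map_exact`, `isQcoh_nearby_spread`).

Existence of `Qc`. For `G` quasi-coherent, `Hom(G, sky_x L) = Hom(G_x, L) = Hom(G|U_x, O ⊗ L) =
Hom(G, j_*(O ⊗ L))`. So `j_*(O ⊗ L)` is the value of `Qc` at the skyscraper, which gives exactness
on skyscrapers; every module is the kernel of a morphism between finite sums of skyscrapers, which
gives `Qc` everywhere (`hasCoreflection`).

Quasi-coherent modules. The same bijections give `Qc(j_* j^* N) = Qc(sky_x N_x)` for all `N`, so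
stalk contractions show that `j_* j^* M` is good for `Qc` when `M` is quasi-coherent. Embedding `M`
in the sum of the `j_* j^* M`, with quasi-coherent quotient, and shifting dimensions shows that `M`
is good (`isGood_of_isQcoh`). -/

noncomputable section

/-! ### Total complexes of bicomplexes with finitely many columns, and functors that preserve
quasi-isomorphisms. -/

section Homological

variable {A : Type*} [Category* A] [Abelian A]

/-- A presentation of a cochain complex `T` as the total complex of a bicomplex with finitely many
nonzero columns `K 0, K 1, …`: the terms of `T` are direct sums with inclusions `ι` and
projections `π`, and the differential has the usual form, with signs `ε`. -/
structure TotalPresentation (K : ℕ → CochainComplex A ℤ) (δ : ∀ p, K p ⟶ K (p + 1))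
    (T : CochainComplex A ℤ) where
  /-- a bound for the columns -/
  bound : ℕ
  /-- the inclusions -/
  ι (p : ℕ) (q n : ℤ) (h : q + p = n) : (K p).X q ⟶ T.X n
  /-- the projections -/
  π (p : ℕ) (q n : ℤ) (h : q + p = n) : T.X n ⟶ (K p).X q
  ι_π (p : ℕ) (q n : ℤ) (h : q + p = n) : ι p q n h ≫ π p q n h = 𝟙 _
  ι_π_of_ne (p p' : ℕ) (q q' n : ℤ) (h : q + p = n) (h' : q' + p' = n) (hp : p ≠ p') :
    ι p q n h ≫ π p' q' n h' = 0
  sum_π_ι (n : ℤ) : ∑ p ∈ Finset.range (bound + 1),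
    π p (n - p) n (by lia) ≫ ι p (n - p) n (by lia) = 𝟙 _
  /-- the signs -/
  ε : ℤ → ℤˣ
  ι_d (p : ℕ) (q q' n n' : ℤ) (h : q + p = n) (hq : q + 1 = q') (hn : n + 1 = n') :
    ι p q n h ≫ T.d n n' = (K p).d q q' ≫ ι p q' n' (by lia) +
      ε q • ((δ p).f q ≫ ι (p + 1) q n' (by push_cast; lia))

namespace TotalPresentation

variable {K : ℕ → CochainComplex A ℤ} {δ : ∀ p, K p ⟶ K (p + 1)} {T : CochainComplex A ℤ}
  (t : TotalPresentation K δ T)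

include t in
lemma hom_ext_from {n : ℤ} {Z : A} {f g : T.X n ⟶ Z}
    (h : ∀ p q (hq : q + (p : ℕ) = n), t.ι p q n hq ≫ f = t.ι p q n hq ≫ g) : f = g := by
  rw [← Category.id_comp f, ← Category.id_comp g, ← t.sum_π_ι n, Preadditive.sum_comp,
    Preadditive.sum_comp]
  refine Finset.sum_congr rfl fun p _ => ?_
  rw [Category.assoc, Category.assoc, h]

lemma eq_sum {n : ℤ} {Z : A} (x : Z ⟶ T.X n) :
    x = ∑ p ∈ Finset.range (t.bound + 1),
      (x ≫ t.π p (n - p) n (by lia)) ≫ t.ι p (n - p) n (by lia) := by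
  conv_lhs => rw [← Category.comp_id x, ← t.sum_π_ι n, Preadditive.comp_sum]
  simp only [Category.assoc]

include t in
lemma hom_ext_to {n : ℤ} {Z : A} {x y : Z ⟶ T.X n}
    (h : ∀ p q (hq : q + (p : ℕ) = n), p ≤ t.bound → x ≫ t.π p q n hq = y ≫ t.π p q n hq) :
    x = y := by
  rw [t.eq_sum x, t.eq_sum y]
  refine Finset.sum_congr rfl fun p hp => ?_
  rw [h _ _ _ (by simpa [Nat.lt_succ_iff] using hp)]

lemma ι_eq_zero (p : ℕ) (q n : ℤ) (h : q + p = n) (hp : t.bound < p) : t.ι p q n h = 0 := by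
  apply t.hom_ext_to
  intro p' q' h' hp'
  rw [t.ι_π_of_ne _ _ _ _ _ _ _ (by lia), zero_comp]

lemma π_eq_zero (p : ℕ) (q n : ℤ) (h : q + p = n) (hp : t.bound < p) : t.π p q n h = 0 := by
  have := t.ι_π p q n h
  rw [t.ι_eq_zero _ _ _ _ hp, zero_comp] at this
  rw [← Category.comp_id (t.π p q n h), ← this, comp_zero]

lemma d_π_zero (q q' n n' : ℤ) (h : q + (0 : ℕ) = n) (hq : q + 1 = q') (hn : n + 1 = n') :
    T.d n n' ≫ t.π 0 q' n' (by lia) = t.π 0 q n h ≫ (K 0).d q q' := by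
  apply t.hom_ext_from
  intro p q₀ h₀
  rw [← Category.assoc, t.ι_d p q₀ (q₀ + 1) n n' h₀ rfl hn, Preadditive.add_comp,
    Linear.units_smul_comp, Category.assoc, Category.assoc,
    t.ι_π_of_ne _ _ _ _ _ _ _ (Nat.succ_ne_zero p), comp_zero, smul_zero, add_zero]
  by_cases hp : p = 0
  · subst hp
    obtain rfl : q₀ = q := by lia
    subst hq
    rw [t.ι_π, Category.comp_id, ← Category.assoc, t.ι_π, Category.id_comp]
  · rw [t.ι_π_of_ne _ _ _ _ _ _ _ hp, comp_zero, ← Category.assoc, t.ι_π_of_ne _ _ _ _ _ _ _ hp,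
      zero_comp]

lemma d_π_succ (p : ℕ) (q q' n n' : ℤ) (h : q + (p + 1 : ℕ) = n) (hq : q + 1 = q')
    (hn : n + 1 = n') :
    T.d n n' ≫ t.π (p + 1) q' n' (by lia) = t.π (p + 1) q n h ≫ (K (p + 1)).d q q' +
      t.ε q' • (t.π p q' n (by push_cast at h; lia) ≫ (δ p).f q') := by
  apply t.hom_ext_from
  intro p₀ q₀ h₀
  rw [← Category.assoc, t.ι_d p₀ q₀ (q₀ + 1) n n' h₀ rfl hn, Preadditive.add_comp,
    Preadditive.comp_add, Linear.units_smul_comp, Linear.comp_units_smul]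
  simp only [Category.assoc]
  by_cases hp : p₀ = p + 1
  · subst hp
    obtain rfl : q₀ = q := by lia
    subst hq
    rw [t.ι_π, Category.comp_id, t.ι_π_of_ne _ _ _ _ _ _ _ (by lia), comp_zero, smul_zero,
      add_zero, ← Category.assoc, t.ι_π, Category.id_comp, ← Category.assoc (t.ι _ _ _ _),
      t.ι_π_of_ne _ _ _ _ _ _ _ (by lia), zero_comp, smul_zero, add_zero]
  · rw [t.ι_π_of_ne _ _ _ _ _ _ _ hp, comp_zero, ← Category.assoc (t.ι _ _ _ _) (t.π (p + 1) _ _ _),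
      t.ι_π_of_ne _ _ _ _ _ _ _ hp, zero_comp, zero_add, zero_add]
    by_cases hp' : p₀ = p
    · subst hp'
      obtain rfl : q₀ = q' := by push_cast at h; lia
      rw [t.ι_π, Category.comp_id, ← Category.assoc, t.ι_π, Category.id_comp]
    · rw [t.ι_π_of_ne _ _ _ _ _ _ _ (by lia), comp_zero, ← Category.assoc,
        t.ι_π_of_ne _ _ _ _ _ _ _ hp', zero_comp, smul_zero, smul_zero]

include t in
/-- If the columns are acyclic, then so is the total complex. -/
lemma acyclic (hK : ∀ p, (K p).Acyclic) : T.Acyclic := by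
  intro n
  rw [T.exactAt_iff_exact_up_to_refinements (n - 1) n (n + 1) (by simp) (by simp)]
  -- Columns are cleared from the left: the cocycle `x` vanishes in the columns before `k`, and `m`
  -- is at least the number of columns that remain.
  have key : ∀ (m k : ℕ), t.bound + 1 ≤ k + m → ∀ ⦃Z : A⦄ (x : Z ⟶ T.X n) (_ : x ≫ T.d n (n + 1) = 0)
      (_ : ∀ p q (hq : q + (p : ℕ) = n), p < k → x ≫ t.π p q n hq = 0),
      ∃ (Z' : A) (e : Z' ⟶ Z) (_ : Epi e) (y : Z' ⟶ T.X (n - 1)), e ≫ x = y ≫ T.d (n - 1) n := by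
    intro m
    induction m with
    | zero =>
      intro k hk Z x _ hx
      refine ⟨Z, 𝟙 Z, inferInstance, 0, ?_⟩
      rw [zero_comp, Category.id_comp]
      apply t.hom_ext_to
      intro p q hq hp
      rw [hx p q hq (by lia), zero_comp]
    | succ m ih =>
      intro k hk Z x hd hx
      -- The component of `dx` in column `k` is `d x_k ± δ x_{k-1}`, and `x_{k-1} = 0`, so `x_k` is
      -- a cocycle of its column.
      have hxk : (x ≫ t.π k (n - k) n (by lia)) ≫ (K k).d (n - k) (n - k + 1) = 0 := by
        have h0 : x ≫ T.d n (n + 1) ≫ t.π k (n - k + 1) (n + 1) (by lia) = 0 := by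
          rw [← Category.assoc, hd, zero_comp]
        cases k with
        | zero =>
          rw [t.d_π_zero (n - (0 : ℕ)) _ _ _ (by lia) rfl rfl, ← Category.assoc] at h0
          exact h0
        | succ k =>
          rw [t.d_π_succ k (n - (k + 1 : ℕ)) _ _ _ (by lia) rfl rfl, Preadditive.comp_add,
            Linear.comp_units_smul, ← Category.assoc, ← Category.assoc x,
            hx k _ _ (Nat.lt_succ_self k), zero_comp, smul_zero, add_zero] at h0
          exact h0
      obtain ⟨Z₁, e₁, _, y₁, hy₁⟩ := ((K k).exactAt_iff_exact_up_to_refinements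
        (n - k - 1) (n - k) (n - k + 1) (by simp) (by simp)).1 (hK k _) _ hxk
      -- Subtracting the boundary of `y₁` clears column `k`; the only other column that it touches
      -- is `k + 1`.
      obtain ⟨Z₂, e₂, _, y₂, hy₂⟩ := ih (k + 1) (by lia)
        (e₁ ≫ x - (y₁ ≫ t.ι k (n - k - 1) (n - 1) (by lia)) ≫ T.d (n - 1) n)
        (by simp [hd]) (by
          intro p q hq hp
          rw [Preadditive.sub_comp, Category.assoc, Category.assoc, Category.assoc,
            ← Category.assoc (t.ι _ _ _ _), t.ι_d k (n - k - 1) (n - k) _ _ _ (by lia) (by lia),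
            Preadditive.add_comp, Linear.units_smul_comp, Category.assoc, Category.assoc,
            t.ι_π_of_ne (k + 1) p _ _ _ _ _ (by lia), comp_zero, smul_zero, add_zero]
          by_cases hpk : p = k
          · subst hpk
            obtain rfl : q = n - p := by lia
            rw [t.ι_π, Category.comp_id, hy₁, sub_self]
          · rw [hx p q hq (by lia), t.ι_π_of_ne k p _ _ _ _ _ (by lia)]
            simp)
      refine ⟨Z₂, e₂ ≫ e₁, inferInstance, y₂ + e₂ ≫ y₁ ≫ t.ι k (n - k - 1) (n - 1) (by lia), ?_⟩
      rw [Preadditive.add_comp, ← hy₂]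
      simp
  intro Z x hx
  exact key (t.bound + 1) 0 (by lia) x hx (by simp)

/-- If the rows are exact in positive degrees, then an element whose differential has only
the component of degree zero is, up to a boundary, concentrated in the column of index zero. -/
lemma exists_eq_ι_add_d (hδ : ∀ p, δ p ≫ δ (p + 1) = 0)
    (hrow : ∀ p q, (ShortComplex.mk ((δ p).f q) ((δ (p + 1)).f q) (by
      rw [← HomologicalComplex.comp_f, hδ]; rfl)).Exact)
    (n : ℤ) ⦃Z : A⦄ (x : Z ⟶ T.X n)
    (hx : ∀ p q (hq : q + (p + 1 : ℕ) = n + 1), x ≫ T.d n (n + 1) ≫ t.π (p + 1) q (n + 1) hq = 0) :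
    ∃ (Z' : A) (e : Z' ⟶ Z) (_ : Epi e) (x₀ : Z' ⟶ (K 0).X n) (y : Z' ⟶ T.X (n - 1)),
      e ≫ x = x₀ ≫ t.ι 0 n n (by simp) + y ≫ T.d (n - 1) n := by
  -- Columns are cleared from the right: if `k + 1` is the last nonzero one, row exactness gives an
  -- element of column `k` whose boundary cancels that component. The factor `ε` undoes the sign in
  -- the differential.
  have key : ∀ (k : ℕ), ∀ ⦃Z : A⦄ (x : Z ⟶ T.X n)
      (_ : ∀ p q (hq : q + (p + 1 : ℕ) = n + 1),
        x ≫ T.d n (n + 1) ≫ t.π (p + 1) q (n + 1) hq = 0)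
      (_ : ∀ p q (hq : q + (p : ℕ) = n), k < p → x ≫ t.π p q n hq = 0),
      ∃ (Z' : A) (e : Z' ⟶ Z) (_ : Epi e) (x₀ : Z' ⟶ (K 0).X n) (y : Z' ⟶ T.X (n - 1)),
      e ≫ x = x₀ ≫ t.ι 0 n n (by simp) + y ≫ T.d (n - 1) n := by
    intro k
    induction k with
    | zero =>
      intro Z x _ hx
      refine ⟨Z, 𝟙 Z, inferInstance, x ≫ t.π 0 n n (by simp), 0, ?_⟩
      rw [zero_comp, Category.id_comp, add_zero]
      apply t.hom_ext_to
      intro p q hq hp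
      rw [Category.assoc, Category.assoc]
      by_cases hp0 : p = 0
      · subst hp0
        obtain rfl : q = n := by lia
        rw [t.ι_π, Category.comp_id]
      · rw [hx p q hq (by lia), t.ι_π_of_ne _ _ _ _ _ _ _ (by lia)]
        simp
    | succ k ih =>
      intro Z x hd hx
      have h1 : (x ≫ t.π (k + 1) (n - (k + 1 : ℕ)) n (by lia)) ≫ (δ (k + 1)).f _ = 0 := by
        have h0 := hd (k + 1) (n - (k + 1 : ℕ)) (by push_cast; lia)
        rw [t.d_π_succ (k + 1) (n - (k + 1 : ℕ) - 1) _ _ _ (by push_cast; lia) (by lia) rfl,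
          Preadditive.comp_add, ← Category.assoc, hx _ _ _ (Nat.lt_succ_self _), zero_comp,
          zero_add, Linear.comp_units_smul, smul_eq_iff_eq_inv_smul, smul_zero,
          ← Category.assoc] at h0
        exact h0
      obtain ⟨Z₁, e₁, _, (y₁ : Z₁ ⟶ (K k).X (n - (k + 1 : ℕ))), hy₁⟩ :=
        (hrow k (n - (k + 1 : ℕ))).exact_up_to_refinements _ h1
      replace hy₁ : e₁ ≫ x ≫ t.π (k + 1) (n - (k + 1 : ℕ)) n (by lia) = y₁ ≫ (δ k).f _ := hy₁
      obtain ⟨Z₂, e₂, _, x₀, y₂, hy₂⟩ := ih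
        (e₁ ≫ x - (t.ε (n - (k + 1 : ℕ)) • y₁ ≫ t.ι k (n - (k + 1 : ℕ)) (n - 1)
          (by push_cast; lia)) ≫ T.d (n - 1) n)
        (by
          intro p q hq
          rw [Preadditive.sub_comp, Category.assoc, hd, Category.assoc, ← Category.assoc (T.d _ _),
            T.d_comp_d]
          simp) (by
          intro p q hq hp
          rw [Preadditive.sub_comp, Category.assoc, Category.assoc, Linear.units_smul_comp,
            Category.assoc,
            ← Category.assoc (t.ι _ _ _ _), t.ι_d k (n - (k + 1 : ℕ)) _ _ _ _ rfl (by lia),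
            Preadditive.add_comp, Linear.units_smul_comp, Category.assoc, Category.assoc,
            t.ι_π_of_ne k p _ _ _ _ _ (by lia), comp_zero, zero_add, Linear.comp_units_smul,
            smul_smul, Int.units_mul_self, one_smul]
          by_cases hpk : p = k + 1
          · subst hpk
            obtain rfl : q = n - (k + 1 : ℕ) := by lia
            rw [t.ι_π, Category.comp_id, hy₁, sub_self]
          · rw [hx p q hq (by lia), t.ι_π_of_ne (k + 1) p _ _ _ _ _ (by lia)]
            simp)
      refine ⟨Z₂, e₂ ≫ e₁, inferInstance, x₀, y₂ + e₂ ≫ (t.ε (n - (k + 1 : ℕ)) • y₁ ≫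
        t.ι k (n - (k + 1 : ℕ)) (n - 1) (by push_cast; lia)), ?_⟩
      rw [Preadditive.add_comp, ← add_assoc, ← hy₂]
      simp
  exact key t.bound x hx (fun p q hq hp => by rw [t.π_eq_zero _ _ _ _ hp, comp_zero])

include t in
/-- If the rows are resolutions of the terms of a complex `B`, then `B` is quasi-isomorphic to
the total complex. -/
lemma quasiIso (hδ : ∀ p, δ p ≫ δ (p + 1) = 0)
    (hrow : ∀ p q, (ShortComplex.mk ((δ p).f q) ((δ (p + 1)).f q) (by
      rw [← HomologicalComplex.comp_f, hδ]; rfl)).Exact)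
    {B : CochainComplex A ℤ} (e : B ⟶ K 0) (he : e ≫ δ 0 = 0)
    (he' : ∀ q, (ShortComplex.mk (e.f q) ((δ 0).f q) (by
      rw [← HomologicalComplex.comp_f, he]; rfl)).Exact)
    (hmono : ∀ q, Mono (e.f q)) (f : B ⟶ T) (hf : ∀ n, f.f n = e.f n ≫ t.ι 0 n n (by simp)) :
    QuasiIso f := by
  have hπ (n : ℤ) : f.f n ≫ t.π 0 n n (by simp) = e.f n := by
    rw [hf, Category.assoc, t.ι_π, Category.comp_id]
  -- If the boundary of an element of column `0` stays in column `0`, then `δ 0` kills the element,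
  -- which therefore comes from `B`. Injectivity and surjectivity on homology both reduce to this by
  -- `exists_eq_ι_add_d`.
  have h0 (n : ℤ) ⦃Z : A⦄ (x₀ : Z ⟶ (K 0).X n) (y : Z ⟶ T.X (n + 1))
      (hy : x₀ ≫ t.ι 0 n n (by simp) ≫ T.d n (n + 1) = y)
      (hy' : ∀ p q hq, y ≫ t.π (p + 1) q (n + 1) hq = 0) :
      ∃ (Z' : A) (π : Z' ⟶ Z) (_ : Epi π) (b : Z' ⟶ B.X n), π ≫ x₀ = b ≫ e.f n := by
    have h1 : x₀ ≫ (δ 0).f n = 0 := by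
      have := hy' 0 n (by simp)
      have hι := t.ι_π (0 + 1) n (n + 1) (by simp)
      rw [← hy, t.ι_d 0 n _ n _ _ rfl rfl, Category.assoc, Preadditive.add_comp, Category.assoc,
        t.ι_π_of_ne _ _ _ _ _ _ _ (by lia), comp_zero, Linear.units_smul_comp,
        Category.assoc, hι, Category.comp_id, Preadditive.comp_add, comp_zero,
        zero_add (x₀ ≫ _), Linear.comp_units_smul, smul_eq_iff_eq_inv_smul, smul_zero] at this
      exact this
    exact (he' n).exact_up_to_refinements x₀ h1
  rw [quasiIso_iff]
  intro n
  rw [quasiIsoAt_iff_isIso_homologyMap]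
  have hm : Mono (HomologicalComplex.homologyMap f n) := by
    rw [HomologicalComplex.mono_homologyMap_iff_up_to_refinements f (n - 1) n (n + 1)
      (by simp) (by simp)]
    intro Z x hx y hy
    have hyd : ∀ p q (hq : q + (p + 1 : ℕ) = n - 1 + 1),
        y ≫ T.d (n - 1) (n - 1 + 1) ≫ t.π (p + 1) q (n - 1 + 1) hq = 0 := by
      have e1 : n - 1 + 1 = n := by lia
      rw [e1]
      intro p q hq
      rw [← Category.assoc, ← hy, hf, Category.assoc, Category.assoc,
        t.ι_π_of_ne _ _ _ _ _ _ _ (by lia), comp_zero, comp_zero]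
    obtain ⟨Z₁, e₁, _, y₀, y', hy'⟩ := t.exists_eq_ι_add_d hδ hrow (n - 1) y hyd
    have h2 : y₀ ≫ t.ι 0 (n - 1) (n - 1) (by simp) ≫ T.d (n - 1) n = e₁ ≫ x ≫ f.f n := by
      rw [hy, ← Category.assoc e₁, hy']
      simp
    obtain ⟨Z₂, e₂, _, b, hb⟩ := h0 (n - 1) y₀ _ rfl (by
      have e1 : n - 1 + 1 = n := by lia
      rw [e1]
      intro p q hq
      rw [h2, hf]
      simp [t.ι_π_of_ne 0 (p + 1) _ _ _ _ _ (by lia)])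
    refine ⟨Z₂, e₂ ≫ e₁, inferInstance, b, ?_⟩
    have := hmono n
    rw [← cancel_mono (e.f n), Category.assoc, Category.assoc, Category.assoc, ← e.comm,
      ← reassoc_of% hb, ← hπ,
      ← reassoc_of% h2, t.d_π_zero (n - 1) n (n - 1) n (by simp) (by lia) (by lia),
      ← Category.assoc (t.ι _ _ _ _), t.ι_π, Category.id_comp]
  have he : Epi (HomologicalComplex.homologyMap f n) := by
    rw [HomologicalComplex.epi_homologyMap_iff_up_to_refinements f (n - 1) n (n + 1)
      (by simp) (by simp)]
    intro Z x hx
    obtain ⟨Z₁, e₁, _, x₀, y, hy⟩ := t.exists_eq_ι_add_d hδ hrow n x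
      (fun p q hq => by rw [← Category.assoc, hx, zero_comp])
    have h3 : x₀ ≫ t.ι 0 n n (by simp) ≫ T.d n (n + 1) = 0 := by
      have := hy =≫ T.d n (n + 1)
      simpa [hx] using this.symm
    obtain ⟨Z₂, e₂, _, b, hb⟩ := h0 n x₀ 0 h3 (by simp)
    refine ⟨Z₂, e₂ ≫ e₁, inferInstance, b, ?_, e₂ ≫ y, ?_⟩
    · have := hmono (n + 1)
      rw [← cancel_mono (e.f (n + 1)), Category.assoc, ← e.comm, ← reassoc_of% hb, zero_comp]
      have h4 := h3 =≫ t.π 0 (n + 1) (n + 1) (by simp)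
      rw [Category.assoc, Category.assoc, t.d_π_zero n (n + 1) n (n + 1) (by simp) rfl rfl,
        ← Category.assoc (t.ι _ _ _ _), t.ι_π, Category.id_comp, zero_comp] at h4
      rw [h4, comp_zero]
    · rw [Category.assoc, hy, Preadditive.comp_add, ← Category.assoc, hb, hf]
      simp
  exact isIso_of_mono_of_epi _

end TotalPresentation

/-- A short complex whose identity is a sum of morphisms that factor through exact short complexes
is exact. -/
lemma CategoryTheory.ShortComplex.exact_of_id_eq_sum {S : ShortComplex A} {I : Type*} (s : Finset I)
    (S' : I → ShortComplex A) (a : ∀ i, S ⟶ S' i) (b : ∀ i, S' i ⟶ S)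
    (hab : 𝟙 S = ∑ i ∈ s, a i ≫ b i) (h : ∀ i ∈ s, (S' i).Exact) : S.Exact := by
  rw [ShortComplex.exact_iff_isZero_homology, IsZero.iff_id_eq_zero]
  have := congrArg (ShortComplex.homologyFunctor A).map hab
  rw [CategoryTheory.Functor.map_id, Functor.map_sum] at this
  refine this.trans (Finset.sum_eq_zero fun i hi => ?_)
  rw [CategoryTheory.Functor.map_comp]
  have h0 : IsZero ((ShortComplex.homologyFunctor A).obj (S' i)) :=
    (ShortComplex.exact_iff_isZero_homology _).1 (h i hi)
  rw [h0.eq_of_tgt ((ShortComplex.homologyFunctor A).map (a i)) 0, zero_comp]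

/-- A functor whose identity is a sum of transformations that factor through exact functors
is exact. -/
lemma CategoryTheory.Functor.map_exact_of_id_eq_sum {C : Type*} [Category* C] [Abelian C] {F : C ⥤ A}
    [F.PreservesZeroMorphisms] {I : Type*} (s : Finset I)
    (F' : I → C ⥤ A) [∀ i, (F' i).PreservesZeroMorphisms] (a : ∀ i, F ⟶ F' i) (b : ∀ i, F' i ⟶ F)
    (hab : ∀ M, 𝟙 (F.obj M) = ∑ i ∈ s, (a i).app M ≫ (b i).app M)
    (h : ∀ i ∈ s, ∀ S : ShortComplex C, S.Exact → (S.map (F' i)).Exact)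
    (S : ShortComplex C) (hS : S.Exact) : (S.map F).Exact := by
  refine ShortComplex.exact_of_id_eq_sum s (fun i => S.map (F' i)) (fun i => S.mapNatTrans (a i))
    (fun i => S.mapNatTrans (b i)) ?_ (fun i hi => h i hi S hS)
  have h1 : ∀ (f : I → (S.map F ⟶ S.map F)) (s : Finset I),
      (∑ i ∈ s, f i).τ₁ = ∑ i ∈ s, (f i).τ₁ ∧ (∑ i ∈ s, f i).τ₂ = ∑ i ∈ s, (f i).τ₂ ∧
      (∑ i ∈ s, f i).τ₃ = ∑ i ∈ s, (f i).τ₃ := by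
    classical
    intro f s
    induction s using Finset.induction with
    | empty => exact ⟨rfl, rfl, rfl⟩
    | insert j s hj ih =>
      simp only [Finset.sum_insert hj, ← ih.1, ← ih.2.1, ← ih.2.2]
      exact ⟨rfl, rfl, rfl⟩
  apply ShortComplex.hom_ext
  · rw [(h1 _ _).1]; exact hab _
  · rw [(h1 _ _).2.1]; exact hab _
  · rw [(h1 _ _).2.2]; exact hab _

lemma CategoryTheory.Functor.map_shortExact_of_map_exact {C : Type*} [Category* C] [Abelian C] {F : C ⥤ A}
    [F.Additive] (h : ∀ S : ShortComplex C, S.Exact → (S.map F).Exact) (S : ShortComplex C)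
    (hS : S.ShortExact) : (S.map F).ShortExact :=
  (((Functor.exact_tfae F).out 1 0 :) : _ ↔ ∀ S : ShortComplex C, S.ShortExact → (S.map F).ShortExact).1 h S hS

lemma CategoryTheory.ShortComplex.ShortExact.quasiIso_f {S : ShortComplex (CochainComplex A ℤ)}
    (hS : S.ShortExact) (h : S.X₃.Acyclic) : _root_.QuasiIso S.f := by
  rw [_root_.quasiIso_iff]
  intro n
  rw [quasiIsoAt_iff_isIso_homologyMap]
  have h3 (n : ℤ) := (HomologicalComplex.exactAt_iff_isZero_homology _ _).1 (h n)
  have : Epi (HomologicalComplex.homologyMap S.f n) :=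
    (hS.homology_exact₂ n).epi_f ((h3 n).eq_of_tgt _ _)
  have : Mono (HomologicalComplex.homologyMap S.f n) :=
    (hS.homology_exact₁ (n - 1) n (by simp)).mono_g ((h3 _).eq_of_src _ _)
  exact isIso_of_mono_of_epi _

/-- An exact functor between categories of complexes that preserves acyclic complexes preserves
quasi-isomorphisms. -/
lemma CochainComplex.quasiIso_map_of_acyclic {C : Type*} [Category* C] [Abelian C]
    [EnoughInjectives C] (Φ : CochainComplex C ℤ ⥤ CochainComplex A ℤ) [Φ.PreservesZeroMorphisms]
    (hΦ : ∀ S : ShortComplex (CochainComplex C ℤ), S.ShortExact → (S.map Φ).ShortExact)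
    (hΦ' : ∀ K : CochainComplex C ℤ, K.Acyclic → (Φ.obj K).Acyclic)
    {K L : CochainComplex C ℤ} (f : K ⟶ L) [QuasiIso f] : QuasiIso (Φ.map f) := by
  -- For a monic quasi-isomorphism the cokernel is acyclic, and `Φ` preserves this situation. In
  -- general `cm5b` factors `f` as a monomorphism followed by a projection, and the projection has
  -- the monic quasi-isomorphism `biprod.inr` as a section.
  have key : ∀ {K L : CochainComplex C ℤ} (f : K ⟶ L) [QuasiIso f] [Mono f],
      QuasiIso (Φ.map f) := by
    intro K L f _ _
    let S := ShortComplex.mk f (cokernel.π f) (cokernel.condition f)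
    have hS : S.ShortExact := { exact := ShortComplex.exact_cokernel f }
    exact (hΦ S hS).quasiIso_f (hΦ' _ (hS.acyclic_X₃ (by assumption)))
  have h1 : QuasiIso (cm5b.i f) := by
    have h := cm5b.fac f
    rw [← quasiIso_iff_comp_right _ (cm5b.p K L), h]
    infer_instance
  have h2 : QuasiIso (biprod.inr : L ⟶ mappingCone (𝟙 (cm5b.I K)) ⊞ L) :=
    (cm5b.homotopyEquiv K L).quasiIso_inv
  have h3 : QuasiIso (Φ.map (cm5b.p K L)) := by
    have := key (biprod.inr : L ⟶ mappingCone (𝟙 (cm5b.I K)) ⊞ L)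
    rw [← quasiIso_iff_comp_left (Φ.map biprod.inr), ← Φ.map_comp, biprod.inr_snd, Φ.map_id]
    infer_instance
  have h4 := key (cm5b.i f)
  rw [← cm5b.fac f, Φ.map_comp]
  infer_instance

end Homological
end

noncomputable section
namespace FiniteRingedSpace

variable {X Y : FiniteRingedSpace.{u}}

/-! ### Exactness, monomorphisms, epimorphisms and isomorphisms are tested on stalks. -/

section Stalks

lemma hom_ext_stalk {M N : X.Mod} {f g : M ⟶ N}
    (h : ∀ x (m : (X.stalk x).obj M), (X.stalk x).map f m = (X.stalk x).map g m) : f = g := by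
  ext p m
  exact h p.unop.unop m

lemma isZero_iff_stalk (M : X.Mod) : IsZero M ↔ ∀ x, IsZero ((X.stalk x).obj M) := by
  refine ⟨fun h x => (X.stalk x).map_isZero h, fun h => ?_⟩
  rw [IsZero.iff_id_eq_zero]
  refine hom_ext_stalk fun x m => ?_
  have := (h x).eq_of_src ((X.stalk x).map (𝟙 M)) ((X.stalk x).map 0)
  rw [this]

lemma exact_iff_stalk (S : ShortComplex X.Mod) :
    S.Exact ↔ ∀ x, (S.map (X.stalk x)).Exact := by
  refine ⟨fun h x => h.map _, fun h => ?_⟩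
  rw [ShortComplex.exact_iff_isZero_homology, isZero_iff_stalk]
  intro x
  exact ((ShortComplex.exact_iff_isZero_homology _).1 (h x)).of_iso
    (S.mapHomologyIso (X.stalk x)).symm

lemma exact_iff_forall (S : ShortComplex X.Mod) :
    S.Exact ↔ ∀ x (m : (X.stalk x).obj S.X₂), (X.stalk x).map S.g m = 0 →
      ∃ m', (X.stalk x).map S.f m' = m := by
  rw [exact_iff_stalk]
  refine forall_congr' fun x => ?_
  rw [ShortComplex.moduleCat_exact_iff]
  rfl

lemma mono_iff_stalk {M N : X.Mod} (f : M ⟶ N) :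
    Mono f ↔ ∀ x, Function.Injective ((X.stalk x).map f) := by
  constructor
  · intro h x
    exact (ModuleCat.mono_iff_injective _).1 inferInstance
  · intro h
    refine ⟨fun a b hab => hom_ext_stalk fun x m => h x ?_⟩
    have := congrArg (fun t => (X.stalk x).map t m) hab
    simpa using this

lemma epi_iff_stalk {M N : X.Mod} (f : M ⟶ N) :
    Epi f ↔ ∀ x, Function.Surjective ((X.stalk x).map f) := by
  rw [← ShortComplex.exact_iff_epi (ShortComplex.mk f (0 : N ⟶ N) comp_zero) rfl, exact_iff_forall]
  refine ⟨fun h x m => h x m ?_, fun h x m _ => h x m⟩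
  simp

lemma isIso_iff_stalk {M N : X.Mod} (f : M ⟶ N) :
    IsIso f ↔ ∀ x, Function.Bijective ((X.stalk x).map f) := by
  rw [isIso_iff_mono_and_epi, mono_iff_stalk, epi_iff_stalk, ← forall_and]
  rfl

/-- The value at an element of a stalk, as a function of a morphism. -/
def evalHom {M : X.Mod} (N : X.Mod) {x : X.carrier} (m : (X.stalk x).obj M) :
    (M ⟶ N) →+ (X.stalk x).obj N where
  toFun f := (X.stalk x).map f m
  map_zero' := rfl
  map_add' _ _ := rfl

lemma stalk_map_sum_apply {M N : X.Mod} {x : X.carrier} {I : Type*} (s : Finset I)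
    (f : I → (M ⟶ N)) (m : (X.stalk x).obj M) :
    (X.stalk x).map (∑ i ∈ s, f i) m = ∑ i ∈ s, (X.stalk x).map (f i) m :=
  map_sum (evalHom N m) f s

lemma stalk_map_zsmul_apply {M N : X.Mod} {x : X.carrier} (n : ℤ) (f : M ⟶ N)
    (m : (X.stalk x).obj M) : (X.stalk x).map (n • f) m = n • (X.stalk x).map f m :=
  map_zsmul (evalHom N m) n f

end Stalks

/-! ### Skyscraper modules and their adjunction with stalks. -/

section Skyscraper

/-- The data of the skyscraper module at `x`, with value `N` at the points `y ≤ x`. -/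
def skyData (x : X.carrier) (N : ModuleCat.{u} (X.O.obj x)) : X.ModData where
  stalk y := ∀ h : PLift (y ≤ x), (ModuleCat.restrictScalars (X.O.map (homOfLE h.down)).hom).obj N
  res {y y'} h :=
    { toFun s h' := s ⟨h.trans h'.down⟩
      map_zero' := rfl
      map_add' _ _ := rfl }
  res_smul {y y'} h a s := by
    funext h'
    change (X.O.map (homOfLE (h.trans h'.down))).hom a • (show N from s ⟨h.trans h'.down⟩) =
      (X.O.map (homOfLE h'.down)).hom ((X.O.map (homOfLE h)).hom a) •
        (show N from s ⟨h.trans h'.down⟩)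
    rw [O_map_map]
  res_self _ := rfl
  res_res _ _ _ := rfl

variable (X) in
/-- The skyscraper functor, right adjoint to the stalk functor. -/
def sky (x : X.carrier) : ModuleCat.{u} (X.O.obj x) ⥤ X.Mod where
  obj N := (skyData x N).toMod
  map {M N} g := homMk
    (fun y =>
      { toFun (s : (skyData x M).stalk y) := (fun h => g (s h) : (skyData x N).stalk y)
        map_add' s t := funext fun h => map_add g.hom (s h) (t h)
        map_smul' a s := funext fun h => map_smul g.hom ((X.O.map (homOfLE h.down)).hom a) (s h) })
    (fun _ _ => rfl)
  map_id _ := rfl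
  map_comp _ _ := rfl

instance (x : X.carrier) : (sky X x).Additive where
  map_add := rfl

/-- The morphism to a skyscraper attached to a linear map on the stalk. -/
def toSky {M : X.Mod} {x : X.carrier} {N : ModuleCat.{u} (X.O.obj x)}
    (φ : (X.stalk x).obj M ⟶ N) : M ⟶ (sky X x).obj N :=
  homMk (fun y =>
    { toFun m := (fun h => φ (res M h.down m) : (skyData x N).stalk y)
      map_add' m m' := funext fun h => by
        refine (congrArg φ (map_add (res M h.down) m m')).trans ?_
        exact map_add φ.hom _ _
      map_smul' a m := funext fun h => by
        refine (congrArg φ (res_smul M h.down a m)).trans ?_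
        exact map_smul φ.hom _ _ })
    (fun {y y'} h m => funext fun h' => by
      change φ (res M _ m) = φ (res M h'.down (res M h m))
      rw [res_res])

/-- The value of a morphism to a skyscraper. -/
def fromSky {M : X.Mod} {x : X.carrier} {N : ModuleCat.{u} (X.O.obj x)}
    (f : M ⟶ (sky X x).obj N) : (X.stalk x).obj M ⟶ N :=
  ModuleCat.ofHom
    { toFun m := ((X.stalk x).map f m : (skyData x N).stalk x) ⟨le_rfl⟩
      map_add' m m' := congrFun (α := PLift (x ≤ x)) (map_add ((X.stalk x).map f).hom m m') ⟨le_rfl⟩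
      map_smul' a m := by
        refine (congrFun (α := PLift (x ≤ x)) (map_smul ((X.stalk x).map f).hom a m) ⟨le_rfl⟩).trans ?_
        change (X.O.map (𝟙 x)).hom a • (_ : N) = _
        rw [X.O.map_id]
        rfl }

lemma fromSky_toSky {M : X.Mod} {x : X.carrier} {N : ModuleCat.{u} (X.O.obj x)}
    (φ : (X.stalk x).obj M ⟶ N) : fromSky (toSky φ) = φ := by
  ext m
  exact congrArg φ (res_self M le_rfl m)

lemma toSky_fromSky {M : X.Mod} {x : X.carrier} {N : ModuleCat.{u} (X.O.obj x)}
    (f : M ⟶ (sky X x).obj N) : toSky (fromSky f) = f := by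
  refine hom_ext_stalk fun y m => funext fun h => ?_
  exact congrFun (α := PLift (x ≤ x)) (res_app f h.down m).symm ⟨le_rfl⟩

lemma fromSky_comp {M M' : X.Mod} {x : X.carrier} {N : ModuleCat.{u} (X.O.obj x)}
    (g : M' ⟶ M) (f : M ⟶ (sky X x).obj N) :
    fromSky (g ≫ f) = (X.stalk x).map g ≫ fromSky f := rfl

lemma toSky_comp_map {M : X.Mod} {x : X.carrier} {N N' : ModuleCat.{u} (X.O.obj x)}
    (φ : (X.stalk x).obj M ⟶ N) (g : N ⟶ N') : toSky φ ≫ (sky X x).map g = toSky (φ ≫ g) := rfl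

lemma comp_toSky {M M' : X.Mod} {x : X.carrier} {N : ModuleCat.{u} (X.O.obj x)}
    (g : M' ⟶ M) (φ : (X.stalk x).obj M ⟶ N) :
    g ≫ toSky φ = toSky ((X.stalk x).map g ≫ φ) := by
  rw [← toSky_fromSky (g ≫ toSky φ), fromSky_comp, fromSky_toSky]

end Skyscraper

/-! ### Decomposition of `C^p M` into skyscrapers. -/

section Decomposition

variable (X) in
/-- The chains `x_0 < … < x_p` of points of `X`. -/
abbrev StrictChain (p : ℕ) : Type u := {c : Fin (p + 1) → X.carrier // StrictMono c}

namespace StrictChain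
variable {p : ℕ}

lemma first_le_last (c : X.StrictChain p) : c.1 0 ≤ c.1 (Fin.last p) :=
  c.2.monotone (Fin.zero_le _)

/-- The functor `M ↦ M_{x_p}`, with values in the `O_{x_0}`-modules. -/
abbrev stalkLast (c : X.StrictChain p) : X.Mod ⥤ ModuleCat.{u} (X.O.obj (c.1 0)) :=
  X.stalk (c.1 (Fin.last p)) ⋙
    ModuleCat.restrictScalars (X.O.map (homOfLE c.first_le_last)).hom

/-- The functor that sends `M` to the skyscraper at `x_0` with value `M_{x_p}`. -/
abbrev skyLast (c : X.StrictChain p) : X.Mod ⥤ X.Mod := c.stalkLast ⋙ sky X (c.1 0)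

/-- The projection of `C^p M` to a factor. -/
def proj (c : X.StrictChain p) : standard X p ⟶ c.skyLast where
  app M := homMk
    (fun y =>
      { toFun (s : (standardData p M).stalk y) :=
          (fun h => s ⟨c.1, c.2, h.down⟩ : (skyData (c.1 0) (c.stalkLast.obj M)).stalk y)
        map_add' _ _ := rfl
        map_smul' a s := funext fun h => by
          change (X.O.map (homOfLE (h.down.trans c.first_le_last))).hom a •
              (show (X.stalk (c.1 (Fin.last p))).obj M from s ⟨c.1, c.2, h.down⟩) =
            (X.O.map (homOfLE c.first_le_last)).hom ((X.O.map (homOfLE h.down)).hom a) •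
              (show (X.stalk (c.1 (Fin.last p))).obj M from s ⟨c.1, c.2, h.down⟩)
          rw [O_map_map] })
    (fun _ _ => rfl)
  naturality _ _ _ := rfl

/-- The two end points are equal, but only propositionally; an inequality allows `res` to play the
role of the transport between the two stalks. -/
lemma last_le_of_eq (c : X.StrictChain p) {y : X.carrier} {c' : Chain X p y} (h : c'.1 = c.1) :
    c.1 (Fin.last p) ≤ c'.last := (congrFun h _).ge

open Classical in
/-- The inclusion of a factor in `C^p M`, on stalks. -/
def inclAt (c : X.StrictChain p) (M : X.Mod) {y : X.carrier}
    (t : (skyData (c.1 0) (c.stalkLast.obj M)).stalk y) (c' : Chain X p y) :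
    (X.stalk c'.last).obj M :=
  if h : c'.1 = c.1 then
    res M (c.last_le_of_eq h) (t ⟨c'.2.2.trans (congrFun h 0).le⟩) else 0

lemma inclAt_add (c : X.StrictChain p) (M : X.Mod) {y : X.carrier}
    (s t : (skyData (c.1 0) (c.stalkLast.obj M)).stalk y) (c' : Chain X p y) :
    c.inclAt M (s + t) c' = c.inclAt M s c' + c.inclAt M t c' := by
  unfold inclAt
  split_ifs with h
  · exact map_add (res M (c.last_le_of_eq h)) _ _
  · exact (add_zero _).symm

lemma inclAt_smul (c : X.StrictChain p) (M : X.Mod) {y : X.carrier} (a : X.O.obj y)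
    (t : (skyData (c.1 0) (c.stalkLast.obj M)).stalk y) (c' : Chain X p y) :
    c.inclAt M (a • t) c' = (X.O.map (homOfLE c'.le_last)).hom a • c.inclAt M t c' := by
  unfold inclAt
  split_ifs with h
  · refine (res_smul M (c.last_le_of_eq h) ((X.O.map (homOfLE c.first_le_last)).hom
      ((X.O.map (homOfLE (c'.2.2.trans (congrFun h 0).le))).hom a)) _).trans ?_
    rw [O_map_map, O_map_map]
  · exact (smul_zero _).symm

lemma inclAt_map (c : X.StrictChain p) {M N : X.Mod} (g : M ⟶ N) {y : X.carrier}
    (t : (skyData (c.1 0) (c.stalkLast.obj M)).stalk y) (c' : Chain X p y) :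
    c.inclAt N (fun h => c.stalkLast.map g (t h)) c' = (X.stalk _).map g (c.inclAt M t c') := by
  unfold inclAt
  split_ifs with h
  · exact res_app g _ _
  · exact (map_zero ((X.stalk _).map g).hom).symm

/-- The inclusion of a factor in `C^p M`. -/
def incl (c : X.StrictChain p) : c.skyLast ⟶ standard X p where
  app M := homMk
    (fun y =>
      { toFun (t : (skyData (c.1 0) (c.stalkLast.obj M)).stalk y) :=
          (c.inclAt M t : (standardData p M).stalk y)
        map_add' s t := funext fun c' => c.inclAt_add M s t c'
        map_smul' a s := funext fun c' => c.inclAt_smul M a s c' })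
    (fun _ _ => rfl)
  naturality _ _ g := hom_ext_stalk fun _ t => funext fun c' => c.inclAt_map g t c'

instance (p : ℕ) : Finite (X.StrictChain p) := inferInstance
instance (p : ℕ) : Fintype (X.StrictChain p) := Fintype.ofFinite _

/-- The component at a chain of an element of `(C^p M)_y`. -/
def component {M : X.Mod} {y : X.carrier} (c : Chain X p y) :
    (X.stalk y).obj ((standard X p).obj M) →+ (X.stalk c.last).obj M where
  toFun s := (s : (standardData p M).stalk y) c
  map_zero' := rfl
  map_add' _ _ := rfl

lemma component_proj_incl (c : X.StrictChain p) (M : X.Mod) {y : X.carrier}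
    (s : (X.stalk y).obj ((standard X p).obj M)) (c' : Chain X p y) :
    component c' ((X.stalk y).map (c.proj.app M ≫ c.incl.app M) s) =
      c.inclAt M (fun h => (s : (standardData p M).stalk y) ⟨c.1, c.2, h.down⟩) c' := rfl

/-- The component at a chain only sees the summand indexed by that chain. Properties that pass to
finite sums of retracts are thereby reduced from `C^p M` to skyscrapers. -/
lemma sum_proj_comp_incl (p : ℕ) (M : X.Mod) :
    ∑ c : X.StrictChain p, c.proj.app M ≫ c.incl.app M = 𝟙 ((standard X p).obj M) := by
  refine hom_ext_stalk fun y (s : (X.stalk y).obj ((standard X p).obj M)) => ?_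
  rw [stalk_map_sum_apply]
  refine funext fun c' => ?_
  refine (map_sum (component c') _ _).trans ?_
  refine (Finset.sum_eq_single (⟨c'.1, c'.2.1⟩ : X.StrictChain p) ?_ (by simp)).trans ?_
  · intro c _ hc
    rw [component_proj_incl]
    exact dif_neg fun h => hc (Subtype.ext h.symm)
  · rw [component_proj_incl]
    refine (dif_pos rfl).trans ?_
    exact res_self M le_rfl _

end StrictChain
end Decomposition

end FiniteRingedSpace
end

noncomputable section
namespace FiniteRingedSpace

variable {X Y : FiniteRingedSpace.{u}}

/-- By the decomposition, `C^p ⋙ F` is a finite sum of functors `M ↦ F(sky (M_{x_p}))`, and taking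
stalks and restricting scalars are exact. -/
lemma standard_comp_map_exact {A : Type*} [Category* A] [Abelian A] (F : X.Mod ⥤ A) [F.Additive]
    (hF : ∀ (x : X.carrier) (S : ShortComplex (ModuleCat.{u} (X.O.obj x))), S.Exact →
      (S.map (sky X x ⋙ F)).Exact) (p : ℕ) (S : ShortComplex X.Mod) (hS : S.Exact) :
    (S.map (standard X p ⋙ F)).Exact := by
  refine Functor.map_exact_of_id_eq_sum (C := X.Mod) Finset.univ
    (fun c : X.StrictChain p => c.skyLast ⋙ F) (fun c => Functor.whiskerRight c.proj F)
    (fun c => Functor.whiskerRight c.incl F) (fun M => ?_) (fun c _ S hS => ?_) S hS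
  · have := congrArg F.map (StrictChain.sum_proj_comp_incl p M)
    rw [F.map_sum, F.map_id] at this
    refine this.symm.trans (Finset.sum_congr rfl fun c _ => F.map_comp _ _)
  · refine hF (c.1 0) (S.map c.stalkLast) ?_
    have h1 := (exact_iff_stalk S).1 hS (c.1 (Fin.last p))
    rw [ShortComplex.moduleCat_exact_iff] at h1 ⊢
    exact h1

/-! ### The augmented standard complex; good and contractible modules. -/

section Augmented

variable (X) in
/-- The terms `M, C^0 M, C^1 M, …` of the augmented standard complex. -/
def augFunctor : ℕ → X.Mod ⥤ X.Mod
  | 0 => 𝟭 _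
  | p + 1 => standard X p

variable (X) in
/-- The differential of the augmented standard complex. -/
def augD : ∀ n, augFunctor X n ⟶ augFunctor X (n + 1)
  | 0 => augmentation X
  | p + 1 => differential X p

instance (n : ℕ) : (augFunctor X n).Additive := by
  cases n <;> dsimp [augFunctor] <;> infer_instance

lemma augD_comp_augD (n : ℕ) : augD X n ≫ augD X (n + 1) = 0 := by
  cases n with
  | zero => exact augmentation_comp_differential X
  | succ p => exact differential_comp_differential X p

lemma augD_app_comp_augD_app (n : ℕ) (M : X.Mod) :
    (augD X n).app M ≫ (augD X (n + 1)).app M = 0 :=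
  congrArg (fun α => NatTrans.app α M) (augD_comp_augD n)

variable {A : Type*} [Category* A] [Preadditive A] (F : X.Mod ⥤ A) [F.Additive]

/-- The short complexes in the augmented standard complex. -/
def augSc (n : ℕ) : X.Mod ⥤ ShortComplex A where
  -- Because of the index shift the middle term is `F(C^n M)`. Exactness for `n > 0` is vanishing of
  -- the cohomology of `F(C^• M)` in degree `n`; for `n = 0` it says that `F(M)` covers the kernel
  -- of `F(C^0 M) → F(C^1 M)`.
  obj M := ShortComplex.mk (F.map ((augD X n).app M)) (F.map ((augD X (n + 1)).app M))
    (by rw [← F.map_comp, augD_app_comp_augD_app, F.map_zero])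
  map f :=
    { τ₁ := F.map ((augFunctor X n).map f)
      τ₂ := F.map ((augFunctor X (n + 1)).map f)
      τ₃ := F.map ((augFunctor X (n + 2)).map f)
      comm₁₂ := by
        dsimp
        rw [← F.map_comp, ← F.map_comp, (augD X n).naturality]
      comm₂₃ := by
        dsimp
        rw [← F.map_comp, ← F.map_comp, (augD X (n + 1)).naturality] }
  map_id M := by ext <;> simp
  map_comp f g := by ext <;> simp

instance (n : ℕ) : (augSc F n).Additive where
  map_add {M N f g} := by
    ext
    · exact (congrArg F.map (augFunctor X n).map_add).trans F.map_add
    · exact (congrArg F.map (augFunctor X (n + 1)).map_add).trans F.map_add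
    · exact (congrArg F.map (augFunctor X (n + 2)).map_add).trans F.map_add

/-- The standard resolution of `M` stays exact after application of `F`. -/
structure IsGood (M : X.Mod) : Prop where
  mono : Mono (F.map ((augD X 0).app M))
  exact (n : ℕ) : ((augSc F n).obj M).Exact

/-- The standard resolution of `M` becomes contractible after application of `F`. -/
def IsContractible (M : X.Mod) : Prop :=
  ∃ h : ∀ n, F.obj ((augFunctor X (n + 1)).obj M) ⟶ F.obj ((augFunctor X n).obj M),
    F.map ((augD X 0).app M) ≫ h 0 = 𝟙 _ ∧
    ∀ n, h n ≫ F.map ((augD X n).app M) + F.map ((augD X (n + 1)).app M) ≫ h (n + 1) = 𝟙 _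

-- A contraction consists of identities between morphisms, so it survives any additive functor; mere
-- exactness would not.
omit [F.Additive] in
variable {F} in
lemma IsContractible.comp {M : X.Mod} (hM : IsContractible F M) {B : Type*} [Category* B]
    [Preadditive B] (G : A ⥤ B) [G.Additive] : IsContractible (F ⋙ G) M := by
  obtain ⟨h, h0, h1⟩ := hM
  refine ⟨fun n => G.map (h n), ?_, fun n => ?_⟩
  · simp only [Functor.comp_map, ← G.map_comp, h0, G.map_id]
    rfl
  · simp only [Functor.comp_map, ← G.map_comp, ← G.map_add, h1, G.map_id]
    rfl

end Augmented

section Good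

variable {A : Type*} [Category* A] [Abelian A] {F : X.Mod ⥤ A} [F.Additive]

lemma IsContractible.isGood {M : X.Mod} (hM : IsContractible F M) : IsGood F M := by
  obtain ⟨h, h0, h1⟩ := hM
  refine ⟨mono_of_mono_fac h0, fun n => ?_⟩
  rw [ShortComplex.exact_iff_exact_up_to_refinements]
  intro Z x hx
  refine ⟨Z, 𝟙 Z, inferInstance, x ≫ h n, ?_⟩
  change Z ⟶ F.obj ((augFunctor X (n + 1)).obj M) at x
  change x ≫ F.map ((augD X (n + 1)).app M) = 0 at hx
  have := x ≫= h1 n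
  rw [Preadditive.comp_add, ← Category.assoc, ← Category.assoc x (F.map _)] at this
  rw [hx, zero_comp, add_zero, Category.comp_id] at this
  exact (Category.id_comp x).trans this.symm

/-- Goodness passes to finite direct sums and direct summands. -/
lemma IsGood.of_id_eq_sum {M : X.Mod} {I : Type*} (s : Finset I) (N : I → X.Mod)
    (a : ∀ i, M ⟶ N i) (b : ∀ i, N i ⟶ M) (hab : 𝟙 M = ∑ i ∈ s, a i ≫ b i)
    (hN : ∀ i ∈ s, IsGood F (N i)) : IsGood F M where
  mono := by
    let ε (M : X.Mod) : M ⟶ (standard X 0).obj M := (augmentation X).app M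
    have hε {M N : X.Mod} (f : M ⟶ N) : f ≫ ε N = ε M ≫ (standard X 0).map f :=
      (augmentation X).naturality f
    change Mono (F.map (ε M))
    refine Preadditive.mono_of_cancel_zero _ fun {Z} x hx => ?_
    have h1 := congrArg F.map hab
    rw [F.map_id, F.map_sum] at h1
    rw [← Category.comp_id x, h1, Preadditive.comp_sum]
    refine Finset.sum_eq_zero fun i hi => ?_
    have hm : Mono (F.map (ε (N i))) := (hN i hi).mono
    have h3 : x ≫ F.map (a i) = 0 := by
      rw [← cancel_mono (F.map (ε (N i))), Category.assoc, ← F.map_comp, hε, F.map_comp,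
        reassoc_of% hx, zero_comp, zero_comp]
    rw [F.map_comp, reassoc_of% h3, zero_comp]
  exact n := by
    refine ShortComplex.exact_of_id_eq_sum s (fun i => (augSc F n).obj (N i))
      (fun i => (augSc F n).map (a i)) (fun i => (augSc F n).map (b i)) ?_
      (fun i hi => (hN i hi).exact n)
    have := congrArg (augSc F n).map hab
    rw [CategoryTheory.Functor.map_id, Functor.map_sum] at this
    refine this.trans (Finset.sum_congr rfl fun i _ => Functor.map_comp _ _ _)

lemma IsGood.of_iso {M N : X.Mod} (hM : IsGood F M) (e : M ≅ N) : IsGood F N :=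
  IsGood.of_id_eq_sum ({()} : Finset Unit) (fun _ => M) (fun _ => e.inv) (fun _ => e.hom) (by simp)
    (fun _ _ => hM)

lemma IsGood.standard {M : X.Mod} (p : ℕ)
    (h : ∀ (x : X.carrier) (N : ModuleCat.{u} (X.O.obj x)), IsGood F ((sky X x).obj N)) :
    IsGood F ((standard X p).obj M) :=
  IsGood.of_id_eq_sum Finset.univ (fun c : X.StrictChain p => c.skyLast.obj M)
    (fun c => c.proj.app M) (fun c => c.incl.app M) (StrictChain.sum_proj_comp_incl p M).symm
    (fun _ _ => h _ _)

end Good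

/-! ### The differential on components, and chains with a point added in front or behind. -/

section Differential

lemma differential_apply {p : ℕ} (M : X.Mod) {y : X.carrier}
    (s : (X.stalk y).obj ((standard X p).obj M)) (c : Chain X (p + 1) y) :
    StrictChain.component c ((X.stalk y).map ((differential X p).app M) s) =
      ∑ k : Fin (p + 2), (-1 : ℤ) ^ (k : ℕ) •
        res M (c.last_face_le k) (StrictChain.component (c.face k) s) := by
  have h : (differential X p).app M = ∑ k : Fin (p + 2), (-1 : ℤ) ^ (k : ℕ) • (coface X p k).app M := by
    simp [differential]
  rw [h, stalk_map_sum_apply]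
  refine (map_sum (StrictChain.component c) _ _).trans (Finset.sum_congr rfl fun k _ => ?_)
  rw [stalk_map_zsmul_apply, map_zsmul]
  rfl

lemma augmentation_apply (M : X.Mod) {y : X.carrier} (m : (X.stalk y).obj M) (c : Chain X 0 y) :
    StrictChain.component c ((X.stalk y).map ((augmentation X).app M) m) = res M c.le_last m := rfl

lemma standard_ext {p : ℕ} {M : X.Mod} {y : X.carrier}
    {s t : (X.stalk y).obj ((standard X p).obj M)}
    (h : ∀ c : Chain X p y, StrictChain.component c s = StrictChain.component c t) : s = t :=
  funext h

/-- Components at propositionally equal chains live in different types; restriction to a common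
point `z` makes them comparable. -/
lemma res_component_eq {p : ℕ} {M : X.Mod} {y : X.carrier}
    (s : (X.stalk y).obj ((standard X p).obj M)) {c₁ c₂ : Chain X p y} (h : c₁ = c₂)
    {z : X.carrier} (h₁ : c₁.last ≤ z) (h₂ : c₂.last ≤ z) :
    res M h₁ (StrictChain.component c₁ s) = res M h₂ (StrictChain.component c₂ s) := by
  subst h
  rfl

end Differential

namespace Chain
variable {p : ℕ} {y : X.carrier}

/-- The first point `x_0` of a chain. -/
def first (c : Chain X p y) : X.carrier := c.1 0

/-- The chain `y < x_0 < … < x_p`. -/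
def cons (c : Chain X p y) (h : y < c.first) : Chain X (p + 1) y :=
  ⟨Matrix.vecCons y c.1, c.2.1.vecCons h, le_rfl⟩

lemma last_cons (c : Chain X p y) (h : y < c.first) : (c.cons h).last = c.last := rfl

lemma face_zero_cons (c : Chain X p y) (h : y < c.first) : (c.cons h).face 0 = c := by
  apply Subtype.ext
  funext i
  rfl

lemma first_le_face (c : Chain X (p + 1) y) (k : Fin (p + 2)) : c.first ≤ (c.face k).first :=
  c.2.1.monotone (Fin.zero_le _)

lemma face_succ_cons (c : Chain X (p + 1) y) (h : y < c.first) (k : Fin (p + 2)) :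
    (c.cons h).face k.succ = (c.face k).cons (h.trans_le (c.first_le_face k)) := by
  apply Subtype.ext
  funext i
  induction i using Fin.cases with
  | zero => rfl
  | succ i =>
    change Matrix.vecCons y c.1 (k.succ.succAbove i.succ) = c.1 (k.succAbove i)
    rw [Fin.succ_succAbove_succ]
    rfl

lemma cons_face_zero (c : Chain X (p + 1) y) (h : c.first = y) (h' : y < (c.face 0).first) :
    (c.face 0).cons h' = c := by
  apply Subtype.ext
  funext i
  induction i using Fin.cases with
  | zero => exact h.symm
  | succ i => rfl

/-- The chain consisting of `y`. -/
def single (y : X.carrier) : Chain X 0 y := ⟨fun _ => y, fun i j h => absurd (Subsingleton.elim (α := Fin 1) i j) h.ne, le_rfl⟩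

lemma last_single (y : X.carrier) : (single y).last ≤ y := le_rfl

lemma le_first (c : Chain X p y) : y ≤ c.first := c.2.2

lemma first_lt_face_zero (c : Chain X (p + 1) y) : c.first < (c.face 0).first := by
  refine c.2.1 ?_
  rw [Fin.succAbove_of_le_castSucc _ _ (Fin.zero_le _)]
  exact Fin.succ_pos _

/-- The chain `x_0 < … < x_p < x`. -/
def snoc (c : Chain X p y) {x : X.carrier} (h : c.last < x) : Chain X (p + 1) y :=
  ⟨Fin.snoc (α := fun _ => X.carrier) c.1 x, by
    rw [Fin.strictMono_iff_lt_succ]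
    intro i
    induction i using Fin.lastCases with
    | last =>
      rw [Fin.succ_last, Fin.snoc_last, Fin.snoc_castSucc]
      exact h
    | cast i =>
      rw [Fin.snoc_castSucc, ← Fin.castSucc_succ, Fin.snoc_castSucc]
      exact c.2.1 (Fin.castSucc_lt_succ), by
    have : (0 : Fin (p + 2)) = Fin.castSucc 0 := rfl
    rw [this, Fin.snoc_castSucc]
    exact c.2.2⟩

lemma last_snoc (c : Chain X p y) {x : X.carrier} (h : c.last < x) : (c.snoc h).last = x :=
  Fin.snoc_last (α := fun _ => X.carrier) _ _

lemma face_last_snoc (c : Chain X p y) {x : X.carrier} (h : c.last < x) :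
    (c.snoc h).face (Fin.last _) = c := by
  apply Subtype.ext
  funext i
  change Fin.snoc (α := fun _ => X.carrier) c.1 x ((Fin.last _).succAbove i) = c.1 i
  rw [Fin.succAbove_last, Fin.snoc_castSucc]

lemma face_castSucc_snoc (c : Chain X (p + 1) y) {x : X.carrier} (h : c.last < x)
    (k : Fin (p + 2)) :
    (c.snoc h).face k.castSucc = (c.face k).snoc ((c.last_face_le k).trans_lt h) := by
  apply Subtype.ext
  funext i
  induction i using Fin.lastCases with
  | last =>
    refine Eq.trans ?_ (last_snoc _ _).symm
    refine (congrArg (Fin.snoc (α := fun _ => X.carrier) c.1 x)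
      (Fin.succAbove_ne_last_last (Fin.castSucc_lt_last k).ne)).trans ?_
    exact Fin.snoc_last (α := fun _ => X.carrier) _ _
  | cast i =>
    refine (congrArg (Fin.snoc (α := fun _ => X.carrier) c.1 x)
      Fin.castSucc_succAbove_castSucc).trans ?_
    exact (Fin.snoc_castSucc (α := fun _ => X.carrier) _ _ _).trans
      (Fin.snoc_castSucc (α := fun _ => X.carrier) x (c.face k).1 i).symm

lemma last_face_castSucc (c : Chain X (p + 1) y) (k : Fin (p + 1)) :
    (c.face k.castSucc).last = c.last :=
  congrArg c.1 (Fin.succAbove_ne_last_last (Fin.castSucc_lt_last k).ne)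

lemma snoc_face_last (c : Chain X (p + 1) y) {x : X.carrier} (h : c.last = x)
    (h' : (c.face (Fin.last _)).last < x) : (c.face (Fin.last _)).snoc h' = c := by
  apply Subtype.ext
  funext i
  induction i using Fin.lastCases with
  | last => exact (last_snoc _ _).trans h.symm
  | cast i =>
    refine (Fin.snoc_castSucc (α := fun _ => X.carrier) _ _ _).trans ?_
    change c.1 ((Fin.last _).succAbove i) = _
    rw [Fin.succAbove_last]

lemma last_face_last_lt (c : Chain X (p + 1) y) : (c.face (Fin.last _)).last < c.last := by
  apply c.2.1
  change (Fin.last _).succAbove _ < _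
  rw [Fin.succAbove_last]
  exact Fin.castSucc_lt_last _

end Chain
end FiniteRingedSpace
end

noncomputable section
namespace FiniteRingedSpace

variable {X Y : FiniteRingedSpace.{u}}

/-! ### Contraction of the standard resolution on a stalk: putting `y` in front of chains. -/

section StalkContraction

open StrictChain (component)

lemma component_smul {p : ℕ} {M : X.Mod} {y : X.carrier} (c : Chain X p y) (a : X.O.obj y)
    (s : (X.stalk y).obj ((standard X p).obj M)) :
    component c (a • s) = (X.O.map (homOfLE c.le_last)).hom a • component c s := rfl

lemma O_map_self {x : X.carrier} (h : x ≤ x) (a : X.O.obj x) :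
    (X.O.map (homOfLE h)).hom a = a := by
  change (X.O.map (𝟙 x)).hom a = a
  rw [X.O.map_id]
  rfl

/-- The map `(C^0 M)_y → M_y` of evaluation at `y`. -/
def stalkContractZero (M : X.Mod) (y : X.carrier) :
    (X.stalk y).obj ((standard X 0).obj M) →ₗ[X.O.obj y] (X.stalk y).obj M where
  toFun s := res M (Chain.last_single y) (component (Chain.single y) s)
  map_add' s t := by rw [map_add, map_add]
  map_smul' a s := by
    rw [component_smul]
    refine (res_smul M _ _ _).trans ?_
    rw [O_map_map, O_map_self]
    rfl

open Classical in
/-- The map `(C^{p+1} M)_y → (C^p M)_y` that puts `y` in front of the chains, at a chain. -/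
def stalkContractAt {M : X.Mod} {y : X.carrier} {p : ℕ}
    (s : (X.stalk y).obj ((standard X (p + 1)).obj M)) (c : Chain X p y) : (X.stalk c.last).obj M :=
  if h : y < c.first then res M (c.last_cons h).le (component (c.cons h) s) else 0

/-- The map `(C^{p+1} M)_y → (C^p M)_y` that puts `y` in front of the chains. -/
def stalkContractSucc (M : X.Mod) (y : X.carrier) (p : ℕ) :
    (X.stalk y).obj ((standard X (p + 1)).obj M) →ₗ[X.O.obj y]
      (X.stalk y).obj ((standard X p).obj M) where
  toFun s := (stalkContractAt s : (standardData p M).stalk y)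
  map_add' s t := funext fun c => by
    change stalkContractAt (s + t) c = stalkContractAt s c + stalkContractAt t c
    unfold stalkContractAt
    split_ifs with h
    · rw [map_add, map_add]
    · exact (add_zero _).symm
  map_smul' a s := funext fun c => by
    change stalkContractAt (a • s) c = (X.O.map (homOfLE c.le_last)).hom a • stalkContractAt s c
    unfold stalkContractAt
    split_ifs with h
    · rw [component_smul]
      refine (res_smul M _ _ _).trans ?_
      rw [O_map_map]
    · exact (smul_zero _).symm

lemma component_stalkContractSucc_of_lt {M : X.Mod} {y : X.carrier} {p : ℕ}
    (s : (X.stalk y).obj ((standard X (p + 1)).obj M)) (c : Chain X p y) (h : y < c.first) :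
    component c (stalkContractSucc M y p s) =
      res M (c.last_cons h).le (component (c.cons h) s) := dif_pos h

lemma component_stalkContractSucc_of_not_lt {M : X.Mod} {y : X.carrier} {p : ℕ}
    (s : (X.stalk y).obj ((standard X (p + 1)).obj M)) (c : Chain X p y) (h : ¬ y < c.first) :
    component c (stalkContractSucc M y p s) = 0 := dif_neg h

lemma stalkContractZero_augmentation (M : X.Mod) (y : X.carrier) (m : (X.stalk y).obj M) :
    stalkContractZero M y ((X.stalk y).map ((augmentation X).app M) m) = m := by
  change res M _ (component (Chain.single y) _) = m
  rw [augmentation_apply, res_res, res_self]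

lemma stalkContract_zero (M : X.Mod) (y : X.carrier)
    (s : (X.stalk y).obj ((standard X 0).obj M)) :
    (X.stalk y).map ((augmentation X).app M) (stalkContractZero M y s) +
      stalkContractSucc M y 0 ((X.stalk y).map ((differential X 0).app M) s) = s := by
  refine standard_ext fun c => ?_
  rw [map_add, augmentation_apply]
  change res M c.le_last (res M (Chain.last_single y) (component (Chain.single y) s)) + _ = _
  rw [res_res]
  by_cases h : y < c.first
  · rw [component_stalkContractSucc_of_lt _ _ h, differential_apply, Fin.sum_univ_two]
    simp only [Fin.val_zero, Fin.val_one, pow_zero, one_smul, pow_one, neg_smul, map_add, map_neg]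
    rw [res_res, res_res]
    rw [res_component_eq s (c.face_zero_cons h) _ le_rfl, res_self]
    have h1 : (c.cons h).face 1 = Chain.single y := by
      apply Subtype.ext
      funext i
      fin_cases i
      rfl
    rw [res_component_eq s h1 _ c.le_last]
    abel
  · rw [component_stalkContractSucc_of_not_lt _ _ h, add_zero]
    have h1 : Chain.single y = c := by
      apply Subtype.ext
      funext i
      fin_cases i
      exact eq_of_le_of_not_lt c.2.2 h
    rw [res_component_eq s h1 _ le_rfl, res_self]

/-- If `y < x_0`, the face of `y < x_0 < …` that omits `y` returns the component at `c`, and the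
other faces cancel against the differential of the contracted cochain. If `x_0 = y`, only the face
omitting `x_0` does not start with `y`, and prepending `y` to it restores `c`. -/
lemma stalkContract_succ (M : X.Mod) (y : X.carrier) (p : ℕ)
    (s : (X.stalk y).obj ((standard X (p + 1)).obj M)) :
    (X.stalk y).map ((differential X p).app M) (stalkContractSucc M y p s) +
      stalkContractSucc M y (p + 1) ((X.stalk y).map ((differential X (p + 1)).app M) s) = s := by
  refine standard_ext fun c => ?_
  rw [map_add, differential_apply]
  by_cases h : y < c.first
  · rw [component_stalkContractSucc_of_lt _ _ h, differential_apply, Fin.sum_univ_succ (n := p + 2),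
      map_add, map_sum]
    have h0 : res M (c.last_cons h).le ((-1 : ℤ) ^ ((0 : Fin (p + 3)) : ℕ) •
        res M ((c.cons h).last_face_le 0) (component ((c.cons h).face 0) s)) = component c s := by
      simp only [Fin.val_zero, pow_zero, one_smul]
      rw [res_res, res_component_eq s (c.face_zero_cons h) _ le_rfl, res_self]
    rw [h0, add_left_comm, ← Finset.sum_add_distrib]
    refine (congrArg (component c s + ·) (Finset.sum_eq_zero fun k _ => ?_)).trans (add_zero _)
    rw [component_stalkContractSucc_of_lt _ _ (h.trans_le (c.first_le_face k)), res_res, map_zsmul,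
      res_res, res_component_eq s (c.face_succ_cons h k) _ (c.last_face_le k), Fin.val_succ,
      pow_succ, mul_neg_one, neg_smul]
    exact add_neg_cancel _
  · rw [component_stalkContractSucc_of_not_lt _ _ h, add_zero, Fin.sum_univ_succ]
    have hy : c.first = y := (eq_of_le_of_not_lt c.le_first h).symm
    have h0 : y < (c.face 0).first := hy.ge.trans_lt c.first_lt_face_zero
    rw [Finset.sum_eq_zero, add_zero, component_stalkContractSucc_of_lt _ _ h0, Fin.val_zero,
      pow_zero, one_smul, res_res, res_component_eq s (c.cons_face_zero hy h0) _ le_rfl, res_self]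
    -- Omitting a later point keeps `y` as first point, where the contraction is zero by definition.
    intro k _
    rw [component_stalkContractSucc_of_not_lt, map_zero, smul_zero]
    exact h

/-- The contraction depends on `y`, so it does not glue to one of `O`-modules: for a general `M` it
yields exactness of the resolution, and goodness only for functors that factor through a stalk. -/
lemma stalk_isContractible (M : X.Mod) (y : X.carrier) : IsContractible (X.stalk y) M := by
  refine ⟨fun n => match n with
    | 0 => ModuleCat.ofHom (stalkContractZero M y)
    | p + 1 => ModuleCat.ofHom (stalkContractSucc M y p), ?_, fun n => ?_⟩
  · ext m
    exact stalkContractZero_augmentation M y m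
  · cases n with
    | zero =>
      ext s
      exact stalkContract_zero M y s
    | succ p =>
      ext s
      exact stalkContract_succ M y p s

end StalkContraction

end FiniteRingedSpace
end

noncomputable section
namespace FiniteRingedSpace

variable {X Y : FiniteRingedSpace.{u}}

/-! ### Contraction of the standard resolution of a skyscraper: putting `x` behind chains. -/

section SkyContraction

open StrictChain (component)

/-- The values of a section of a skyscraper. -/
def skyVal {x y : X.carrier} {N : ModuleCat.{u} (X.O.obj x)} (h : y ≤ x) :
    (X.stalk y).obj ((sky X x).obj N) →+ N where
  toFun s := (s : (skyData x N).stalk y) ⟨h⟩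
  map_zero' := rfl
  map_add' _ _ := rfl

lemma skyVal_smul {x y : X.carrier} {N : ModuleCat.{u} (X.O.obj x)} (h : y ≤ x) (a : X.O.obj y)
    (s : (X.stalk y).obj ((sky X x).obj N)) :
    skyVal h (a • s) = (X.O.map (homOfLE h)).hom a • skyVal h s := rfl

lemma skyVal_res {x y z : X.carrier} {N : ModuleCat.{u} (X.O.obj x)} (h : y ≤ x) (h' : z ≤ y)
    (s : (X.stalk z).obj ((sky X x).obj N)) :
    skyVal h (res _ h' s) = skyVal (h'.trans h) s := rfl

lemma sky_ext {x y : X.carrier} {N : ModuleCat.{u} (X.O.obj x)}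
    {s t : (X.stalk y).obj ((sky X x).obj N)} (h : ∀ h : y ≤ x, skyVal h s = skyVal h t) : s = t :=
  funext fun h' => h h'.down

/-- The section of a skyscraper with given values. -/
def skyMk {x y : X.carrier} {N : ModuleCat.{u} (X.O.obj x)} (f : y ≤ x → N) :
    (X.stalk y).obj ((sky X x).obj N) := (fun h => f h.down : (skyData x N).stalk y)

lemma skyVal_skyMk {x y : X.carrier} {N : ModuleCat.{u} (X.O.obj x)} (f : y ≤ x → N) (h : y ≤ x) :
    skyVal h (skyMk f) = f h := rfl

lemma component_eq_skyVal {p : ℕ} {x y : X.carrier} {N : ModuleCat.{u} (X.O.obj x)}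
    (s : (X.stalk y).obj ((standard X p).obj ((sky X x).obj N))) {c₁ c₂ : Chain X p y}
    (h : c₁ = c₂) (h₁ : c₁.last ≤ x) (h₂ : c₂.last ≤ x) :
    skyVal h₁ (component c₁ s) = skyVal h₂ (component c₂ s) := by
  subst h
  rfl

/-- The chain of length zero in `U_y` consisting of `x`. -/
def Chain.singleAt {x y : X.carrier} (h : y ≤ x) : Chain X 0 y :=
  ⟨fun _ => x, fun i j h => absurd (Subsingleton.elim (α := Fin 1) i j) h.ne, h⟩

lemma Chain.last_singleAt {x y : X.carrier} (h : y ≤ x) : (Chain.singleAt h).last ≤ x := le_rfl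

variable (x : X.carrier) (N : ModuleCat.{u} (X.O.obj x))

/-- The retraction `C^0 S → S` for a skyscraper `S`. -/
def skyContractZero : (standard X 0).obj ((sky X x).obj N) ⟶ (sky X x).obj N :=
  homMk (fun y =>
    { toFun s := skyMk fun h => skyVal (Chain.last_singleAt h) (component (Chain.singleAt h) s)
      map_add' s t := sky_ext fun h => by
        simp only [map_add, skyVal_skyMk]
      map_smul' a s := sky_ext fun h => by
        rw [skyVal_skyMk, component_smul, skyVal_smul, O_map_map]
        rfl })
    (fun _ _ => rfl)

variable {x N}

open Classical in
/-- The map `C^{p+1} S → C^p S`, for a skyscraper `S` at `x`, that puts `x` behind the chains. -/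
def skyContractAt {p : ℕ} {y : X.carrier}
    (s : (X.stalk y).obj ((standard X (p + 1)).obj ((sky X x).obj N))) (c : Chain X p y) : N :=
  -- The sign is that of the face omitting the appended point, so that this face contributes with
  -- coefficient one.
  if h : c.last < x then (-1 : ℤ) ^ (p + 1) • skyVal (c.last_snoc h).le (component (c.snoc h) s)
    else 0

lemma skyContractAt_of_lt {p : ℕ} {y : X.carrier}
    (s : (X.stalk y).obj ((standard X (p + 1)).obj ((sky X x).obj N))) (c : Chain X p y)
    (h : c.last < x) : skyContractAt s c =
      (-1 : ℤ) ^ (p + 1) • skyVal (c.last_snoc h).le (component (c.snoc h) s) := dif_pos h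

lemma skyContractAt_of_not_lt {p : ℕ} {y : X.carrier}
    (s : (X.stalk y).obj ((standard X (p + 1)).obj ((sky X x).obj N))) (c : Chain X p y)
    (h : ¬ c.last < x) : skyContractAt s c = 0 := dif_neg h

variable (x N)

/-- The map `C^{p+1} S → C^p S`, for a skyscraper `S` at `x`, that puts `x` behind the chains. -/
def skyContractSucc (p : ℕ) :
    (standard X (p + 1)).obj ((sky X x).obj N) ⟶ (standard X p).obj ((sky X x).obj N) :=
  homMk (fun y =>
    { toFun s := (fun c => skyMk fun _ => skyContractAt s c :
        (standardData p ((sky X x).obj N)).stalk y)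
      map_add' s t := standard_ext fun c => sky_ext fun h => by
        change skyContractAt (s + t) c = skyContractAt s c + skyContractAt t c
        unfold skyContractAt
        split_ifs
        · rw [map_add, map_add, smul_add]
        · exact (add_zero _).symm
      map_smul' a s := standard_ext fun c => sky_ext fun h => by
        change skyContractAt (a • s) c =
          (X.O.map (homOfLE h)).hom ((X.O.map (homOfLE c.le_last)).hom a) • skyContractAt s c
        unfold skyContractAt
        split_ifs
        · rw [component_smul, skyVal_smul, O_map_map, O_map_map, smul_comm]
        · exact (smul_zero _).symm })
    (fun _ _ => rfl)

variable {x N}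

lemma skyVal_skyContractSucc {p : ℕ} {y : X.carrier}
    (s : (X.stalk y).obj ((standard X (p + 1)).obj ((sky X x).obj N))) (c : Chain X p y)
    (h : c.last ≤ x) :
    skyVal h (component c ((X.stalk y).map (skyContractSucc x N p) s)) = skyContractAt s c := rfl

lemma skyVal_skyContractZero {y : X.carrier}
    (s : (X.stalk y).obj ((standard X 0).obj ((sky X x).obj N)))
    (h : y ≤ x) : skyVal h ((X.stalk y).map (skyContractZero x N) s) =
      skyVal (Chain.last_singleAt h) (component (Chain.singleAt h) s) := rfl

lemma skyContract_zero {y : X.carrier} (s : (X.stalk y).obj ((standard X 0).obj ((sky X x).obj N))) :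
    (X.stalk y).map ((augmentation X).app ((sky X x).obj N)) ((X.stalk y).map (skyContractZero x N) s) +
      (X.stalk y).map (skyContractSucc x N 0) ((X.stalk y).map ((differential X 0).app ((sky X x).obj N)) s) =
        s := by
  refine standard_ext fun c => sky_ext fun h => ?_
  rw [map_add, map_add, augmentation_apply, skyVal_skyContractSucc]
  rw [skyVal_res, skyVal_skyContractZero]
  by_cases hc : c.last < x
  · rw [skyContractAt_of_lt _ _ hc, differential_apply, Fin.sum_univ_two]
    simp only [Fin.val_zero, Fin.val_one, pow_zero, one_smul, pow_one, neg_smul, map_add, map_neg,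
      Nat.reduceAdd]
    rw [skyVal_res, skyVal_res]
    have h0 : (c.snoc hc).face 0 = Chain.singleAt (c.le_last.trans h) := by
      apply Subtype.ext
      funext i
      fin_cases i
      exact c.last_snoc hc
    have h1 : (c.snoc hc).face 1 = c := c.face_last_snoc hc
    rw [component_eq_skyVal s h0 _ le_rfl, component_eq_skyVal s h1 _ h]
    abel_nf
  · rw [skyContractAt_of_not_lt _ _ hc, add_zero]
    refine component_eq_skyVal s ?_ _ _
    apply Subtype.ext
    funext i
    fin_cases i
    exact (eq_of_le_of_not_lt h hc).symm

/-- If the chain ends strictly below `x`, the last face of the extended chain returns `s(c)` and the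
other faces cancel against the contracted cochain. If it ends at `x`, only the face omitting `x` can
be extended by `x` again, and this restores `c`. The restriction maps of a skyscraper below `x` are
identities on `N`, so changing the last point does no harm. -/
lemma skyContract_succ {p : ℕ} {y : X.carrier}
    (s : (X.stalk y).obj ((standard X (p + 1)).obj ((sky X x).obj N))) :
    (X.stalk y).map ((differential X p).app ((sky X x).obj N)) ((X.stalk y).map (skyContractSucc x N p) s) +
      (X.stalk y).map (skyContractSucc x N (p + 1))
        ((X.stalk y).map ((differential X (p + 1)).app ((sky X x).obj N)) s) = s := by
  refine standard_ext fun c => sky_ext fun h => ?_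
  rw [map_add, map_add, differential_apply, skyVal_skyContractSucc, map_sum]
  have h1 (k : Fin (p + 2)) : skyVal h ((-1 : ℤ) ^ (k : ℕ) • res _ (c.last_face_le k)
      (component (c.face k) ((X.stalk y).map (skyContractSucc x N p) s))) =
      (-1 : ℤ) ^ (k : ℕ) • skyContractAt s (c.face k) := by
    rw [map_zsmul]
    rfl
  rw [Finset.sum_congr rfl fun k _ => h1 k]
  by_cases hc : c.last < x
  · rw [skyContractAt_of_lt _ _ hc, differential_apply, Fin.sum_univ_castSucc (n := p + 2),
      map_add, map_sum, smul_add, ← add_assoc, Finset.smul_sum, ← Finset.sum_add_distrib,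
      Finset.sum_eq_zero, zero_add (_ • _ : N)]
    · rw [map_zsmul, skyVal_res, component_eq_skyVal s (c.face_last_snoc hc) _ h, smul_smul,
        Fin.val_last, ← mul_pow]
      simp
    · intro k _
      rw [skyContractAt_of_lt _ _ ((c.last_face_le k).trans_lt hc), map_zsmul, skyVal_res,
        component_eq_skyVal s (c.face_castSucc_snoc hc k) _ (Chain.last_snoc _ _).le,
        Fin.val_castSucc, smul_smul, smul_smul, ← add_smul]
      have : (-1 : ℤ) ^ (k : ℕ) * (-1) ^ (p + 1) + (-1) ^ (p + 1 + 1) * (-1) ^ (k : ℕ) = 0 := by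
        ring
      rw [this, zero_smul]
  · have hx : c.last = x := by
      by_contra e
      exact hc (h.lt_of_ne e)
    rw [skyContractAt_of_not_lt _ _ hc, add_zero, Fin.sum_univ_castSucc, Finset.sum_eq_zero,
      zero_add (_ • _ : N)]
    · have h2 : (c.face (Fin.last (p + 1))).last < x := c.last_face_last_lt.trans_le h
      rw [skyContractAt_of_lt _ _ h2, smul_smul, Fin.val_last, ← mul_pow,
        component_eq_skyVal s (c.snoc_face_last hx h2) _ h]
      simp
    · intro k _
      rw [skyContractAt_of_not_lt, smul_zero]
      rw [c.last_face_castSucc k]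
      exact hc

/-- Here the appended point `x` does not depend on the stalk, so the contraction is a morphism of
`O`-modules. -/
lemma sky_isContractible_id : IsContractible (𝟭 X.Mod) ((sky X x).obj N) := by
  refine ⟨fun n => match n with
    | 0 => skyContractZero x N
    | p + 1 => skyContractSucc x N p, ?_, fun n => ?_⟩
  · refine hom_ext_stalk fun y m => ?_
    rfl
  · cases n with
    | zero => exact hom_ext_stalk fun y s => skyContract_zero s
    | succ p => exact hom_ext_stalk fun y s => skyContract_succ s

lemma sky_isContractible {A : Type*} [Category* A] [Preadditive A] (F : X.Mod ⥤ A) [F.Additive] :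
    IsContractible F ((sky X x).obj N) :=
  sky_isContractible_id.comp F

/-- This is the source of all acyclicity of `C^p M`: no exactness of `F` is needed, since the
contraction of a skyscraper survives `F`. -/
lemma standard_isGood {A : Type*} [Category* A] [Abelian A] (F : X.Mod ⥤ A) [F.Additive]
    (M : X.Mod) (p : ℕ) : IsGood F ((standard X p).obj M) :=
  IsGood.standard p fun _ _ => (sky_isContractible F).isGood

/-- The standard resolution of a module is exact. -/
lemma isGood_id (M : X.Mod) : IsGood (𝟭 X.Mod) M where
  mono := by
    rw [mono_iff_stalk]
    intro y
    exact (ModuleCat.mono_iff_injective _).1 (stalk_isContractible M y).isGood.mono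
  exact n := by
    rw [exact_iff_stalk]
    intro y
    exact (stalk_isContractible M y).isGood.exact n

/-- The monomorphism `I → C^0 I` splits, and goodness passes to direct summands. -/
lemma isGood_of_injective {A : Type*} [Category* A] [Abelian A] (F : X.Mod ⥤ A) [F.Additive]
    (I : X.Mod) [Injective I] : IsGood F I := by
  have : Mono ((augmentation X).app I) := (isGood_id I).mono
  exact IsGood.of_id_eq_sum ({()} : Finset Unit) (fun _ => (standard X 0).obj I)
    (fun _ => (augmentation X).app I)
    (fun _ => Injective.factorThru (𝟙 I) ((augmentation X).app I)) (by simp)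
    (fun _ _ => standard_isGood F I 0)

end SkyContraction

end FiniteRingedSpace
end

noncomputable section

section

variable {A B : Type*} [Category* A] [Category* B] [Abelian A] [Abelian B]

/-- The image of a presentation of a total complex by an additive functor. -/
def TotalPresentation.map {K : ℕ → CochainComplex A ℤ} {δ : ∀ p, K p ⟶ K (p + 1)}
    {T : CochainComplex A ℤ} (t : TotalPresentation K δ T) (F : A ⥤ B) [F.Additive] :
    TotalPresentation (fun p => (F.mapHomologicalComplex (ComplexShape.up ℤ)).obj (K p))
      (fun p => (F.mapHomologicalComplex (ComplexShape.up ℤ)).map (δ p))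
      ((F.mapHomologicalComplex (ComplexShape.up ℤ)).obj T) where
  bound := t.bound
  ι p q n h := F.map (t.ι p q n h)
  π p q n h := F.map (t.π p q n h)
  ι_π p q n h := (F.map_comp _ _).symm.trans ((congrArg F.map (t.ι_π p q n h)).trans (F.map_id _))
  ι_π_of_ne p p' q q' n h h' hp := (F.map_comp _ _).symm.trans
    ((congrArg F.map (t.ι_π_of_ne p p' q q' n h h' hp)).trans (F.map_zero _ _))
  sum_π_ι n := by
    have := congrArg F.map (t.sum_π_ι n)
    rw [F.map_sum, F.map_id] at this
    exact (Finset.sum_congr rfl fun p _ => (F.map_comp _ _).symm).trans this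
  ε := t.ε
  ι_d p q q' n n' h hq hn := by
    have := congrArg F.map (t.ι_d p q q' n n' h hq hn)
    rw [F.map_comp, F.map_add, F.map_comp, Units.smul_def, F.map_zsmul, F.map_comp] at this
    exact this

/-- When the columns are concentrated in degree `0`, the total complex is the row `q = 0`; the
condition on `ε 0` removes the sign from its differential. -/
lemma TotalPresentation.exactAt_iff {K : ℕ → CochainComplex A ℤ} {δ : ∀ p, K p ⟶ K (p + 1)}
    {T : CochainComplex A ℤ} (t : TotalPresentation K δ T) (hK : ∀ p q, q ≠ 0 → IsZero ((K p).X q))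
    (hε : t.ε 0 = 1) (hδ : ∀ p, δ p ≫ δ (p + 1) = 0) (j : ℕ) :
    T.ExactAt ((j + 1 : ℕ) : ℤ) ↔ (ShortComplex.mk ((δ j).f 0) ((δ (j + 1)).f 0) (by
      rw [← HomologicalComplex.comp_f, hδ]; rfl)).Exact := by
  have hπι (p : ℕ) (n : ℤ) (h : 0 + (p : ℤ) = n) : t.π p 0 n h ≫ t.ι p 0 n h = 𝟙 _ := by
    refine t.hom_ext_to fun p' q hq _ => ?_
    rw [Category.assoc, Category.id_comp]
    by_cases hp : p' = p
    · subst hp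
      obtain rfl : q = 0 := by lia
      rw [t.ι_π, Category.comp_id]
    · exact (hK p' q (by lia)).eq_of_tgt _ _
  let i (p : ℕ) (n : ℤ) (h : 0 + (p : ℤ) = n) : (K p).X 0 ≅ T.X n :=
    { hom := t.ι p 0 n h
      inv := t.π p 0 n h
      hom_inv_id := t.ι_π _ _ _ _
      inv_hom_id := hπι _ _ _ }
  have hd (p : ℕ) (n n' : ℤ) (h : 0 + (p : ℤ) = n) (hn : n + 1 = n') :
      t.ι p 0 n h ≫ T.d n n' = (δ p).f 0 ≫ t.ι (p + 1) 0 n' (by push_cast; lia) := by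
    rw [t.ι_d p 0 1 n n' h rfl hn, (hK p 1 one_ne_zero).eq_of_tgt ((K p).d 0 1) 0, zero_comp,
      zero_add (_ • _ : (K p).X 0 ⟶ _), hε, one_smul]
  rw [T.exactAt_iff' (j : ℤ) ((j + 1 : ℕ) : ℤ) ((j + 2 : ℕ) : ℤ) (by simp)
    (by simp; lia)]
  refine (ShortComplex.exact_iff_of_iso (ShortComplex.isoMk (i j _ (by simp))
    (i (j + 1) _ (by simp)) (i (j + 2) _ (by simp)) ?_ ?_)).symm
  · exact hd _ _ _ _ (by simp)
  · exact hd _ _ _ _ (by push_cast; lia)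

end

namespace FiniteRingedSpace

variable {X Y : FiniteRingedSpace.{u}}

lemma standard_isZero_of_isEmpty {p : ℕ} (h : IsEmpty (X.StrictChain p)) (M : X.Mod) :
    IsZero ((standard X p).obj M) := by
  rw [IsZero.iff_id_eq_zero, ← StrictChain.sum_proj_comp_incl]
  simp

lemma StrictChain.isEmpty_of_card_le {p : ℕ} (h : Nat.card X.carrier ≤ p) :
    IsEmpty (X.StrictChain p) :=
  ⟨fun c => by
    have := Nat.card_le_card_of_injective c.1 c.2.injective
    rw [Nat.card_fin] at this
    lia⟩

lemma StrictChain.isEmpty_of_krullDim_lt {p : ℕ} (h : Order.krullDim X.carrier < (p : WithBot ℕ∞)) :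
    IsEmpty (X.StrictChain p) :=
  ⟨fun c => h.not_ge (Order.LTSeries.length_le_krullDim
    ({ length := p, toFun := c.1, step := fun _ => c.2 Fin.castSucc_lt_succ } :
      LTSeries X.carrier))⟩

/-! ### `C^• M` as a total complex with finitely many columns. -/

section Total

/-- The inclusion `C^p M^q → (C^• M)^n`. -/
def totalι (M : CochainComplex X.Mod ℤ) (p : ℕ) (q n : ℤ) (h : q + p = n) :
    (standard X p).obj (M.X q) ⟶ (X.totalStandard.obj M).X n :=
  (X.bicomplex.obj M).ιTotal (ComplexShape.up ℤ) q p n h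

open Classical in
/-- The projection `(C^• M)^n → C^p M^q`. -/
def totalπ (M : CochainComplex X.Mod ℤ) (p : ℕ) (q n : ℤ) (h : q + p = n) :
    (X.totalStandard.obj M).X n ⟶ (standard X p).obj (M.X q) :=
  (X.bicomplex.obj M).totalDesc fun q' p' h' =>
    if hp : p' = p then ((X.bicomplex.obj M).XXIsoOfEq _ _ _
      (show q' = q by subst hp; exact add_right_cancel (h'.trans h.symm)) hp).hom else 0

lemma totalι_totalπ (M : CochainComplex X.Mod ℤ) (p : ℕ) (q n : ℤ) (h : q + p = n) :
    totalι M p q n h ≫ totalπ M p q n h = 𝟙 _ :=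
  ((X.bicomplex.obj M).ι_totalDesc _ _ _ _).trans ((dif_pos rfl).trans
    (congrArg Iso.hom (HomologicalComplex₂.XXIsoOfEq_rfl _ _ _ _ _ _)))

lemma totalι_totalπ_of_ne (M : CochainComplex X.Mod ℤ) (p p' : ℕ) (q q' n : ℤ) (h : q + p = n)
    (h' : q' + p' = n) (hp : p ≠ p') : totalι M p q n h ≫ totalπ M p' q' n h' = 0 :=
  ((X.bicomplex.obj M).ι_totalDesc _ _ _ _).trans (dif_neg hp)

lemma total_hom_ext {M : CochainComplex X.Mod ℤ} {n : ℤ} {Z : X.Mod}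
    {f g : (X.totalStandard.obj M).X n ⟶ Z}
    (h : ∀ p q (h : q + (p : ℕ) = n), totalι M p q n h ≫ f = totalι M p q n h ≫ g) : f = g :=
  HomologicalComplex₂.total.hom_ext (ComplexShape.up ℤ) (fun q p hpq => h p q hpq)

lemma totalι_map {M N : CochainComplex X.Mod ℤ} (f : M ⟶ N) (p : ℕ) (q n : ℤ) (h : q + p = n) :
    totalι M p q n h ≫ (X.totalStandard.map f).f n =
      (standard X p).map (f.f q) ≫ totalι N p q n h :=
  HomologicalComplex₂.ιTotal_map _ _ (X.bicomplex.map f) (ComplexShape.up ℤ) q p n h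

lemma totalπ_map {M N : CochainComplex X.Mod ℤ} (f : M ⟶ N) (p : ℕ) (q n : ℤ) (h : q + p = n) :
    (X.totalStandard.map f).f n ≫ totalπ N p q n h =
      totalπ M p q n h ≫ (standard X p).map (f.f q) := by
  refine total_hom_ext fun p' q' h' => ?_
  rw [← Category.assoc, totalι_map, ← Category.assoc, Category.assoc]
  by_cases hp : p' = p
  · subst hp
    obtain rfl : q' = q := add_right_cancel (h'.trans h.symm)
    rw [totalι_totalπ, totalι_totalπ, Category.comp_id, Category.id_comp]
  · rw [totalι_totalπ_of_ne _ _ _ _ _ _ _ _ hp, totalι_totalπ_of_ne _ _ _ _ _ _ _ _ hp, comp_zero,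
      zero_comp]

lemma totalι_d (M : CochainComplex X.Mod ℤ) (p : ℕ) (q q' n n' : ℤ) (h : q + p = n)
    (hq : q + 1 = q') (hn : n + 1 = n') :
    totalι M p q n h ≫ (X.totalStandard.obj M).d n n' =
      (standard X p).map (M.d q q') ≫ totalι M p q' n' (by lia) +
        q.negOnePow • ((differential X p).app (M.X q) ≫
          totalι M (p + 1) q n' (by push_cast; lia)) := by
  have h1 : (X.totalStandard.obj M).d n n' = (X.bicomplex.obj M).D₁ (ComplexShape.up ℤ) n n' +
      (X.bicomplex.obj M).D₂ (ComplexShape.up ℤ) n n' :=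
    HomologicalComplex₂.total_d _ _ _ _
  rw [h1]
  refine (Preadditive.comp_add _ _ _ _ _ _).trans (congrArg₂ (· + ·) ?_ ?_)
  · refine (HomologicalComplex₂.ι_D₁ _ _ _ _ _ _ _).trans ?_
    refine (HomologicalComplex₂.d₁_eq _ _ (i₁' := q') hq _ _ (by
      subst hn; subst hq; change q + 1 + (p : ℤ) = n + 1; lia)).trans ?_
    exact one_smul _ _
  · refine (HomologicalComplex₂.ι_D₂ _ _ _ _ _ _ _).trans ?_
    refine (HomologicalComplex₂.d₂_eq _ _ _ (i₂' := p + 1) rfl _ (by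
      subst hn; change q + ((p + 1 : ℕ) : ℤ) = n + 1; push_cast; lia)).trans ?_
    exact congrArg (fun f => q.negOnePow • (f ≫ totalι M (p + 1) q n' (by push_cast; lia)))
      (CochainComplex.of_d (fun p => (standard X p).obj (M.X q))
        (fun p => (differential X p).app (M.X q)) p)

/-- A chain `x_0 < … < x_p` has `p + 1` distinct points, so `C^p = 0` once `p` reaches the number of
points of `X`. Each degree of `C^• M` is therefore a finite sum, even for unbounded `M`. -/
lemma sum_totalπ_totalι (M : CochainComplex X.Mod ℤ) (n : ℤ) :
    ∑ p ∈ Finset.range (Nat.card X.carrier + 1),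
      totalπ M p (n - p) n (by lia) ≫ totalι M p (n - p) n (by lia) = 𝟙 _ := by
  refine total_hom_ext fun p q h => ?_
  rw [Category.comp_id, Preadditive.comp_sum]
  by_cases hp : p < Nat.card X.carrier + 1
  · rw [Finset.sum_eq_single_of_mem p (Finset.mem_range.2 hp)]
    · obtain rfl : q = n - p := by lia
      rw [← Category.assoc, totalι_totalπ, Category.id_comp]
    · intro p' _ hp'
      rw [← Category.assoc, totalι_totalπ_of_ne _ _ _ _ _ _ _ _ hp'.symm, zero_comp]
  · exact (standard_isZero_of_isEmpty (StrictChain.isEmpty_of_card_le (by lia)) _).eq_of_src _ _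

/-- The columns `C^p M^•` of the bicomplex of a complex. -/
abbrev column (p : ℕ) : CochainComplex X.Mod ℤ ⥤ CochainComplex X.Mod ℤ :=
  (standard X p).mapHomologicalComplex (ComplexShape.up ℤ)

/-- The morphism between columns induced by the differential of the standard complexes. -/
abbrev columnD (M : CochainComplex X.Mod ℤ) (p : ℕ) :
    (column p).obj M ⟶ (column (p + 1)).obj M :=
  (NatTrans.mapHomologicalComplex (differential X p) (ComplexShape.up ℤ)).app M

lemma columnD_comp_columnD (M : CochainComplex X.Mod ℤ) (p : ℕ) :
    columnD M p ≫ columnD M (p + 1) = 0 := by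
  ext q : 1
  exact differential_comp_differential_app X (M.X q) p

/-- The complex `C^• M` is the total complex of the bicomplex `C^p M^q`. -/
def totalPresentation (M : CochainComplex X.Mod ℤ) :
    TotalPresentation (fun p => (column p).obj M) (columnD M) (X.totalStandard.obj M) where
  bound := Nat.card X.carrier
  ι := totalι M
  π := totalπ M
  ι_π := totalι_totalπ M
  ι_π_of_ne := totalι_totalπ_of_ne M
  sum_π_ι := sum_totalπ_totalι M
  ε := Int.negOnePow
  ι_d := totalι_d M

instance : (totalStandard X).Additive where
  map_add {M N f g} := by
    ext n : 1
    refine total_hom_ext fun p q h => ?_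
    rw [HomologicalComplex.add_f_apply, Preadditive.comp_add, totalι_map, totalι_map, totalι_map,
      ← Preadditive.add_comp, ← Functor.map_add]
    rfl

end Total

end FiniteRingedSpace
end

noncomputable section
namespace FiniteRingedSpace

variable {X Y : FiniteRingedSpace.{u}}

/-! ### Functors exact on skyscrapers: the standard resolution computes their derived functors. -/

section SkyExact

variable {A : Type*} [Category* A] [Abelian A] (F : X.Mod ⥤ A) [F.Additive]

/-- The functor is exact on skyscrapers. -/
def SkyExact : Prop := ∀ (x : X.carrier) (S : ShortComplex (ModuleCat.{u} (X.O.obj x))), S.Exact →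
  (S.map (sky X x ⋙ F)).Exact

/-- The functor `M ↦ F(C^• M)` on complexes. -/
abbrev totalMap : CochainComplex X.Mod ℤ ⥤ CochainComplex A ℤ :=
  X.totalStandard ⋙ F.mapHomologicalComplex (ComplexShape.up ℤ)

variable {F}

/-- In degree `n`, `F(C^• M)` is the finite sum of the `F(C^p M^{n-p})`, and each `C^p ⋙ F` is
exact. -/
lemma SkyExact.totalMap_exact (hF : SkyExact F) (S : ShortComplex (CochainComplex X.Mod ℤ))
    (hS : S.Exact) : (S.map (totalMap F)).Exact := by
  refine HomologicalComplex.exact_of_degreewise_exact _ fun n => ?_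
  have key := Functor.map_exact_of_id_eq_sum (C := CochainComplex X.Mod ℤ)
    (F := totalMap F ⋙ HomologicalComplex.eval _ _ n)
    (Finset.range (Nat.card X.carrier + 1))
    (fun p => HomologicalComplex.eval _ _ (n - p) ⋙ (standard X p ⋙ F))
    (fun p =>
      { app M := F.map (totalπ M p (n - p) n (by lia))
        naturality M N f := by
          refine (F.map_comp _ _).symm.trans (Eq.trans ?_ (F.map_comp _ _))
          exact congrArg F.map (totalπ_map f p (n - p) n (by lia)) })
    (fun p =>
      { app M := F.map (totalι M p (n - p) n (by lia))
        naturality M N f := by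
          refine (F.map_comp _ _).symm.trans (Eq.trans ?_ (F.map_comp _ _))
          exact congrArg F.map (totalι_map f p (n - p) n (by lia)).symm })
    (fun M => ((totalPresentation M).map F).sum_π_ι n |>.symm)
    (fun p _ S hS => standard_comp_map_exact F hF p (S.map (HomologicalComplex.eval _ _ (n - p)))
      (hS.map (HomologicalComplex.eval _ _ (n - p))))
  exact key S hS

lemma exact_map_of_acyclic {B : Type*} [Category* B] [Abelian B] (G : B ⥤ A) [G.Additive]
    (hG : ∀ S : ShortComplex B, S.Exact → (S.map G).Exact) {K : CochainComplex B ℤ}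
    (hK : K.Acyclic) : ((G.mapHomologicalComplex (ComplexShape.up ℤ)).obj K).Acyclic := fun n =>
  hG (K.sc n) (hK n)

/-- Each column `F(C^p M^•)` is acyclic by exactness of `C^p ⋙ F`; finiteness of the number of
columns removes any boundedness condition on `M`. -/
lemma SkyExact.acyclic (hF : SkyExact F) (M : CochainComplex X.Mod ℤ) (hM : M.Acyclic) :
    ((totalMap F).obj M).Acyclic :=
  ((totalPresentation M).map F).acyclic fun p =>
    exact_map_of_acyclic (standard X p ⋙ F) (standard_comp_map_exact F hF p) hM

/-- This makes `F(C^• -)` descend to the unbounded derived category. -/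
lemma SkyExact.quasiIso (hF : SkyExact F) {M N : CochainComplex X.Mod ℤ} (f : M ⟶ N)
    [QuasiIso f] : QuasiIso ((totalMap F).map f) :=
  CochainComplex.quasiIso_map_of_acyclic (totalMap F)
    (Functor.map_shortExact_of_map_exact hF.totalMap_exact) hF.acyclic f

/-- If the terms of `M` are good, then `F(M) → F(C^• M)` is a quasi-isomorphism. -/
lemma quasiIso_map_toTotalStandard (M : CochainComplex X.Mod ℤ) (hM : ∀ n, IsGood F (M.X n)) :
    QuasiIso ((F.mapHomologicalComplex (ComplexShape.up ℤ)).map (X.toTotalStandard.app M)) := by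
  let e : M ⟶ (column 0).obj M :=
    { f q := (augmentation X).app (M.X q)
      comm' q q' _ := ((augmentation X).naturality (M.d q q')).symm }
  have he : e ≫ columnD M 0 = 0 := by
    ext q : 1
    exact congrArg (fun α => NatTrans.app α (M.X q)) (augmentation_comp_differential X)
  refine ((totalPresentation M).map F).quasiIso (fun p => ?_) (fun p q => ?_)
    ((F.mapHomologicalComplex (ComplexShape.up ℤ)).map e) ?_ (fun q => ?_) (fun q => ?_) _
    (fun n => ?_)
  · rw [← Functor.map_comp, columnD_comp_columnD, Functor.map_zero]
  · exact (hM q).exact (p + 1)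
  · rw [← Functor.map_comp, he, Functor.map_zero]
  · exact (hM q).exact 0
  · exact (hM q).mono
  · exact F.map_comp _ _

instance quasiIso_toTotalStandard (M : CochainComplex X.Mod ℤ) :
    QuasiIso (X.toTotalStandard.app M) :=
  quasiIso_map_toTotalStandard (F := 𝟭 X.Mod) M fun _ => isGood_id _

variable (F)

lemma exactAt_totalMap_single (N : X.Mod) (j : ℕ) :
    ((totalMap F).obj ((CochainComplex.singleFunctor X.Mod 0).obj N)).ExactAt ((j + 1 : ℕ) : ℤ) ↔
      ((augSc F (j + 1)).obj N).Exact := by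
  let M := (CochainComplex.singleFunctor X.Mod 0).obj N
  have hM (q : ℤ) (hq : q ≠ 0) : IsZero (M.X q) :=
    HomologicalComplex.isZero_single_obj_X (ComplexShape.up ℤ) 0 N q hq
  refine (((totalPresentation M).map F).exactAt_iff (fun p q hq =>
    (standard X p ⋙ F).map_isZero (hM q hq)) Int.negOnePow_zero (fun p => ?_) j).trans ?_
  · rw [← Functor.map_comp, columnD_comp_columnD, Functor.map_zero]
  · exact ShortComplex.exact_iff_of_iso
      ((augSc F (j + 1)).mapIso (HomologicalComplex.singleObjXSelf (ComplexShape.up ℤ) 0 N))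

lemma exactAt_map_cochainComplex {N : X.Mod} (I : InjectiveResolution N) (j : ℕ) :
    ((F.mapHomologicalComplex (ComplexShape.up ℤ)).obj I.cochainComplex).ExactAt
      ((j + 1 : ℕ) : ℤ) ↔
    ((F.mapHomologicalComplex (ComplexShape.up ℕ)).obj I.cocomplex).ExactAt (j + 1) := by
  rw [HomologicalComplex.exactAt_iff' _ (j : ℤ) ((j + 1 : ℕ) : ℤ) ((j + 2 : ℕ) : ℤ) (by simp)
    (by simp; lia), HomologicalComplex.exactAt_iff' _ j (j + 1) (j + 2) (by simp) (by simp)]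
  have h (j : ℕ) : F.map (I.cochainComplexXIso (j : ℤ) j rfl).hom ≫
      F.map (I.cocomplex.d j (j + 1)) = F.map (I.cochainComplex.d (j : ℤ) ((j + 1 : ℕ) : ℤ)) ≫
        F.map (I.cochainComplexXIso ((j + 1 : ℕ) : ℤ) (j + 1) rfl).hom := by
    rw [I.cochainComplex_d _ _ j (j + 1) rfl rfl, ← F.map_comp, ← F.map_comp, Category.assoc,
      Category.assoc, Iso.inv_hom_id, Category.comp_id]
  refine ShortComplex.exact_iff_of_iso (ShortComplex.isoMk
    (F.mapIso (I.cochainComplexXIso (j : ℤ) j rfl))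
    (F.mapIso (I.cochainComplexXIso ((j + 1 : ℕ) : ℤ) (j + 1) rfl))
    (F.mapIso (I.cochainComplexXIso ((j + 2 : ℕ) : ℤ) (j + 2) rfl)) ?_ ?_)
  · exact h j
  · exact h (j + 1)

variable {F}

/-- If `F` is exact on skyscrapers, then the derived functors of `F` are computed by the standard
resolution. -/
lemma SkyExact.isZero_rightDerived_iff (hF : SkyExact F) (N : X.Mod) (j : ℕ) :
    IsZero ((F.rightDerived (j + 1)).obj N) ↔ ((augSc F (j + 1)).obj N).Exact := by
  let I := injectiveResolution N
  -- In `F(C^• N) → F(C^• I) ← F(I)` the first morphism is a quasi-isomorphism because `F(C^• -)`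
  -- preserves them, the second because injective modules are good.
  have h1 : QuasiIso ((totalMap F).map I.ι') := hF.quasiIso _
  have h2 := quasiIso_map_toTotalStandard (F := F) I.cochainComplex
    (fun n => isGood_of_injective F _)
  rw [(I.isoRightDerivedObj F (j + 1)).isZero_iff]
  refine (HomologicalComplex.exactAt_iff_isZero_homology _ _).symm.trans ?_
  rw [← exactAt_map_cochainComplex, ← exactAt_totalMap_single]
  exact (exactAt_iff_of_quasiIsoAt ((F.mapHomologicalComplex (ComplexShape.up ℤ)).map
    (X.toTotalStandard.app I.cochainComplex)) _).trans
    (exactAt_iff_of_quasiIsoAt ((totalMap F).map I.ι') _).symm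

lemma SkyExact.isZero_rightDerived_standard (hF : SkyExact F) (N : X.Mod) (i j : ℕ) (hj : 0 < j) :
    IsZero ((F.rightDerived j).obj ((standard X i).obj N)) := by
  obtain ⟨j, rfl⟩ := Nat.exists_eq_succ_of_ne_zero hj.ne'
  exact (hF.isZero_rightDerived_iff _ j).2 ((standard_isGood F N i).exact (j + 1))

lemma SkyExact.isZero_rightDerived_of_krullDim_lt (hF : SkyExact F) (N : X.Mod) (i : ℕ)
    (hi : Order.krullDim X.carrier < (i : WithBot ℕ∞)) : IsZero ((F.rightDerived i).obj N) := by
  have h := StrictChain.isEmpty_of_krullDim_lt hi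
  cases i with
  -- A negative dimension means that `X` is empty, so every module is zero.
  | zero =>
    have hX : IsEmpty X.carrier := ⟨fun x => h.false ⟨fun _ => x, fun i j hij =>
      absurd (Subsingleton.elim (α := Fin 1) i j) hij.ne⟩⟩
    let I := injectiveResolution N
    rw [(I.isoRightDerivedObj F 0).isZero_iff]
    refine (HomologicalComplex.exactAt_iff_isZero_homology _ _).1
      (ShortComplex.exact_of_isZero_X₂ _ (F.map_isZero ?_))
    rw [isZero_iff_stalk]
    exact fun x => hX.elim x
  | succ j =>
    rw [hF.isZero_rightDerived_iff]
    exact ShortComplex.exact_of_isZero_X₂ _ (F.map_isZero (standard_isZero_of_isEmpty h N))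

/-- For a left exact functor, goodness can be checked in positive degrees. -/
lemma isGood_iff_of_preservesFiniteLimits [PreservesFiniteLimits F] (N : X.Mod) :
    IsGood F N ↔ ∀ j, ((augSc F (j + 1)).obj N).Exact := by
  refine ⟨fun h j => h.exact (j + 1), fun h => ?_⟩
  have hN := isGood_id N
  have : Mono ((augD X 0).app N) := hN.mono
  refine ⟨inferInstance, fun n => ?_⟩
  cases n with
  | zero => exact ((hN.exact 0).map_of_mono_of_preservesKernel F this inferInstance)
  | succ n => exact h n

lemma SkyExact.isGood_iff (hF : SkyExact F) [PreservesFiniteLimits F] (N : X.Mod) :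
    IsGood F N ↔ ∀ j, 0 < j → IsZero ((F.rightDerived j).obj N) := by
  rw [isGood_iff_of_preservesFiniteLimits]
  refine ⟨fun h j hj => ?_, fun h j => ?_⟩
  · obtain ⟨j, rfl⟩ := Nat.exists_eq_succ_of_ne_zero hj.ne'
    exact (hF.isZero_rightDerived_iff _ j).2 (h j)
  · exact (hF.isZero_rightDerived_iff _ j).1 (h _ j.succ_pos)

/-- In `F(C^• N) → F(C^• M) ← F(M) ← F(N)` all morphisms are quasi-isomorphisms, and `F(N)` sits in
degree `0`. So goodness can be tested on any resolution by good modules that stays a resolution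
after `F`. -/
lemma SkyExact.isGood_of_quasiIso (hF : SkyExact F) [PreservesFiniteLimits F] {N : X.Mod}
    {M : CochainComplex X.Mod ℤ} (f : (CochainComplex.singleFunctor X.Mod 0).obj N ⟶ M)
    [QuasiIso f] (hM : ∀ n, IsGood F (M.X n))
    (h : QuasiIso ((F.mapHomologicalComplex (ComplexShape.up ℤ)).map f)) : IsGood F N := by
  rw [isGood_iff_of_preservesFiniteLimits]
  intro j
  rw [← exactAt_totalMap_single]
  have h1 : QuasiIso ((totalMap F).map f) := hF.quasiIso _
  have h2 := quasiIso_map_toTotalStandard (F := F) M hM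
  refine (exactAt_iff_of_quasiIsoAt ((totalMap F).map f) _).2
    ((exactAt_iff_of_quasiIsoAt ((F.mapHomologicalComplex (ComplexShape.up ℤ)).map
      (X.toTotalStandard.app M)) _).1 ((exactAt_iff_of_quasiIsoAt
      ((F.mapHomologicalComplex (ComplexShape.up ℤ)).map f) _).1 ?_))
  exact ShortComplex.exact_of_isZero_X₂ _ (F.map_isZero
    (HomologicalComplex.isZero_single_obj_X (ComplexShape.up ℤ) 0 N _ (by lia)))

end SkyExact

end FiniteRingedSpace
end

noncomputable section
namespace FiniteRingedSpace

variable {X Y : FiniteRingedSpace.{u}}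

/-! ### Direct images are left exact, and exact on skyscrapers. -/

section Pushforward

variable (f : Hom X Y)

/-- The value at a point of a section of a direct image. -/
def secVal {M : X.Mod} {y : Y.carrier} {x : X.carrier} (h : y ≤ f.base x) :
    (Y.stalk y).obj ((pushforward f).obj M) →+ (X.stalk x).obj M where
  toFun s := (show sectionsOver f M y from s).1 ⟨x, h⟩
  map_zero' := rfl
  map_add' _ _ := rfl

variable {f}

lemma secVal_smul {M : X.Mod} {y : Y.carrier} {x : X.carrier} (h : y ≤ f.base x) (a : Y.O.obj y)
    (s : (Y.stalk y).obj ((pushforward f).obj M)) :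
    secVal f h (a • s) = f.ringMap h a • secVal f h s := rfl

lemma res_secVal {M : X.Mod} {y : Y.carrier} {x x' : X.carrier} (h : y ≤ f.base x)
    (h' : x ≤ x') (s : (Y.stalk y).obj ((pushforward f).obj M)) :
    res M h' (secVal f h s) = secVal f (h.trans (f.base.monotone h')) s :=
  (show sectionsOver f M y from s).2 ⟨x, h⟩ ⟨x', h.trans (f.base.monotone h')⟩ h'

lemma sec_ext {M : X.Mod} {y : Y.carrier} {s t : (Y.stalk y).obj ((pushforward f).obj M)}
    (h : ∀ x (h : y ≤ f.base x), secVal f h s = secVal f h t) : s = t :=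
  Subtype.ext (funext fun x => h x.1 x.2)

/-- The section of a direct image with given values. -/
def secMk {M : X.Mod} {y : Y.carrier} (s : ∀ x, y ≤ f.base x → (X.stalk x).obj M)
    (hs : ∀ x x' h h' (hx : x ≤ x'), res M hx (s x h) = s x' h') :
    (Y.stalk y).obj ((pushforward f).obj M) :=
  (⟨fun x => s x.1 x.2, fun x x' h => hs x.1 x'.1 x.2 x'.2 h⟩ : sectionsOver f M y)

/-- A section over `f⁻¹(U_y)` of a skyscraper at `z` is determined by its value at `z`, which is
arbitrary if `y ≤ f(z)`; otherwise there are no nonzero sections. So the direct image is a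
skyscraper at `f(z)`. -/
lemma pushforward_skyExact : SkyExact (pushforward f) := by
  intro z S hS
  rw [exact_iff_forall]
  rw [ShortComplex.moduleCat_exact_iff] at hS
  intro y m hm
  change (Y.stalk y).obj ((pushforward f).obj ((sky X z).obj S.X₂)) at m
  have key {L : ModuleCat.{u} (X.O.obj z)}
      (s : (Y.stalk y).obj ((pushforward f).obj ((sky X z).obj L))) {x : X.carrier}
      (h : y ≤ f.base x) (hx : x ≤ z) (hz : y ≤ f.base z) :
      skyVal hx (secVal f h s) = skyVal le_rfl (secVal f hz s) := by
    rw [← res_secVal h hx s, skyVal_res]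
  by_cases h : y ≤ f.base z
  · obtain ⟨n, hn⟩ := hS (skyVal le_rfl (secVal f h m))
      (congrArg (fun t => skyVal le_rfl (secVal f h t)) hm)
    refine ⟨secMk (fun x _ => skyMk fun _ => n) (fun _ _ _ _ _ => rfl), ?_⟩
    refine sec_ext fun x hx => sky_ext fun hx' => ?_
    exact hn.trans (key m hx hx' h).symm
  · exact ⟨0, sec_ext fun x hx => sky_ext fun hx' => (h (hx.trans (f.base.monotone hx'))).elim⟩

instance pushforward_preservesFiniteLimits (f : Hom X Y) :
    PreservesFiniteLimits (pushforward f) := by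
  have := ((Functor.preservesFiniteLimits_tfae (pushforward f)).out 0 3).1
  refine this fun S hS => ?_
  have h1 := (mono_iff_stalk _).1 hS.mono_f
  refine ⟨?_, ?_⟩
  · rw [exact_iff_forall]
    intro y m hm
    change (Y.stalk y).obj ((pushforward f).obj S.X₂) at m
    have h2 (x : X.carrier) (h : y ≤ f.base x) :=
      (exact_iff_forall S).1 hS.exact x (secVal f h m) (congrArg (secVal f h) hm)
    choose n hn using h2
    refine ⟨secMk n fun x x' h h' hx => h1 x' ?_, sec_ext fun x hx => hn x hx⟩
    rw [← res_app, hn, hn, res_secVal]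
  · rw [mono_iff_stalk]
    intro y s t hst
    exact sec_ext fun x hx => h1 x (congrArg (secVal f hx) hst)

end Pushforward

lemma IsQcoh.of_iso {M N : X.Mod} (h : X.IsQcoh M) (e : M ≅ N) : X.IsQcoh N := fun _ _ f => by
  have := h f
  exact (NatTrans.isIso_app_iff_of_iso (X.tensorRes f) e).1 this

/-! ### The slice of `δ_*` over `{x} × X` is `j_* j^*` for the inclusion `j` of `U_x`. -/

section Diagonal

/-- The point `(x, y)` of the product. -/
abbrev pt (x y : X.carrier) : (X.prod X).carrier := (show X.ProdCarrier X from (x, y))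

lemma pt_le {x y x' y' : X.carrier} (h : x ≤ x') (h' : y ≤ y') : pt x y ≤ pt x' y' := ⟨h, h'⟩

/-- The ring morphism `O_y → O_x ⊗ O_y`. -/
def inclRight (x y : X.carrier) : X.O.obj y →+* (X.prod X).O.obj (pt x y) :=
  (Algebra.TensorProduct.includeRight :
    X.O.obj y →ₐ[ℤ] TensorProduct ℤ (X.O.obj x) (X.O.obj y)).toRingHom

lemma map_inclRight (x : X.carrier) {y y' : X.carrier} (h : y ≤ y') (a : X.O.obj y) :
    ((X.prod X).O.map (homOfLE (pt_le (le_refl x) h))).hom (inclRight x y a) =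
      inclRight x y' ((X.O.map (homOfLE h)).hom a) := by
  change (X.O.map (homOfLE (le_refl x))).hom 1 ⊗ₜ[ℤ] (X.O.map (homOfLE h)).hom a = 1 ⊗ₜ _
  rw [map_one]

lemma ringMap_inclRight {x y w : X.carrier} (h : x ≤ w) (h' : y ≤ w) (a : X.O.obj y) :
    X.diag.ringMap (show pt x y ≤ X.diag.base w from pt_le h h') (inclRight x y a) =
      (X.O.map (homOfLE h')).hom a := by
  change (X.O.map (homOfLE h)).hom 1 * (X.O.map (homOfLE h')).hom a = _
  rw [map_one, one_mul]

/-- The data of the restriction of a module on `X × X` to `{x} × X`. -/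
def sliceData (x : X.carrier) (G : (X.prod X).Mod) : X.ModData where
  stalk y := (ModuleCat.restrictScalars (inclRight x y)).obj (((X.prod X).stalk (pt x y)).obj G)
  res h := res G (pt_le (le_refl x) h)
  res_smul {y y'} h a m := by
    refine (res_smul G (pt_le (le_refl x) h) (inclRight x y a) m).trans ?_
    rw [map_inclRight]
    rfl
  res_self m := res_self G _ m
  res_res h h' m := res_res G _ _ m

/-- The restriction of modules on `X × X` to `{x} × X`. -/
def slice (x : X.carrier) : (X.prod X).Mod ⥤ X.Mod where
  obj G := (sliceData x G).toMod
  map {G H} g := homMk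
    (fun y =>
      { toFun (s : (sliceData x G).stalk y) :=
          (((X.prod X).stalk (pt x y)).map g s : (sliceData x H).stalk y)
        map_add' s t := map_add (((X.prod X).stalk (pt x y)).map g).hom s t
        map_smul' a s := map_smul (((X.prod X).stalk (pt x y)).map g).hom (inclRight x y a)
          (show ((X.prod X).stalk (pt x y)).obj G from s) })
    (fun h s => res_app g (pt_le (le_refl x) h) s)
  map_id _ := rfl
  map_comp _ _ := rfl

instance (x : X.carrier) : (slice x).Additive where
  map_add := rfl

lemma slice_map_exact (x : X.carrier) (S : ShortComplex (X.prod X).Mod) (hS : S.Exact) :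
    (S.map (slice x)).Exact := by
  rw [exact_iff_forall]
  intro y
  exact (exact_iff_forall S).1 hS (pt x y)

/-- The functor `M ↦ j_* j^* M`, where `j` is the inclusion of `U_x`. -/
def nearby (x : X.carrier) : X.Mod ⥤ X.Mod := pushforward X.diag ⋙ slice x

instance (x : X.carrier) : (nearby x).Additive :=
  inferInstanceAs (pushforward X.diag ⋙ slice x).Additive

lemma nearby_skyExact (x : X.carrier) : SkyExact (nearby x) := fun z S hS =>
  slice_map_exact x _ (pushforward_skyExact z S hS)

instance (x : X.carrier) : PreservesFiniteLimits (nearby x) := by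
  have : PreservesFiniteLimits (slice (X := X) x) := by
    have h := ((Functor.exact_tfae (slice (X := X) x)).out 1 3 :)
    exact (h.1 (slice_map_exact x)).1
  exact inferInstanceAs (PreservesFiniteLimits (pushforward X.diag ⋙ slice x))

variable {x : X.carrier}

/-- The value at a point of `U_x ∩ U_y` of a section of `j_* j^* M` over `U_y`. -/
def nearbyVal {M : X.Mod} {y w : X.carrier} (h : x ≤ w) (h' : y ≤ w) :
    (X.stalk y).obj ((nearby x).obj M) →+ (X.stalk w).obj M :=
  secVal X.diag (M := M) (show pt x y ≤ X.diag.base w from pt_le h h')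

lemma nearbyVal_smul {M : X.Mod} {y w : X.carrier} (h : x ≤ w) (h' : y ≤ w) (a : X.O.obj y)
    (s : (X.stalk y).obj ((nearby x).obj M)) :
    nearbyVal h h' (a • s) = (X.O.map (homOfLE h')).hom a • nearbyVal h h' s := by
  refine (secVal_smul (M := M) (f := X.diag) _ (inclRight x y a) s).trans ?_
  rw [ringMap_inclRight h h']
  rfl

lemma nearbyVal_res {M : X.Mod} {y y' w : X.carrier} (h : x ≤ w) (h' : y ≤ w) (hy : y' ≤ y)
    (s : (X.stalk y').obj ((nearby x).obj M)) :
    nearbyVal h h' (res _ hy s) = nearbyVal h (hy.trans h') s := rfl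

lemma nearbyVal_map {M N : X.Mod} (g : M ⟶ N) {y w : X.carrier} (h : x ≤ w) (h' : y ≤ w)
    (s : (X.stalk y).obj ((nearby x).obj M)) :
    nearbyVal h h' ((X.stalk y).map ((nearby x).map g) s) = (X.stalk w).map g (nearbyVal h h' s) :=
  rfl

lemma res_nearbyVal {M : X.Mod} {y w w' : X.carrier} (h : x ≤ w) (h' : y ≤ w) (hw : w ≤ w')
    (s : (X.stalk y).obj ((nearby x).obj M)) :
    res M hw (nearbyVal h h' s) = nearbyVal (h.trans hw) (h'.trans hw) s :=
  res_secVal (M := M) (f := X.diag) _ hw s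

lemma nearby_ext {M : X.Mod} {y : X.carrier} {s t : (X.stalk y).obj ((nearby x).obj M)}
    (h : ∀ w (h : x ≤ w) (h' : y ≤ w), nearbyVal h h' s = nearbyVal h h' t) : s = t :=
  sec_ext (M := M) (f := X.diag) fun w hw => h w hw.1 hw.2

/-- The section of `j_* j^* M` with given values. -/
def nearbyMk {M : X.Mod} {y : X.carrier} (s : ∀ w, x ≤ w → y ≤ w → (X.stalk w).obj M)
    (hs : ∀ w w' h₁ h₂ h₁' h₂' (hw : w ≤ w'), res M hw (s w h₁ h₂) = s w' h₁' h₂') :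
    (X.stalk y).obj ((nearby x).obj M) :=
  secMk (M := M) (f := X.diag) (y := pt x y) (fun w h => s w h.1 h.2)
    (fun _ _ _ _ hw => hs _ _ _ _ _ _ hw)

/-- The functor `j_* j^*` only depends on the stalks at the points of `U_x`. -/
lemma isIso_nearby_map {M N : X.Mod} (g : M ⟶ N)
    (hg : ∀ w, x ≤ w → Function.Bijective ((X.stalk w).map g)) : IsIso ((nearby x).map g) := by
  rw [isIso_iff_stalk]
  intro y
  refine ⟨fun s t hst => nearby_ext fun w h h' => (hg w h).1 ?_, fun t => ?_⟩
  · rw [← nearbyVal_map, ← nearbyVal_map, hst]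
  · have h2 (w : X.carrier) (h : x ≤ w) (h' : y ≤ w) := (hg w h).2 (nearbyVal h h' t)
    choose s hs using h2
    refine ⟨nearbyMk s fun w w' _ _ _ _ hw => (hg w' (by assumption)).1 ?_,
      nearby_ext fun w h h' => hs w h h'⟩
    rw [← res_app, hs, hs, res_nearbyVal]

lemma bijective_standard_map {M N : X.Mod} (g : M ⟶ N)
    (hg : ∀ w, x ≤ w → Function.Bijective ((X.stalk w).map g)) (p : ℕ) (w : X.carrier)
    (hw : x ≤ w) : Function.Bijective ((X.stalk w).map ((standard X p).map g)) := by
  refine ⟨fun s t hst => standard_ext fun c => (hg _ (hw.trans c.le_last)).1 ?_, fun t => ?_⟩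
  · exact congrArg (StrictChain.component c) hst
  · have h2 (c : Chain X p w) :=
      (hg _ (hw.trans c.le_last)).2 (StrictChain.component c t)
    choose s hs using h2
    exact ⟨(s : (standardData p M).stalk w), standard_ext hs⟩

lemma bijective_augFunctor_map {M N : X.Mod} (g : M ⟶ N)
    (hg : ∀ w, x ≤ w → Function.Bijective ((X.stalk w).map g)) (n : ℕ) (w : X.carrier)
    (hw : x ≤ w) : Function.Bijective ((X.stalk w).map ((augFunctor X n).map g)) := by
  cases n with
  | zero => exact hg w hw
  | succ p => exact bijective_standard_map g hg p w hw

/-- The stalk of `C^p M` at a point of `U_x` only involves stalks of `M` on `U_x`, so `g` induces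
isomorphisms between the complexes obtained by applying `j_* j^*`. -/
lemma isGood_nearby_iff {M N : X.Mod} (g : M ⟶ N)
    (hg : ∀ w, x ≤ w → Function.Bijective ((X.stalk w).map g)) :
    IsGood (nearby x) M ↔ IsGood (nearby x) N := by
  rw [isGood_iff_of_preservesFiniteLimits, isGood_iff_of_preservesFiniteLimits]
  refine forall_congr' fun j => ShortComplex.exact_iff_of_iso
    (@asIso _ _ _ _ ((augSc (nearby x) (j + 1)).map g) ?_)
  have h (n : ℕ) : IsIso ((nearby x).map ((augFunctor X n).map g)) :=
    isIso_nearby_map _ (bijective_augFunctor_map g hg n)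
  have h1 : IsIso ((augSc (nearby x) (j + 1)).map g).τ₁ := h (j + 1)
  have h2 : IsIso ((augSc (nearby x) (j + 1)).map g).τ₂ := h (j + 2)
  have h3 : IsIso ((augSc (nearby x) (j + 1)).map g).τ₃ := h (j + 3)
  exact ShortComplex.isIso_of_isIso _

/-- The functor `j_* j^*` sends a skyscraper to a skyscraper or to zero. -/
lemma isGood_nearby_sky {A : Type*} [Category* A] [Abelian A] (F : X.Mod ⥤ A) [F.Additive]
    (x z : X.carrier) (L : ModuleCat.{u} (X.O.obj z)) :
    IsGood F ((nearby x).obj ((sky X z).obj L)) := by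
  -- If `x ≤ z`, a section over `U_x ∩ U_y` is determined by its value at `z`, so `j_* j^*` returns
  -- the skyscraper itself. Otherwise `U_x` misses its support.
  by_cases h : x ≤ z
  · let φ : (X.stalk z).obj ((nearby x).obj ((sky X z).obj L)) ⟶ L := ModuleCat.ofHom
      { toFun s := skyVal le_rfl (nearbyVal h le_rfl s)
        map_add' s t := (congrArg (skyVal le_rfl)
          (map_add (nearbyVal (M := (sky X z).obj L) h le_rfl) s t)).trans (map_add _ _ _)
        map_smul' a s := (congrArg (skyVal le_rfl)
          (nearbyVal_smul (M := (sky X z).obj L) h le_rfl a s)).trans (by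
            rw [skyVal_smul, O_map_map, O_map_self]
            rfl) }
    have hφ (y : X.carrier) (hy : y ≤ z)
        (s : (X.stalk y).obj ((nearby x).obj ((sky X z).obj L))) :
        skyVal hy ((X.stalk y).map (toSky φ) s) = skyVal le_rfl (nearbyVal h hy s) := rfl
    have hs (y w : X.carrier) (h1 : x ≤ w) (h2 : y ≤ w) (h3 : w ≤ z)
        (s : (X.stalk y).obj ((nearby x).obj ((sky X z).obj L))) :
        skyVal h3 (nearbyVal h1 h2 s) = skyVal le_rfl (nearbyVal h (h2.trans h3) s) := by
      rw [← res_nearbyVal h1 h2 h3, skyVal_res]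
    have : IsIso (toSky φ) := by
      rw [isIso_iff_stalk]
      intro y
      refine ⟨fun s t hst => nearby_ext fun w h1 h2 => sky_ext fun h3 => ?_, fun t => ?_⟩
      · rw [hs y w h1 h2 h3 s, hs y w h1 h2 h3 t, ← hφ y _ s, ← hφ y _ t, hst]
      · refine ⟨nearbyMk (fun w _ h2 => skyMk fun h3 => skyVal (h2.trans h3) t)
          (fun _ _ _ _ _ _ _ => rfl), sky_ext fun hy => ?_⟩
        rw [hφ]
        rfl
    exact (sky_isContractible F).isGood.of_iso (asIso (toSky φ)).symm
  · have h0 : IsZero ((nearby x).obj ((sky X z).obj L)) := by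
      rw [IsZero.iff_id_eq_zero]
      refine hom_ext_stalk fun y s => nearby_ext fun w h1 h2 => sky_ext fun h3 => ?_
      exact (h (h1.trans h3)).elim
    exact IsGood.of_id_eq_sum ∅ (fun e : PEmpty.{1} => e.elim) (fun e => e.elim)
      (fun e => e.elim)
      (h0.eq_of_src _ _) (by simp)

lemma isGood_nearby_standard {A : Type*} [Category* A] [Abelian A] (F : X.Mod ⥤ A) [F.Additive]
    (x : X.carrier) (M : X.Mod) (p : ℕ) : IsGood F ((nearby x).obj ((standard X p).obj M)) := by
  refine IsGood.of_id_eq_sum Finset.univ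
    (fun c : X.StrictChain p => (nearby x).obj (c.skyLast.obj M))
    (fun c => (nearby x).map (c.proj.app M)) (fun c => (nearby x).map (c.incl.app M)) ?_
    (fun c _ => isGood_nearby_sky F x _ _)
  rw [← CategoryTheory.Functor.map_id, ← StrictChain.sum_proj_comp_incl, Functor.map_sum]
  exact Finset.sum_congr rfl fun c _ => Functor.map_comp _ _ _

section
variable (X) [X.IsSemiSeparated]

/-- The vanishing half of semi-separatedness, expressed through the standard resolution. -/
lemma isGood_pushforward_structureModule : IsGood (pushforward X.diag) X.structureModule :=
  (pushforward_skyExact.isGood_iff _).2 fun j hj => IsSemiSeparated.isZero j hj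

lemma isQcoh_pushforward_structureModule :
    (X.prod X).IsQcoh ((pushforward X.diag).obj X.structureModule) :=
  (IsSchematic.isQcoh (X := X) 0).of_iso
    ((pushforward X.diag).rightDerivedZeroIsoSelf.app X.structureModule)

lemma isGood_nearby_structureModule (x : X.carrier) : IsGood (nearby x) X.structureModule where
  mono := by
    have := (mono_iff_stalk _).1 (isGood_pushforward_structureModule X).mono
    exact (mono_iff_stalk _).2 fun y => this (pt x y)
  exact n := slice_map_exact x _ ((isGood_pushforward_structureModule X).exact n)

end

end Diagonal

end FiniteRingedSpace
end

noncomputable section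

/-! ### Fragments of the long exact cohomology sequence of complexes `A → B → C`. -/

section Chase

variable {A : Type*} [Category* A] [Abelian A]
  {A₁ A₂ A₃ B₀ B₁ B₂ B₃ C₀ C₁ C₂ : A}
  {a₁ : A₁ ⟶ A₂} {a₂ : A₂ ⟶ A₃} {b₀ : B₀ ⟶ B₁} {b₁ : B₁ ⟶ B₂} {b₂ : B₂ ⟶ B₃}
  {c₀ : C₀ ⟶ C₁} {c₁ : C₁ ⟶ C₂} {i₁ : A₁ ⟶ B₁} {i₂ : A₂ ⟶ B₂} {i₃ : A₃ ⟶ B₃}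
  {p₀ : B₀ ⟶ C₀} {p₁ : B₁ ⟶ C₁} {p₂ : B₂ ⟶ C₂}

/-- The fragment `H^n(B) → H^n(C) → H^{n+1}(A)`. Short exactness is required only in the places
where it is used, because in the augmentation degree the columns `F(M₁) → F(M₂) → F(M₃)` need not be
short exact. -/
lemma CategoryTheory.ShortComplex.exact_of_quotient (wa : a₁ ≫ a₂ = 0) (ha : (mk a₁ a₂ wa).Exact)
    (wb : b₀ ≫ b₁ = 0) (hb : (mk b₀ b₁ wb).Exact) (wb' : b₁ ≫ b₂ = 0) (wc : c₀ ≫ c₁ = 0)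
    (hi₁ : i₁ ≫ b₁ = a₁ ≫ i₂) (hi₂ : i₂ ≫ b₂ = a₂ ≫ i₃) (hp₀ : b₀ ≫ p₁ = p₀ ≫ c₀)
    (hp₁ : b₁ ≫ p₂ = p₁ ≫ c₁) (w₁ : i₁ ≫ p₁ = 0) (w₂ : i₂ ≫ p₂ = 0) (h₂ : (mk i₂ p₂ w₂).Exact)
    [Epi p₁] [Mono i₃] : (mk c₀ c₁ wc).Exact := by
  rw [exact_iff_exact_up_to_refinements]
  intro Z x hx
  change Z ⟶ C₁ at x
  change x ≫ c₁ = 0 at hx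
  obtain ⟨Z₁, e₁, _, y, hy⟩ := surjective_up_to_refinements_of_epi p₁ x
  obtain ⟨Z₂, e₂, _, z, hz⟩ := h₂.exact_up_to_refinements (y ≫ b₁) (by
    change (y ≫ b₁) ≫ p₂ = 0
    rw [Category.assoc, hp₁, ← Category.assoc, ← hy, Category.assoc, hx, comp_zero])
  change Z₂ ⟶ A₂ at z
  change e₂ ≫ y ≫ b₁ = z ≫ i₂ at hz
  obtain ⟨Z₃, e₃, _, w, hw⟩ := ha.exact_up_to_refinements z (by
    change z ≫ a₂ = 0
    rw [← cancel_mono i₃, zero_comp, Category.assoc, ← hi₂, ← Category.assoc, ← hz]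
    simp [wb'])
  change Z₃ ⟶ A₁ at w
  change e₃ ≫ z = w ≫ a₁ at hw
  obtain ⟨Z₄, e₄, _, v, hv⟩ := hb.exact_up_to_refinements (e₃ ≫ e₂ ≫ y - w ≫ i₁) (by
    change (e₃ ≫ e₂ ≫ y - w ≫ i₁) ≫ b₁ = 0
    rw [Preadditive.sub_comp, Category.assoc, Category.assoc, Category.assoc, hz, hi₁,
      ← Category.assoc, hw, Category.assoc, sub_self])
  change Z₄ ⟶ B₀ at v
  change e₄ ≫ (e₃ ≫ e₂ ≫ y - w ≫ i₁) = v ≫ b₀ at hv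
  refine ⟨Z₄, e₄ ≫ e₃ ≫ e₂ ≫ e₁, inferInstance, v ≫ p₀, ?_⟩
  change _ = (v ≫ p₀) ≫ c₀
  rw [Category.assoc v, ← hp₀, ← Category.assoc v, ← hv]
  simp [w₁, hy]

/-- The fragment `H^{n-1}(C) → H^n(A) → H^n(B)`. -/
lemma CategoryTheory.ShortComplex.exact_of_sub (wa : a₁ ≫ a₂ = 0) (wb : b₀ ≫ b₁ = 0)
    (wb' : b₁ ≫ b₂ = 0) (hb : (mk b₁ b₂ wb').Exact) (wc : c₀ ≫ c₁ = 0) (hc : (mk c₀ c₁ wc).Exact)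
    (hi₁ : i₁ ≫ b₁ = a₁ ≫ i₂) (hi₂ : i₂ ≫ b₂ = a₂ ≫ i₃) (hp₀ : b₀ ≫ p₁ = p₀ ≫ c₀)
    (hp₁ : b₁ ≫ p₂ = p₁ ≫ c₁) (w₁ : i₁ ≫ p₁ = 0) (h₁ : (mk i₁ p₁ w₁).Exact) (w₂ : i₂ ≫ p₂ = 0)
    [Epi p₀] [Mono i₂] : (mk a₁ a₂ wa).Exact := by
  rw [exact_iff_exact_up_to_refinements]
  intro Z x hx
  change Z ⟶ A₂ at x
  change x ≫ a₂ = 0 at hx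
  obtain ⟨Z₁, e₁, _, y, hy⟩ := hb.exact_up_to_refinements (x ≫ i₂) (by
    change (x ≫ i₂) ≫ b₂ = 0
    rw [Category.assoc, hi₂, ← Category.assoc, hx, zero_comp])
  change Z₁ ⟶ B₁ at y
  change e₁ ≫ x ≫ i₂ = y ≫ b₁ at hy
  obtain ⟨Z₂, e₂, _, z, hz⟩ := hc.exact_up_to_refinements (y ≫ p₁) (by
    change (y ≫ p₁) ≫ c₁ = 0
    rw [Category.assoc, ← hp₁, ← Category.assoc, ← hy]
    simp [w₂])
  change Z₂ ⟶ C₀ at z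
  change e₂ ≫ y ≫ p₁ = z ≫ c₀ at hz
  obtain ⟨Z₃, e₃, _, t, ht⟩ := surjective_up_to_refinements_of_epi p₀ z
  obtain ⟨Z₄, e₄, _, v, hv⟩ := h₁.exact_up_to_refinements (e₃ ≫ e₂ ≫ y - t ≫ b₀) (by
    change (e₃ ≫ e₂ ≫ y - t ≫ b₀) ≫ p₁ = 0
    rw [Preadditive.sub_comp, Category.assoc, Category.assoc, Category.assoc, hz, hp₀,
      ← Category.assoc, ht, Category.assoc, sub_self])
  change Z₄ ⟶ A₁ at v
  change e₄ ≫ (e₃ ≫ e₂ ≫ y - t ≫ b₀) = v ≫ i₁ at hv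
  refine ⟨Z₄, e₄ ≫ e₃ ≫ e₂ ≫ e₁, inferInstance, v, ?_⟩
  change _ = v ≫ a₁
  rw [← cancel_mono i₂, Category.assoc v, ← hi₁, ← Category.assoc v, ← hv]
  simp [wb, hy]

/-- The fragment `H^0(B) → H^0(C) → H^1(A)`, where `c₀` includes `C₀` in the next term and the image
of `b₀` is the kernel of `b₁`. -/
lemma CategoryTheory.ShortComplex.epi_of_exact (wa : a₁ ≫ a₂ = 0) (ha : (mk a₁ a₂ wa).Exact)
    (wb : b₀ ≫ b₁ = 0) (hb : (mk b₀ b₁ wb).Exact) (wb' : b₁ ≫ b₂ = 0) (wc : c₀ ≫ c₁ = 0)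
    (hi₁ : i₁ ≫ b₁ = a₁ ≫ i₂) (hi₂ : i₂ ≫ b₂ = a₂ ≫ i₃) (hp₀ : b₀ ≫ p₁ = p₀ ≫ c₀)
    (hp₁ : b₁ ≫ p₂ = p₁ ≫ c₁) (w₁ : i₁ ≫ p₁ = 0) (w₂ : i₂ ≫ p₂ = 0) (h₂ : (mk i₂ p₂ w₂).Exact)
    [Epi p₁] [Mono i₃] [Mono c₀] : Epi p₀ := by
  rw [epi_iff_surjective_up_to_refinements]
  intro Z x
  obtain ⟨Z₁, e₁, _, y, hy⟩ := surjective_up_to_refinements_of_epi p₁ (x ≫ c₀)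
  obtain ⟨Z₂, e₂, _, z, hz⟩ := h₂.exact_up_to_refinements (y ≫ b₁) (by
    change (y ≫ b₁) ≫ p₂ = 0
    rw [Category.assoc, hp₁, ← Category.assoc, ← hy]
    simp [wc])
  change Z₂ ⟶ A₂ at z
  change e₂ ≫ y ≫ b₁ = z ≫ i₂ at hz
  obtain ⟨Z₃, e₃, _, w, hw⟩ := ha.exact_up_to_refinements z (by
    change z ≫ a₂ = 0
    rw [← cancel_mono i₃, zero_comp, Category.assoc, ← hi₂, ← Category.assoc, ← hz]
    simp [wb'])
  change Z₃ ⟶ A₁ at w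
  change e₃ ≫ z = w ≫ a₁ at hw
  obtain ⟨Z₄, e₄, _, v, hv⟩ := hb.exact_up_to_refinements (e₃ ≫ e₂ ≫ y - w ≫ i₁) (by
    change (e₃ ≫ e₂ ≫ y - w ≫ i₁) ≫ b₁ = 0
    rw [Preadditive.sub_comp, Category.assoc, Category.assoc, Category.assoc, hz, hi₁,
      ← Category.assoc, hw, Category.assoc, sub_self])
  change Z₄ ⟶ B₀ at v
  change e₄ ≫ (e₃ ≫ e₂ ≫ y - w ≫ i₁) = v ≫ b₀ at hv
  refine ⟨Z₄, e₄ ≫ e₃ ≫ e₂ ≫ e₁, inferInstance, v, ?_⟩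
  rw [← cancel_mono c₀, Category.assoc v, ← hp₀, ← Category.assoc v, ← hv]
  simp [w₁, hy]

end Chase

/-! ### Finitary functors: passage from `R` to free modules and then to all modules. -/

section Finitary

variable {R S : Type u} [CommRing R] [CommRing S]

lemma ModuleCat.sum_hom_apply {M N : ModuleCat.{u} R} {I : Type*} (s : Finset I) (f : I → (M ⟶ N))
    (m : M) : (∑ i ∈ s, f i) m = ∑ i ∈ s, f i m :=
  map_sum (⟨⟨fun f => f m, rfl⟩, fun _ _ => rfl⟩ : (M ⟶ N) →+ N) f s

/-- The projection of a free module to the part that is spanned by finitely many basis vectors. -/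
def truncation (R : Type u) [CommRing R] {I : Type u} (J : Finset I) :
    ModuleCat.of R (I →₀ R) ⟶ ModuleCat.of R (I →₀ R) :=
  ∑ i ∈ J, (ModuleCat.ofHom (Finsupp.lapply i) : _ ⟶ ModuleCat.of R R) ≫
    ModuleCat.ofHom (Finsupp.lsingle i)

lemma truncation_apply {I : Type u} (J : Finset I) (s : I →₀ R) (hs : s.support ⊆ J) :
    truncation R J s = s := by
  have h : truncation R J s = ∑ i ∈ J, Finsupp.single i (s i) := by
    unfold truncation
    rw [ModuleCat.sum_hom_apply]
    rfl
  rw [h]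
  conv_rhs => rw [← Finsupp.sum_single s]
  exact (Finset.sum_subset hs fun i _ hi => by
    rw [Finsupp.notMem_support_iff.1 hi, Finsupp.single_zero]).symm

/-- Every element of the value of the functor at a free module comes from a finitely generated
free submodule. -/
def Finitary (P : ModuleCat.{u} R ⥤ ModuleCat.{u} S) : Prop :=
  -- Allowing every larger `J'` makes it possible to merge finitely many such sets by taking their
  -- union.
  ∀ (I : Type u) (s : P.obj (ModuleCat.of R (I →₀ R))), ∃ J : Finset I, ∀ J', J ⊆ J' →
    P.map (truncation R J') s = s

/-- The exactness of a complex of finitary functors can be checked at `R` for free modules. -/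
lemma Finitary.exact_free {E₀ E₁ E₂ : ModuleCat.{u} R ⥤ ModuleCat.{u} S} [E₁.Additive]
    (h : Finitary E₁) (d₀ : E₀ ⟶ E₁) (d₁ : E₁ ⟶ E₂)
    (hR : ∀ s : E₁.obj (ModuleCat.of R R), d₁.app _ s = 0 → ∃ t, d₀.app _ t = s) (I : Type u)
    (s : E₁.obj (ModuleCat.of R (I →₀ R))) (hs : d₁.app _ s = 0) : ∃ t, d₀.app _ t = s := by
  classical
  obtain ⟨J, hJ⟩ := h I s
  let a (i : I) : ModuleCat.of R (I →₀ R) ⟶ ModuleCat.of R R := ModuleCat.ofHom (Finsupp.lapply i)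
  let b (i : I) : ModuleCat.of R R ⟶ ModuleCat.of R (I →₀ R) := ModuleCat.ofHom (Finsupp.lsingle i)
  have h1 (i : I) : ∃ t, d₀.app _ t = E₁.map (a i) s := by
    refine hR _ ?_
    rw [NatTrans.naturality_apply, hs, map_zero]
  choose t ht using h1
  -- Each coordinate of `s` in `J` is a cocycle over `R`, hence has a preimage `t i`; the
  -- coordinates outside `J` do not contribute to `s`.
  refine ⟨∑ i ∈ J, E₀.map (b i) (t i), ?_⟩
  rw [map_sum]
  have h2 := hJ J subset_rfl
  unfold truncation at h2
  rw [E₁.map_sum, ModuleCat.sum_hom_apply] at h2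
  refine Eq.trans (Finset.sum_congr rfl fun i _ => ?_) h2
  rw [NatTrans.naturality_apply, ht, E₁.map_comp]
  rfl

/-- A transformation between exact finitary functors is an isomorphism if it is one at `R`. -/
lemma Finitary.isIso {P Q : ModuleCat.{u} R ⥤ ModuleCat.{u} S} [P.Additive] [Q.Additive]
    (hP : Finitary P) (hQ : Finitary Q) (eP : ∀ S : ShortComplex _, S.Exact → (S.map P).Exact)
    (eQ : ∀ S : ShortComplex _, S.Exact → (S.map Q).Exact) (τ : P ⟶ Q)
    (hτ : IsIso (τ.app (ModuleCat.of R R))) (N : ModuleCat.{u} R) : IsIso (τ.app N) := by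
  have hb := (ConcreteCategory.isIso_iff_bijective (τ.app (ModuleCat.of R R))).1 hτ
  have hfree (I : Type u) : IsIso (τ.app (ModuleCat.of R (I →₀ R))) := by
    rw [ConcreteCategory.isIso_iff_bijective]
    refine ⟨(injective_iff_map_eq_zero _).2 fun s hs => ?_, fun t => ?_⟩
    -- With `0` as first morphism, exactness expresses injectivity of `τ`; below, with `0` as
    -- second, it expresses surjectivity.
    · obtain ⟨t, ht⟩ := hP.exact_free (E₀ := P) 0 τ (fun s hs => ⟨0, by
        rw [map_zero]; exact (hb.1 (hs.trans (map_zero _).symm)).symm⟩) I s hs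
      exact ht.symm
    · exact hQ.exact_free (E₂ := Q) τ 0 (fun s _ => hb.2 s) I t rfl
  have := (((Functor.exact_tfae P).out 1 3 :).1 eP).2
  have := (((Functor.exact_tfae Q).out 1 3 :).1 eQ).2
  let p (N : ModuleCat.{u} R) : ModuleCat.of R (N →₀ R) ⟶ N :=
    ModuleCat.ofHom (Finsupp.linearCombination R (id : N → N))
  have hp (N : ModuleCat.{u} R) : Epi (p N) := by
    rw [ModuleCat.epi_iff_surjective]
    exact Finsupp.linearCombination_id_surjective R N
  -- A free presentation of `N`. The modules themselves serve as index sets, so the free modules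
  -- stay in the same universe.
  let S := ShortComplex.mk (p (kernel (p N)) ≫ kernel.ι (p N)) (p N) (by simp)
  have hS : S.Exact := by
    let S' := ShortComplex.mk (kernel.ι (p N)) (p N) (by simp)
    let φ : S ⟶ S' := { τ₁ := p (kernel (p N)), τ₂ := 𝟙 _, τ₃ := 𝟙 _ }
    have : Epi φ.τ₁ := hp _
    exact (ShortComplex.exact_iff_of_epi_of_isIso_of_mono φ).2 (ShortComplex.exact_kernel _)
  have : Epi S.g := hp N
  refine FiniteRingedSpace.isIso_app_of_isColimit τ hS.gIsCokernel ?_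
  rintro (_ | _)
  exacts [hfree _, hfree _]

end Finitary

namespace FiniteRingedSpace

variable {X Y : FiniteRingedSpace.{u}} {A : Type*} [Category* A] [Abelian A]
  {F : X.Mod ⥤ A} [F.Additive]

lemma SkyExact.shortExact (hF : SkyExact F) {S : ShortComplex X.Mod} (hS : S.ShortExact) (p : ℕ) :
    (S.map (standard X p ⋙ F)).ShortExact :=
  Functor.map_shortExact_of_map_exact (standard_comp_map_exact F hF p) S hS

omit [Abelian A] [F.Additive] in
lemma map_augD_naturality {M N : X.Mod} (g : M ⟶ N) (n : ℕ) :
    F.map ((augFunctor X n).map g) ≫ F.map ((augD X n).app N) =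
      F.map ((augD X n).app M) ≫ F.map ((augFunctor X (n + 1)).map g) := by
  rw [← F.map_comp, ← F.map_comp, (augD X n).naturality]

lemma map_augD_comp (M : X.Mod) (n : ℕ) :
    F.map ((augD X n).app M) ≫ F.map ((augD X (n + 1)).app M) = 0 := by
  rw [← F.map_comp, augD_app_comp_augD_app, F.map_zero]

lemma map_augFunctor_comp (S : ShortComplex X.Mod) (n : ℕ) :
    F.map ((augFunctor X n).map S.f) ≫ F.map ((augFunctor X n).map S.g) = 0 := by
  rw [← F.map_comp, ← Functor.map_comp, S.zero, Functor.map_zero, F.map_zero]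

variable {M₁ M₂ M₃ : X.Mod} {f : M₁ ⟶ M₂} {g : M₂ ⟶ M₃} {w : f ≫ g = 0}

lemma SkyExact.augSc_exact_of_quotient (hF : SkyExact F) (hS : (ShortComplex.mk f g w).ShortExact) (n : ℕ) (h₂ : ((augSc F n).obj M₂).Exact)
    (h₁ : ((augSc F (n + 1)).obj M₁).Exact) : ((augSc F n).obj M₃).Exact := by
  have e : Epi (F.map ((augFunctor X (n + 1)).map g)) := (hF.shortExact hS n).epi_g
  have m : Mono (F.map ((augFunctor X (n + 3)).map f)) := (hF.shortExact hS (n + 2)).mono_f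
  exact ShortComplex.exact_of_quotient (map_augD_comp _ _) h₁ (map_augD_comp _ _) h₂
    (map_augD_comp _ _) (map_augD_comp _ _) (map_augD_naturality f (n + 1))
    (map_augD_naturality f (n + 2)) (map_augD_naturality g n).symm
    (map_augD_naturality g (n + 1)).symm (map_augFunctor_comp (.mk f g w) _) (map_augFunctor_comp (.mk f g w) _)
    (hF.shortExact hS (n + 1)).exact

lemma SkyExact.augSc_exact_of_sub (hF : SkyExact F) (hS : (ShortComplex.mk f g w).ShortExact) (n : ℕ) (h₂ : ((augSc F (n + 1)).obj M₂).Exact)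
    (h₃ : ((augSc F n).obj M₃).Exact) (e : Epi (F.map ((augFunctor X n).map g))) :
    ((augSc F (n + 1)).obj M₁).Exact := by
  have m : Mono (F.map ((augFunctor X (n + 2)).map f)) := (hF.shortExact hS (n + 1)).mono_f
  exact ShortComplex.exact_of_sub (map_augD_comp _ _) (map_augD_comp _ _) (map_augD_comp _ _) h₂
    (map_augD_comp _ _) h₃ (map_augD_naturality f (n + 1))
    (map_augD_naturality f (n + 2)) (map_augD_naturality g n).symm
    (map_augD_naturality g (n + 1)).symm (map_augFunctor_comp (.mk f g w) _)
    (hF.shortExact hS n).exact (map_augFunctor_comp (.mk f g w) _)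

/-- Goodness of `M₁` includes the vanishing of the first cohomology of `F(C^• M₁)`, which is the
obstruction to lifting from `F(M₃)` to `F(M₂)`. -/
lemma SkyExact.epi_map [PreservesFiniteLimits F] (hF : SkyExact F) (hS : (ShortComplex.mk f g w).ShortExact) (h : IsGood F M₁) : Epi (F.map g) := by
  have e : Epi (F.map ((augFunctor X 1).map g)) := (hF.shortExact hS 0).epi_g
  have m : Mono (F.map ((augFunctor X 3).map f)) := (hF.shortExact hS 2).mono_f
  have m' (M : X.Mod) : Mono (F.map ((augD X 0).app M)) := by
    have := (isGood_id M).mono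
    have : Mono ((augD X 0).app M) := this
    infer_instance
  have h2 : ((augSc F 0).obj M₂).Exact := by
    have := (isGood_id M₂).mono
    exact ((isGood_id M₂).exact 0).map_of_mono_of_preservesKernel F this inferInstance
  have := m' M₃
  change Epi (F.map ((augFunctor X 0).map g))
  exact ShortComplex.epi_of_exact (map_augD_comp _ _) (h.exact 1) (map_augD_comp _ _) h2
    (map_augD_comp _ _) (map_augD_comp _ _) (map_augD_naturality f 1)
    (map_augD_naturality f 2) (map_augD_naturality g 0).symm
    (map_augD_naturality g 1).symm (map_augFunctor_comp (.mk f g w) _) (map_augFunctor_comp (.mk f g w) _)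
    (hF.shortExact hS 1).exact

end FiniteRingedSpace
end

noncomputable section

/-! ### Extension of scalars, handled through its adjunction. -/

section BaseChange

variable {R S : Type u} [CommRing R] [CommRing S] (f : R →+* S)

/-- The map `n ↦ 1 ⊗ n`. -/
def bcUnit (N : ModuleCat.{u} R) : N →+ (ModuleCat.extendScalars.{u, u, u} f).obj N where
  toFun n := (ModuleCat.extendRestrictScalarsAdj.{u, u, u} f).unit.app N n
  map_zero' := map_zero ((ModuleCat.extendRestrictScalarsAdj.{u, u, u} f).unit.app N).hom
  map_add' := map_add ((ModuleCat.extendRestrictScalarsAdj.{u, u, u} f).unit.app N).hom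

lemma bcUnit_smul (N : ModuleCat.{u} R) (r : R) (n : N) :
    bcUnit f N (r • n) = f r • bcUnit f N n :=
  map_smul ((ModuleCat.extendRestrictScalarsAdj.{u, u, u} f).unit.app N).hom r n

variable {f}

/-- The linear map `S ⊗ N → Q` attached to a semilinear map `N → Q`. -/
def bcLift {N : ModuleCat.{u} R} {Q : ModuleCat.{u} S}
    (φ : N ⟶ (ModuleCat.restrictScalars f).obj Q) : (ModuleCat.extendScalars.{u, u, u} f).obj N ⟶ Q :=
  ((ModuleCat.extendRestrictScalarsAdj.{u, u, u} f).homEquiv N Q).symm φ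

lemma bcLift_bcUnit {N : ModuleCat.{u} R} {Q : ModuleCat.{u} S}
    (φ : N ⟶ (ModuleCat.restrictScalars f).obj Q) (n : N) : bcLift φ (bcUnit f N n) = φ n := by
  have h := ((ModuleCat.extendRestrictScalarsAdj.{u, u, u} f).homEquiv N Q).apply_symm_apply φ
  rw [Adjunction.homEquiv_unit] at h
  exact congr($h n)

lemma map_bcUnit {N N' : ModuleCat.{u} R} (g : N ⟶ N') (n : N) :
    (ModuleCat.extendScalars.{u, u, u} f).map g (bcUnit f N n) = bcUnit f N' (g n) :=
  congr($((ModuleCat.extendRestrictScalarsAdj.{u, u, u} f).unit.naturality g) n).symm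

-- The elements `1 ⊗ n` generate: the projection to the quotient by their span corresponds to zero
-- under the adjunction, so it is zero.
@[elab_as_elim]
lemma bc_induction {N : ModuleCat.{u} R}
    {p : (ModuleCat.extendScalars.{u, u, u} f).obj N → Prop}
    (t : (ModuleCat.extendScalars.{u, u, u} f).obj N) (unit : ∀ n, p (bcUnit f N n))
    (add : ∀ s t, p s → p t → p (s + t)) (smul : ∀ (a : S) t, p t → p (a • t)) : p t := by
  let V := Submodule.span S (Set.range (bcUnit f N))
  have h : ModuleCat.ofHom V.mkQ = 0 := by
    refine ((ModuleCat.extendRestrictScalarsAdj.{u, u, u} f).homEquiv _ _).injective ?_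
    rw [Adjunction.homEquiv_unit, Adjunction.homEquiv_unit]
    ext n
    exact (V.mkQ_apply _).trans ((Submodule.Quotient.mk_eq_zero V).2
      (Submodule.subset_span ⟨n, rfl⟩))
  have ht : t ∈ V := (Submodule.Quotient.mk_eq_zero V).1 congr($h t)
  refine Submodule.span_induction ?_ ?_ (fun s t _ _ => add s t) (fun a t _ => smul a t) ht
  · rintro _ ⟨n, rfl⟩
    exact unit n
  · have := unit 0
    rwa [map_zero] at this

instance (f : R →+* S) : (ModuleCat.extendScalars.{u, u, u} f).Additive :=
  (ModuleCat.extendRestrictScalarsAdj.{u, u, u} f).left_adjoint_additive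

lemma Finitary.comp_extendScalars {R' : Type u} [CommRing R'] {P : ModuleCat.{u} R' ⥤ ModuleCat.{u} R}
    (hP : Finitary P) : Finitary (P ⋙ ModuleCat.extendScalars.{u, u, u} f) := by
  classical
  intro I s
  refine bc_induction s (fun n => ?_) ?_ ?_
  · obtain ⟨J, hJ⟩ := hP I n
    refine ⟨J, fun J' h => ?_⟩
    refine (map_bcUnit _ n).trans ?_
    rw [hJ J' h]
  · rintro s t ⟨J, hJ⟩ ⟨K, hK⟩
    refine ⟨J ∪ K, fun J' h => ?_⟩
    rw [map_add, hJ J' (Finset.union_subset_left h), hK J' (Finset.union_subset_right h)]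
  · rintro a t ⟨J, hJ⟩
    exact ⟨J, fun J' h => by rw [map_smul, hJ J' h]⟩

lemma finitary_id : Finitary (𝟭 (ModuleCat.{u} R)) := fun _ s =>
  ⟨s.support, fun J' h => truncation_apply J' s h⟩

end BaseChange

namespace FiniteRingedSpace

variable {X Y : FiniteRingedSpace.{u}}

lemma tensorRes_bcUnit (M : X.Mod) {x y : X.carrier} (h : x ≤ y) (m : (X.stalk x).obj M) :
    (X.tensorRes (homOfLE h)).app M (bcUnit (X.O.map (homOfLE h)).hom _ m) = res M h m := by
  refine (congrArg ((ModuleCat.extendRestrictScalarsAdj.{u, u, u}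
    (X.O.map (homOfLE h)).hom).counit.app ((X.stalk y).obj M)) (map_bcUnit _ m)).trans ?_
  exact congr($((ModuleCat.extendRestrictScalarsAdj.{u, u, u}
    (X.O.map (homOfLE h)).hom).right_triangle_components ((X.stalk y).obj M)) (res M h m))

/-! ### The module `z ↦ O_z ⊗ N` on `U_x`, extended by zero. -/

section Spread

variable {x : X.carrier}

/-- The `O_z`-module `O_z ⊗_{O_x} N`. -/
abbrev ext (N : ModuleCat.{u} (X.O.obj x)) {z : X.carrier} (h : x ≤ z) :
    ModuleCat.{u} (X.O.obj z) :=
  (ModuleCat.extendScalars.{u, u, u} (X.O.map (homOfLE h)).hom).obj N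

/-- The map `n ↦ 1 ⊗ n`. -/
abbrev extUnit (N : ModuleCat.{u} (X.O.obj x)) {z : X.carrier} (h : x ≤ z) : N →+ ext N h :=
  bcUnit (X.O.map (homOfLE h)).hom N

/-- The linear map `O_z ⊗ N → M_z` attached to a linear map `N → M_x`. -/
def extLift {N : ModuleCat.{u} (X.O.obj x)} {M : X.Mod} (φ : N ⟶ (X.stalk x).obj M)
    {z : X.carrier} (h : x ≤ z) : ext N h ⟶ (X.stalk z).obj M :=
  (ModuleCat.extendScalars.{u, u, u} (X.O.map (homOfLE h)).hom).map φ ≫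
    (X.tensorRes (homOfLE h)).app M

lemma extLift_extUnit {N : ModuleCat.{u} (X.O.obj x)} {M : X.Mod} (φ : N ⟶ (X.stalk x).obj M)
    {z : X.carrier} (h : x ≤ z) (n : N) : extLift φ h (extUnit N h n) = res M h (φ n) := by
  refine (congrArg ((X.tensorRes (homOfLE h)).app M) (map_bcUnit φ n)).trans ?_
  exact tensorRes_bcUnit M h (φ n)

variable (N : ModuleCat.{u} (X.O.obj x))

/-- The restriction `O_z ⊗ N → O_z' ⊗ N`, as a linear map. -/
def extResHom {z z' : X.carrier} (h : x ≤ z) (h' : z ≤ z') :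
    ext N h ⟶ (ModuleCat.restrictScalars (X.O.map (homOfLE h')).hom).obj (ext N (h.trans h')) :=
  bcLift (ModuleCat.ofHom (Y := (ModuleCat.restrictScalars (X.O.map (homOfLE h)).hom).obj
      ((ModuleCat.restrictScalars (X.O.map (homOfLE h')).hom).obj (ext N (h.trans h'))))
    { toFun n := extUnit N (h.trans h') n
      map_add' := map_add _
      map_smul' a n := by
        refine (bcUnit_smul _ N a n).trans ?_
        rw [← O_map_map h h']
        rfl })

/-- The restriction `O_z ⊗ N → O_z' ⊗ N`. -/
def extRes {z z' : X.carrier} (h : x ≤ z) (h' : z ≤ z') : ext N h →+ ext N (h.trans h') where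
  toFun t := extResHom N h h' t
  map_zero' := map_zero (extResHom N h h').hom
  map_add' := map_add (extResHom N h h').hom

lemma extRes_extUnit {z z' : X.carrier} (h : x ≤ z) (h' : z ≤ z') (n : N) :
    extRes N h h' (extUnit N h n) = extUnit N (h.trans h') n :=
  bcLift_bcUnit _ n

lemma extRes_smul {z z' : X.carrier} (h : x ≤ z) (h' : z ≤ z') (a : X.O.obj z) (t : ext N h) :
    extRes N h h' (a • t) = (X.O.map (homOfLE h')).hom a • extRes N h h' t :=
  map_smul (extResHom N h h').hom a t

lemma extRes_self {z : X.carrier} (h : x ≤ z) (t : ext N h) : extRes N h le_rfl t = t := by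
  refine bc_induction t (fun n => extRes_extUnit N h le_rfl n) (fun s t hs ht => ?_)
    (fun a t ht => ?_)
  · rw [map_add, hs, ht]
  · rw [extRes_smul, ht, O_map_self]

lemma extRes_extRes {z z' z'' : X.carrier} (h : x ≤ z) (h' : z ≤ z') (h'' : z' ≤ z'')
    (t : ext N h) :
    extRes N (h.trans h') h'' (extRes N h h' t) = extRes N h (h'.trans h'') t := by
  refine bc_induction t (fun n => ?_) (fun s t hs ht => ?_) (fun a t ht => ?_)
  · rw [extRes_extUnit, extRes_extUnit, extRes_extUnit]
  · rw [map_add, map_add, map_add, hs, ht]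
  · rw [extRes_smul, extRes_smul, extRes_smul, ht, O_map_map]

variable {N}

lemma extRes_map {N' : ModuleCat.{u} (X.O.obj x)} (g : N ⟶ N') {z z' : X.carrier} (h : x ≤ z)
    (h' : z ≤ z') (t : ext N h) :
    extRes N' h h' ((ModuleCat.extendScalars.{u, u, u} (X.O.map (homOfLE h)).hom).map g t) =
      (ModuleCat.extendScalars.{u, u, u} (X.O.map (homOfLE (h.trans h'))).hom).map g
        (extRes N h h' t) := by
  refine bc_induction t (fun n => ?_) (fun s t hs ht => ?_) (fun a t ht => ?_)
  · rw [map_bcUnit, extRes_extUnit]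
    exact (map_bcUnit g n).symm.trans (congrArg
      ((ModuleCat.extendScalars.{u, u, u} (X.O.map (homOfLE (h.trans h'))).hom).map g)
      (extRes_extUnit N h h' n).symm)
  · rw [map_add, map_add, map_add, map_add, hs, ht]
  · rw [map_smul, extRes_smul, extRes_smul, map_smul, ht]

lemma res_extLift {M : X.Mod} (φ : N ⟶ (X.stalk x).obj M) {z z' : X.carrier} (h : x ≤ z)
    (h' : z ≤ z') (t : ext N h) :
    res M h' (extLift φ h t) = extLift φ (h.trans h') (extRes N h h' t) := by
  refine bc_induction t (fun n => ?_) (fun s t hs ht => ?_) (fun a t ht => ?_)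
  · rw [extRes_extUnit]
    refine (congrArg (res M h') (extLift_extUnit φ h n)).trans ?_
    exact (res_res M h h' _).trans (extLift_extUnit φ _ n).symm
  · rw [map_add, map_add, map_add, map_add, hs, ht]
  · rw [map_smul, res_smul, extRes_smul, map_smul, ht]

open Classical in
/-- The restriction maps of the extension by zero of `z ↦ O_z ⊗ N`. -/
def spreadRes {z z' : X.carrier} (h' : z ≤ z') (s : ∀ h : PLift (x ≤ z), ext N h.down)
    (h : PLift (x ≤ z')) : ext N h.down :=
  if k : x ≤ z then extRes N k h' (s ⟨k⟩) else 0

lemma spreadRes_of_le {z z' : X.carrier} (h' : z ≤ z') (s : ∀ h : PLift (x ≤ z), ext N h.down)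
    (h : PLift (x ≤ z')) (k : x ≤ z) : spreadRes h' s h = extRes N k h' (s ⟨k⟩) := dif_pos k

lemma spreadRes_of_not_le {z z' : X.carrier} (h' : z ≤ z')
    (s : ∀ h : PLift (x ≤ z), ext N h.down) (h : PLift (x ≤ z')) (k : ¬ x ≤ z) :
    spreadRes h' s h = 0 := dif_neg k

lemma spreadRes_add {z z' : X.carrier} (h' : z ≤ z') (s t : ∀ h : PLift (x ≤ z), ext N h.down) :
    spreadRes h' (s + t) = spreadRes h' s + spreadRes h' t := by
  funext h
  unfold spreadRes
  rw [Pi.add_apply]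
  split_ifs with k
  · exact map_add _ _ _
  · exact (add_zero _).symm

variable (N) in
/-- The data of the extension by zero of `z ↦ O_z ⊗ N`. -/
def spreadData : X.ModData where
  stalk z := ∀ h : PLift (x ≤ z), ext N h.down
  res h' := AddMonoidHom.mk' (spreadRes h') (spreadRes_add h')
  res_smul {z z'} h' a s := by
    funext h
    change spreadRes h' (a • s) h = (X.O.map (homOfLE h')).hom a • spreadRes h' s h
    unfold spreadRes
    split_ifs with k
    · exact extRes_smul N k h' a _
    · exact (smul_zero _).symm
  res_self {z} s := by
    funext h
    exact (spreadRes_of_le le_rfl s h h.down).trans (extRes_self N h.down _)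
  res_res {z z' z''} h h' s := by
    funext k
    change spreadRes h' (spreadRes h s) k = spreadRes _ s k
    by_cases hx : x ≤ z
    · rw [spreadRes_of_le h' _ _ (hx.trans h), spreadRes_of_le _ _ _ hx, spreadRes_of_le _ _ _ hx,
        extRes_extRes]
    · rw [spreadRes_of_not_le _ s _ hx]
      unfold spreadRes
      split_ifs with k'
      · exact map_zero _
      · rfl

variable (x) in
/-- The functor that sends `N` to the extension by zero of `z ↦ O_z ⊗ N`; it is left adjoint to
the stalk functor. -/
def spread : ModuleCat.{u} (X.O.obj x) ⥤ X.Mod where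
  obj N := (spreadData N).toMod
  map {N N'} g := homMk
    (fun z =>
      { toFun (s : (spreadData N).stalk z) :=
          (fun h => (ModuleCat.extendScalars.{u, u, u} (X.O.map (homOfLE h.down)).hom).map g (s h) :
            (spreadData N').stalk z)
        map_add' s t := funext fun h => map_add
          ((ModuleCat.extendScalars.{u, u, u} (X.O.map (homOfLE h.down)).hom).map g).hom (s h) (t h)
        map_smul' a s := funext fun h => map_smul
          ((ModuleCat.extendScalars.{u, u, u} (X.O.map (homOfLE h.down)).hom).map g).hom a (s h) })
    (fun {z z'} h' s => by
      funext h
      change spreadRes h' _ h = (ModuleCat.extendScalars.{u, u, u} _).map g (spreadRes h' s h)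
      unfold spreadRes
      split_ifs with k
      · exact extRes_map g k h' _
      · exact (map_zero ((ModuleCat.extendScalars.{u, u, u} _).map g).hom).symm)
  map_id N := hom_ext_stalk fun z s => funext fun h =>
    congr($((ModuleCat.extendScalars.{u, u, u} (X.O.map (homOfLE h.down)).hom).map_id N)
      ((s : (spreadData N).stalk z) h))
  map_comp {N _ _} g g' := hom_ext_stalk fun z s => funext fun h =>
    congr($((ModuleCat.extendScalars.{u, u, u} (X.O.map (homOfLE h.down)).hom).map_comp g g')
      ((s : (spreadData N).stalk z) h))

/-- The values of a section of `spread`. -/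
def spreadVal {z : X.carrier} (h : x ≤ z) : (X.stalk z).obj ((spread x).obj N) →+ ext N h where
  toFun s := (s : (spreadData N).stalk z) ⟨h⟩
  map_zero' := rfl
  map_add' _ _ := rfl

lemma spread_ext {z : X.carrier} {s t : (X.stalk z).obj ((spread x).obj N)}
    (h : ∀ h : x ≤ z, spreadVal h s = spreadVal h t) : s = t :=
  funext fun h' => h h'.down

lemma spreadVal_smul {z : X.carrier} (h : x ≤ z) (a : X.O.obj z)
    (s : (X.stalk z).obj ((spread x).obj N)) : spreadVal h (a • s) = a • spreadVal h s := rfl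

lemma spreadVal_res {z z' : X.carrier} (h : x ≤ z) (h' : z ≤ z')
    (s : (X.stalk z).obj ((spread x).obj N)) :
    spreadVal (h.trans h') (res _ h' s) = extRes N h h' (spreadVal h s) :=
  spreadRes_of_le h' s ⟨h.trans h'⟩ h

lemma spreadVal_map {N' : ModuleCat.{u} (X.O.obj x)} (g : N ⟶ N') {z : X.carrier} (h : x ≤ z)
    (s : (X.stalk z).obj ((spread x).obj N)) :
    spreadVal h ((X.stalk z).map ((spread x).map g) s) =
      (ModuleCat.extendScalars.{u, u, u} (X.O.map (homOfLE h)).hom).map g (spreadVal h s) := rfl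

/-- The section of `spread` with given values. -/
def spreadMk {z : X.carrier} (t : ∀ h : x ≤ z, ext N h) : (X.stalk z).obj ((spread x).obj N) :=
  (fun h => t h.down : (spreadData N).stalk z)

instance : (spread x).Additive where
  map_add {N N' g g'} := hom_ext_stalk fun z s => spread_ext fun h => by
    have h1 : (X.stalk z).map ((spread x).map g + (spread x).map g') s =
      (X.stalk z).map ((spread x).map g) s + (X.stalk z).map ((spread x).map g') s := rfl
    rw [h1, map_add, spreadVal_map, spreadVal_map, spreadVal_map, Functor.map_add]
    rfl

open Classical in
/-- The components of the morphism `fromSpread`. -/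
def fromSpreadAt {M : X.Mod} (φ : N ⟶ (X.stalk x).obj M) {z : X.carrier}
    (s : (X.stalk z).obj ((spread x).obj N)) : (X.stalk z).obj M :=
  if h : x ≤ z then extLift φ h (spreadVal h s) else 0

/-- The morphism that is attached to a linear map with values in the stalk at `x`. -/
def fromSpread {M : X.Mod} (φ : N ⟶ (X.stalk x).obj M) : (spread x).obj N ⟶ M :=
  homMk (fun z =>
    { toFun s := fromSpreadAt φ s
      map_add' s t := by
        change fromSpreadAt φ (show (X.stalk z).obj ((spread x).obj N) from
          (show (X.stalk z).obj ((spread x).obj N) from s) +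
            (show (X.stalk z).obj ((spread x).obj N) from t)) = fromSpreadAt φ s + fromSpreadAt φ t
        unfold fromSpreadAt
        split_ifs with h
        · exact (congrArg (extLift φ h) (map_add (spreadVal (N := N) h) s t)).trans
            (map_add (extLift φ h).hom _ _)
        · exact (add_zero _).symm
      map_smul' a s := by
        change fromSpreadAt φ (show (X.stalk z).obj ((spread x).obj N) from
          a • (show (X.stalk z).obj ((spread x).obj N) from s)) = a • fromSpreadAt φ s
        unfold fromSpreadAt
        split_ifs with h
        · exact map_smul (extLift φ h).hom a _
        · exact (smul_zero _).symm })
    (fun {z z'} h' s => by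
      change res M h' (fromSpreadAt φ s) = fromSpreadAt φ (res ((spread x).obj N) h' s)
      unfold fromSpreadAt
      by_cases h : x ≤ z
      · rw [dif_pos h, dif_pos (h.trans h')]
        exact (res_extLift φ h h' _).trans (congrArg _ (spreadVal_res h h' s).symm)
      · rw [dif_neg h, map_zero]
        split_ifs with h1
        · exact ((congrArg (extLift φ h1) (spreadRes_of_not_le h' _ ⟨h1⟩ h)).trans
            (map_zero (extLift φ h1).hom)).symm
        · rfl)

lemma fromSpread_apply {M : X.Mod} (φ : N ⟶ (X.stalk x).obj M) {z : X.carrier} (h : x ≤ z)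
    (s : (X.stalk z).obj ((spread x).obj N)) :
    (X.stalk z).map (fromSpread φ) s = extLift φ h (spreadVal h s) := dif_pos h

end Spread

end FiniteRingedSpace
end

noncomputable section
namespace FiniteRingedSpace

variable {X : FiniteRingedSpace.{u}} {x : X.carrier}

/-! ### `N ↦ j_*(O ⊗ N)` is finitary, exact and free of higher cohomology. -/

section StalkFinitary

variable {R : Type u} [CommRing R]

/-- The functor is finitary on all stalks. -/
def StalkFinitary (G : ModuleCat.{u} R ⥤ X.Mod) : Prop := ∀ z, Finitary (G ⋙ X.stalk z)

/-- An element of the stalk of `F(M)` is determined by its finitely many values `v i` in stalks of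
`M`; the union of the finite sets for these values works. For `C^p` and `j_* j^*` the index set is
finite because `X` is. -/
lemma StalkFinitary.of_finite {G : ModuleCat.{u} R ⥤ X.Mod} (hG : StalkFinitary G)
    (F : X.Mod ⥤ X.Mod) {z : X.carrier} {ι : Type u} [Finite ι] (w : ι → X.carrier)
    (v : ∀ (i : ι) (M : X.Mod), (X.stalk z).obj (F.obj M) → (X.stalk (w i)).obj M)
    (hv : ∀ (i : ι) {M N : X.Mod} (g : M ⟶ N) (s : (X.stalk z).obj (F.obj M)),
      v i N ((X.stalk z).map (F.map g) s) = (X.stalk (w i)).map g (v i M s))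
    (ext : ∀ {M : X.Mod} {s t : (X.stalk z).obj (F.obj M)}, (∀ i, v i M s = v i M t) → s = t) :
    Finitary ((G ⋙ F) ⋙ X.stalk z) := by
  classical
  intro I s
  have := Fintype.ofFinite ι
  have h (i : ι) := hG (w i) I (v i _ s)
  choose J hJ using h
  refine ⟨Finset.univ.biUnion J, fun J' h => ext fun i => ?_⟩
  refine (hv i _ s).trans (hJ i J' ?_)
  exact (Finset.subset_biUnion_of_mem J (Finset.mem_univ i)).trans h

instance (p : ℕ) (y : X.carrier) : Finite (Chain X p y) :=
  inferInstanceAs (Finite {c : Fin (p + 1) → X.carrier // StrictMono c ∧ y ≤ c 0})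

lemma StalkFinitary.comp_standard {G : ModuleCat.{u} R ⥤ X.Mod} (hG : StalkFinitary G) (p : ℕ) :
    StalkFinitary (G ⋙ standard X p) := fun z =>
  hG.of_finite (standard X p) (ι := Chain X p z) (fun c => c.last)
    (fun c _ s => StrictChain.component c s) (fun _ _ _ _ _ => rfl) (fun h => standard_ext h)

lemma StalkFinitary.comp_augFunctor {G : ModuleCat.{u} R ⥤ X.Mod} (hG : StalkFinitary G) (n : ℕ) :
    StalkFinitary (G ⋙ augFunctor X n) := by
  cases n with
  | zero => exact hG
  | succ p => exact hG.comp_standard p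

lemma StalkFinitary.comp_nearby {G : ModuleCat.{u} R ⥤ X.Mod} (hG : StalkFinitary G)
    (x : X.carrier) : StalkFinitary (G ⋙ nearby x) := fun z =>
  hG.of_finite (nearby x) (ι := {w : X.carrier // x ≤ w ∧ z ≤ w}) (fun w => w.1)
    (fun w _ s => nearbyVal w.2.1 w.2.2 s) (fun _ _ _ _ _ => rfl)
    (fun h => nearby_ext fun w h1 h2 => h ⟨w, h1, h2⟩)

lemma stalkFinitary_spread (x : X.carrier) : StalkFinitary (spread x) := by
  intro z I s
  by_cases h : x ≤ z
  · obtain ⟨J, hJ⟩ := finitary_id.comp_extendScalars (f := (X.O.map (homOfLE h)).hom) I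
      (spreadVal h s)
    exact ⟨J, fun J' h' => spread_ext fun _ => hJ J' h'⟩
  · exact ⟨∅, fun _ _ => spread_ext fun h' => (h h').elim⟩

end StalkFinitary

lemma extendScalars_map_exact [X.IsFiniteSpace] {y z : X.carrier} (f : y ⟶ z)
    (S : ShortComplex (ModuleCat.{u} (X.O.obj y))) (hS : S.Exact) :
    (S.map (ModuleCat.extendScalars.{u, u, u} (X.O.map f).hom)).Exact :=
  ((Functor.exact_tfae (ModuleCat.extendScalars.{u, u, u} (X.O.map f).hom)).out 1 3 :).2
    ⟨inferInstance, (inferInstance : PreservesColimitsOfSize.{0, 0}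
      (ModuleCat.extendScalars.{u, u, u} (X.O.map f).hom)).preservesFiniteColimits⟩ S hS

/-- On `U_x` the stalks are extensions of scalars along flat morphisms; elsewhere they are zero. -/
lemma spread_map_exact [X.IsFiniteSpace] (x : X.carrier)
    (S : ShortComplex (ModuleCat.{u} (X.O.obj x))) (hS : S.Exact) : (S.map (spread x)).Exact := by
  rw [exact_iff_forall]
  intro z m hm
  change (X.stalk z).obj ((spread x).obj S.X₂) at m
  by_cases h : x ≤ z
  · have hE := extendScalars_map_exact (homOfLE h) S hS
    rw [ShortComplex.moduleCat_exact_iff] at hE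
    obtain ⟨n, hn⟩ := hE (spreadVal h m) (congrArg (spreadVal h) hm)
    exact ⟨spreadMk fun _ => n, spread_ext fun _ => hn⟩
  · exact ⟨0, spread_ext fun h' => (h h').elim⟩

section FromStalk

variable {M : X.Mod}

lemma extLift_id {z : X.carrier} (h : x ≤ z) :
    extLift (𝟙 ((X.stalk x).obj M)) h = (X.tensorRes (homOfLE h)).app M := by
  unfold extLift
  rw [CategoryTheory.Functor.map_id, Category.id_comp]

/-- On `U_x`, a module whose comparison morphisms from `x` are isomorphisms is recovered from its
stalk at `x`. -/
lemma bijective_fromSpread_id (hM : ∀ w (h : x ≤ w), IsIso ((X.tensorRes (homOfLE h)).app M))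
    (w : X.carrier) (h : x ≤ w) :
    Function.Bijective ((X.stalk w).map (fromSpread (𝟙 ((X.stalk x).obj M)))) := by
  have hb := (ConcreteCategory.isIso_iff_bijective _).1 (hM w h)
  have hv (s : (X.stalk w).obj ((spread x).obj ((X.stalk x).obj M))) :
      (X.stalk w).map (fromSpread (𝟙 ((X.stalk x).obj M))) s =
        (X.tensorRes (homOfLE h)).app M (spreadVal h s) := by
    rw [fromSpread_apply _ h, extLift_id]
  refine ⟨fun s t hst => spread_ext fun _ => hb.1 ?_, fun m => ?_⟩
  · rw [← hv, ← hv, hst]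
  · obtain ⟨t, ht⟩ := hb.2 m
    exact ⟨spreadMk fun _ => t, (hv _).trans ht⟩

end FromStalk

lemma isQcoh_structureModule : X.IsQcoh X.structureModule := by
  intro y z f
  rw [Subsingleton.elim f (homOfLE f.le)]
  have h := f.le
  rw [ConcreteCategory.isIso_iff_bijective]
  let e (a : X.O.obj y) : (X.stalk y).obj X.structureModule := a
  have hres (a : X.O.obj y) : res X.structureModule h (e a) = (X.O.map (homOfLE h)).hom a := rfl
  -- The element `1 ⊗ 1` generates `O_z ⊗ O_y` over `O_z` and is sent to `1`.
  let u := bcUnit (X.O.map (homOfLE h)).hom ((X.stalk y).obj X.structureModule) (e 1)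
  have hu : (X.tensorRes (homOfLE h)).app X.structureModule u =
      (show (X.stalk z).obj X.structureModule from (1 : X.O.obj z)) :=
    (tensorRes_bcUnit _ _ _).trans ((hres 1).trans (map_one (X.O.map (homOfLE h)).hom))
  have hsu (a : X.O.obj z) :
      (X.tensorRes (homOfLE h)).app X.structureModule (a • u) = a :=
    (map_smul ((X.tensorRes (homOfLE h)).app X.structureModule).hom a u).trans
      ((congrArg (fun t : (X.stalk z).obj X.structureModule => a • t) hu).trans
        (mul_one (show X.O.obj z from a)))
  have hgen (t : ext ((X.stalk y).obj X.structureModule) h) : ∃ a : X.O.obj z, t = a • u := by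
    refine bc_induction t (fun n => ?_) ?_ ?_
    · refine ⟨(X.O.map (homOfLE h)).hom n, ?_⟩
      refine Eq.trans ?_ (bcUnit_smul _ _ _ _)
      exact congrArg (bcUnit (X.O.map (homOfLE h)).hom _) (mul_one (show X.O.obj y from n)).symm
    · rintro s t ⟨a, rfl⟩ ⟨b, rfl⟩
      exact ⟨a + b, (add_smul a b u).symm⟩
    · rintro b t ⟨a, rfl⟩
      exact ⟨b * a, (mul_smul b a u).symm⟩
  refine ⟨fun s t hst => ?_, fun a => ⟨(show X.O.obj z from a) • u, hsu a⟩⟩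
  obtain ⟨a, rfl⟩ := hgen s
  obtain ⟨b, rfl⟩ := hgen t
  rw [((hsu a).symm.trans hst).trans (hsu b)]

section Semiseparated

variable [X.IsSemiSeparated]

omit [X.IsSemiSeparated] in
lemma isGood_nearby_iff_spread {M : X.Mod}
    (hM : ∀ w (h : x ≤ w), IsIso ((X.tensorRes (homOfLE h)).app M)) :
    IsGood (nearby x) ((spread x).obj ((X.stalk x).obj M)) ↔ IsGood (nearby x) M :=
  isGood_nearby_iff _ (bijective_fromSpread_id hM)

/-- For `O_x` itself this is semi-separatedness, as its spread agrees with `O` on `U_x`; finitary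
functors carry exactness over to free modules. -/
lemma isGood_nearby_spread_free (x : X.carrier) (I : Type u) :
    IsGood (nearby x) ((spread x).obj (ModuleCat.of _ (I →₀ X.O.obj x))) := by
  rw [isGood_iff_of_preservesFiniteLimits]
  intro j
  rw [exact_iff_forall]
  intro y s hs
  have h0 := (isGood_nearby_iff_spread (x := x) (fun w h => isQcoh_structureModule _)).2
    (isGood_nearby_structureModule X x)
  have h1 := (exact_iff_forall _).1 (h0.exact (j + 1)) y
  exact Finitary.exact_free
    (((stalkFinitary_spread x).comp_augFunctor (j + 2)).comp_nearby x y)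
    (Functor.whiskerRight (Functor.whiskerLeft (spread x) (augD X (j + 1))) (nearby x ⋙ X.stalk y))
    (Functor.whiskerRight (Functor.whiskerLeft (spread x) (augD X (j + 2))) (nearby x ⋙ X.stalk y))
    h1 I s hs

omit [X.IsSemiSeparated] in
lemma augSc_nearby_spread_exact_of_quotient [X.IsFiniteSpace]
    {K P N : ModuleCat.{u} (X.O.obj x)} {i : K ⟶ P} {p : P ⟶ N} {w : i ≫ p = 0}
    (hS : (ShortComplex.mk i p w).ShortExact) (n : ℕ)
    (h₂ : ((augSc (nearby x) n).obj ((spread x).obj P)).Exact)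
    (h₁ : ((augSc (nearby x) (n + 1)).obj ((spread x).obj K)).Exact) :
    ((augSc (nearby x) n).obj ((spread x).obj N)).Exact := by
  have hS' : (ShortComplex.mk ((spread x).map i) ((spread x).map p)
      (by rw [← Functor.map_comp, w, Functor.map_zero])).ShortExact :=
    Functor.map_shortExact_of_map_exact (spread_map_exact x) _ hS
  have h := (nearby_skyExact x).augSc_exact_of_quotient hS' n h₂ h₁
  exact h

/-- Let `0 → K → P → N → 0` with `P` free. Vanishing for `P` in degree `n` and for `K` in degree `n
+ 1` gives vanishing for `N` in degree `n`, so the degree can be raised until the standard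
resolution is zero. -/
lemma isGood_nearby_spread (x : X.carrier) (N : ModuleCat.{u} (X.O.obj x)) :
    IsGood (nearby x) ((spread x).obj N) := by
  rw [isGood_iff_of_preservesFiniteLimits]
  -- The induction variable `k` bounds the distance from `n` to the number of points; the claim must
  -- cover all `N` at once, since `N` is replaced by `K`.
  suffices h : ∀ (k n : ℕ) (_ : Nat.card X.carrier ≤ n + k) (N : ModuleCat.{u} (X.O.obj x)),
      ((augSc (nearby x) (n + 1)).obj ((spread x).obj N)).Exact from
    fun j => h _ j (Nat.le_add_left _ _) N
  intro k
  induction k with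
  | zero =>
    intro n hn N
    refine ShortComplex.exact_of_isZero_X₂ _ ((nearby x).map_isZero ?_)
    exact standard_isZero_of_isEmpty (StrictChain.isEmpty_of_card_le (by lia)) _
  | succ k hk =>
    intro n hn N
    let p : ModuleCat.of (X.O.obj x) (N →₀ X.O.obj x) ⟶ N :=
      ModuleCat.ofHom (Finsupp.linearCombination (X.O.obj x) (id : N → N))
    have hp : Epi p := by
      rw [ModuleCat.epi_iff_surjective]
      exact Finsupp.linearCombination_id_surjective (X.O.obj x) N
    obtain ⟨K, i, w, hS⟩ : ∃ (K : ModuleCat.{u} (X.O.obj x)) (i : K ⟶ _) (w : i ≫ p = 0),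
        (ShortComplex.mk i p w).ShortExact :=
      ⟨kernel p, kernel.ι p, kernel.condition p, { exact := ShortComplex.exact_kernel p }⟩
    exact augSc_nearby_spread_exact_of_quotient hS (n + 1)
      ((isGood_nearby_spread_free x N).exact (n + 1)) (hk (n + 1) (by lia) K)

/-- `j_* j^*` is left exact, and goodness of the spread of the first term makes the last morphism
surjective. Both the quasi-coherence of `j_*(O ⊗ N)` and the exactness of `Qc` on skyscrapers rest
on this. -/
lemma spread_nearby_map_exact (x : X.carrier) (S : ShortComplex (ModuleCat.{u} (X.O.obj x)))
    (hS : S.Exact) : (S.map (spread x ⋙ nearby x)).Exact := by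
  refine ((Functor.exact_tfae (spread x ⋙ nearby x)).out 0 1 :).1 (fun S hS => ?_) S hS
  have hS' : (S.map (spread x)).ShortExact :=
    Functor.map_shortExact_of_map_exact (spread_map_exact x) S hS
  have := hS'.mono_f
  have h1 : IsGood (nearby x) (S.map (spread x)).X₁ := isGood_nearby_spread x S.X₁
  have h2 : Epi ((nearby x).map (S.map (spread x)).g) := (nearby_skyExact x).epi_map hS' h1
  have h3 : ((S.map (spread x)).map (nearby x)).Exact :=
    hS'.exact.map_of_mono_of_preservesKernel (nearby x) this inferInstance
  have h4 : Mono ((nearby x).map (S.map (spread x)).f) := inferInstance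
  exact { exact := h3
          mono_f := h4
          epi_g := h2 }

end Semiseparated

end FiniteRingedSpace
end

noncomputable section

lemma CategoryTheory.ShortComplex.exact_map_comp {A B C : Type*} [Category* A] [Category* B]
    [Category* C] [Preadditive A] [Preadditive B] [Preadditive C] (F : A ⥤ B) (G : B ⥤ C)
    [F.Additive] [G.Additive] (S : ShortComplex A) (h : ((S.map F).map G).Exact) :
    (S.map (F ⋙ G)).Exact := h

namespace FiniteRingedSpace

variable {X : FiniteRingedSpace.{u}} {x : X.carrier}

/-! ### Quasi-coherence of slices and of `j_*(O ⊗ N)`. -/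

section Slice

variable (G : (X.prod X).Mod)

/-- The ring morphism `O_x → O_x ⊗ O_y`. -/
def inclLeft (x y : X.carrier) : X.O.obj x →+* (X.prod X).O.obj (pt x y) :=
  (Algebra.TensorProduct.includeLeft :
    X.O.obj x →ₐ[ℤ] TensorProduct ℤ (X.O.obj x) (X.O.obj y)).toRingHom

lemma map_inclLeft (x : X.carrier) {y y' : X.carrier} (h : y ≤ y') (a : X.O.obj x) :
    ((X.prod X).O.map (homOfLE (pt_le (le_refl x) h))).hom (inclLeft x y a) = inclLeft x y' a := by
  change (X.O.map (homOfLE (le_refl x))).hom a ⊗ₜ[ℤ] (X.O.map (homOfLE h)).hom 1 = a ⊗ₜ 1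
  rw [map_one, O_map_self]

@[elab_as_elim]
lemma prod_induction {x y : X.carrier} {p : (X.prod X).O.obj (pt x y) → Prop}
    (b : (X.prod X).O.obj (pt x y)) (mul : ∀ a s, p (inclLeft x y a * inclRight x y s))
    (add : ∀ b c, p b → p c → p (b + c)) : p b := by
  change TensorProduct ℤ (X.O.obj x) (X.O.obj y) at b
  induction b with
  | zero =>
    have := mul 0 0
    rwa [map_zero, zero_mul] at this
  | add b c hb hc => exact add b c hb hc
  | tmul a s =>
    have := mul a s
    change p ((a ⊗ₜ[ℤ] (1 : X.O.obj y)) * ((1 : X.O.obj x) ⊗ₜ[ℤ] s)) at this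
    rwa [Algebra.TensorProduct.tmul_mul_tmul, mul_one, one_mul] at this

variable {G} in
/-- The value at `(x, y)`. -/
def sliceVal {y : X.carrier} :
    (X.stalk y).obj ((slice x).obj G) ≃+ ((X.prod X).stalk (pt x y)).obj G where
  toFun m := m
  invFun m := m
  left_inv _ := rfl
  right_inv _ := rfl
  map_add' _ _ := rfl

variable {G} in
lemma sliceVal_smul {y : X.carrier} (s : X.O.obj y) (m : (X.stalk y).obj ((slice x).obj G)) :
    sliceVal (s • m) = inclRight x y s • sliceVal m := rfl

variable {G} in
lemma sliceVal_res {y y' : X.carrier} (h : y ≤ y') (m : (X.stalk y).obj ((slice x).obj G)) :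
    sliceVal (res _ h m) = res G (pt_le (le_refl x) h) (sliceVal m) := rfl

/-- The action of `O_x` on the stalks of the restriction of a module on `X × X` to `{x} × X`. -/
def sliceMulAt (y : X.carrier) (a : X.O.obj x) :
    (X.stalk y).obj ((slice x).obj G) →ₗ[X.O.obj y] (X.stalk y).obj ((slice x).obj G) where
  toFun m := sliceVal.symm (inclLeft x y a • sliceVal m)
  map_add' s t := by rw [map_add, smul_add, map_add]
  map_smul' s m := sliceVal.injective (by
    rw [AddEquiv.apply_symm_apply, sliceVal_smul, RingHom.id_apply, sliceVal_smul,
      AddEquiv.apply_symm_apply, smul_comm])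

lemma sliceVal_sliceMulAt {y : X.carrier} (a : X.O.obj x)
    (m : (X.stalk y).obj ((slice x).obj G)) :
    sliceVal (sliceMulAt G y a m) = inclLeft x y a • sliceVal m := rfl

/-- The action of `O_x` on the restriction of a module on `X × X` to `{x} × X`. -/
def sliceMul (a : X.O.obj x) : (slice x).obj G ⟶ (slice x).obj G :=
  homMk (fun y => sliceMulAt G y a)
    (fun {y y'} h m => sliceVal.injective (by
      rw [sliceVal_res h, sliceVal_sliceMulAt, sliceVal_sliceMulAt, sliceVal_res h,
        res_smul G (pt_le (le_refl x) h), map_inclLeft x h]))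

lemma sliceVal_sliceMul {y : X.carrier} (a : X.O.obj x)
    (m : (X.stalk y).obj ((slice x).obj G)) :
    sliceVal ((X.stalk y).map (sliceMul G a) m) = inclLeft x y a • sliceVal m := rfl

/-- The action of `O_x` on the stalks of the restriction, as a ring morphism. -/
def sliceMulHom (x y : X.carrier) (G : (X.prod X).Mod) :
    X.O.obj x →+* End ((X.stalk y).obj ((slice x).obj G)) where
  toFun a := (X.stalk y).map (sliceMul G a)
  map_zero' := by
    refine ModuleCat.hom_ext (LinearMap.ext fun m => ?_)
    refine sliceVal.injective ((sliceVal_sliceMul G 0 m).trans ?_)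
    rw [map_zero, zero_smul]
    rfl
  map_one' := by
    refine ModuleCat.hom_ext (LinearMap.ext fun m => ?_)
    refine sliceVal.injective ((sliceVal_sliceMul G 1 m).trans ?_)
    rw [map_one, one_smul]
    rfl
  map_add' a b := by
    refine ModuleCat.hom_ext (LinearMap.ext fun m => ?_)
    refine sliceVal.injective ((sliceVal_sliceMul G _ m).trans ?_)
    rw [map_add, add_smul]
    rfl
  map_mul' a b := by
    refine ModuleCat.hom_ext (LinearMap.ext fun m => ?_)
    refine sliceVal.injective ((sliceVal_sliceMul G _ m).trans ?_)
    rw [map_mul, mul_smul]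
    rfl

variable (x) {y y' : X.carrier} (h : y ≤ y')

/-- The action of `O_x` on `O_y' ⊗ G_{(x,y)}`. -/
def sliceExtMul : X.O.obj x →+*
    AddMonoid.End (ext ((X.stalk y).obj ((slice x).obj G)) h) where
  toFun a := ((ModuleCat.extendScalars.{u, u, u} (X.O.map (homOfLE h)).hom).map
    (sliceMulHom x y G a)).hom.toAddMonoidHom
  map_zero' := by
    rw [map_zero, Functor.map_zero]
    rfl
  map_one' := by
    rw [map_one, End.one_def, CategoryTheory.Functor.map_id]
    rfl
  map_add' a b := by
    rw [map_add, Functor.map_add]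
    rfl
  map_mul' a b := by
    rw [map_mul, End.mul_def, Functor.map_comp]
    rfl

/-- The `O_x ⊗ O_y'`-module `O_y' ⊗ G_{(x,y)}`. -/
def sliceExt : ModuleCat.{u} ((X.prod X).O.obj (pt x y')) :=
  letI : Module ((X.prod X).O.obj (pt x y')) (ext ((X.stalk y).obj ((slice x).obj G)) h) :=
    Module.compHom _ (Algebra.TensorProduct.lift (sliceExtMul x G h).toIntAlgHom
      (Module.toAddMonoidEnd (X.O.obj y')
        (ext ((X.stalk y).obj ((slice x).obj G)) h)).toIntAlgHom (fun a s =>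
          AddMonoidHom.ext fun t => map_smul
            ((ModuleCat.extendScalars.{u, u, u} (X.O.map (homOfLE h)).hom).map
              (sliceMulHom x y G a)).hom s t)).toRingHom
  ModuleCat.of _ (ext ((X.stalk y).obj ((slice x).obj G)) h)

/-- The identity of `O_y' ⊗ G_{(x,y)}`. -/
def sliceExtVal : sliceExt x G h ≃+ ext ((X.stalk y).obj ((slice x).obj G)) h where
  toFun m := m
  invFun m := m
  left_inv _ := rfl
  right_inv _ := rfl
  map_add' _ _ := rfl

lemma sliceExtVal_smul (a : X.O.obj x) (s : X.O.obj y') (t : sliceExt x G h) :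
    sliceExtVal x G h ((inclLeft x y' a * inclRight x y' s) • t) =
      sliceExtMul x G h a (s • sliceExtVal x G h t) := by
  have : inclLeft x y' a * inclRight x y' s = (a ⊗ₜ s : TensorProduct ℤ (X.O.obj x) (X.O.obj y')) :=
    (Algebra.TensorProduct.tmul_mul_tmul a 1 1 s).trans (by rw [one_mul, mul_one])
  rw [this]
  rfl

/-- Since `O_x ⊗ O_y' = (O_x ⊗ O_y) ⊗_{O_y} O_y'`, base change along `(x,y) ≤ (x,y')` coincides with
base change along `y ≤ y'`. The `O_x`-action on `G_{(x,y)}` makes `O_y' ⊗ G_{(x,y)}` a module over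
`O_x ⊗ O_y'`, to which the universal property applies. -/
lemma isQcoh_slice {G : (X.prod X).Mod} (hG : (X.prod X).IsQcoh G) :
    X.IsQcoh ((slice x).obj G) := by
  intro y y' f
  rw [Subsingleton.elim f (homOfLE f.le)]
  have h := f.le
  have hp : pt x y ≤ pt x y' := pt_le (le_refl x) h
  have hI := hG (homOfLE hp)
  have hψ (b : (X.prod X).O.obj (pt x y)) (g : ((X.prod X).stalk (pt x y)).obj G) :
      extUnit _ h (sliceVal.symm (b • g)) = sliceExtVal x G h
        (((X.prod X).O.map (homOfLE hp)).hom b • (sliceExtVal x G h).symm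
          (extUnit _ h (sliceVal.symm g))) := by
    refine prod_induction b (fun a s => ?_) (fun b c hb hc => ?_)
    · rw [map_mul, map_inclLeft x h, map_inclRight x h, sliceExtVal_smul, AddEquiv.apply_symm_apply,
        ← bcUnit_smul, mul_smul]
      exact (map_bcUnit ((X.stalk y).map (sliceMul G a)) _).symm
    · rw [add_smul, map_add, map_add, hb, hc, map_add, add_smul, map_add]
  have hψ₁ (g g' : ((X.prod X).stalk (pt x y)).obj G) :
      (sliceExtVal x G h).symm (extUnit _ h (sliceVal.symm (g + g'))) =
        (sliceExtVal x G h).symm (extUnit _ h (sliceVal.symm g)) +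
          (sliceExtVal x G h).symm (extUnit _ h (sliceVal.symm g')) := by
    rw [map_add, map_add, map_add]
  let ψ : ((X.prod X).stalk (pt x y)).obj G ⟶
      (ModuleCat.restrictScalars ((X.prod X).O.map (homOfLE hp)).hom).obj (sliceExt x G h) :=
    ModuleCat.ofHom (Y := (ModuleCat.restrictScalars
        ((X.prod X).O.map (homOfLE hp)).hom).obj (sliceExt x G h))
      { toFun g := (sliceExtVal x G h).symm (extUnit _ h (sliceVal.symm g))
        map_add' := hψ₁
        map_smul' b g := (sliceExtVal x G h).injective (hψ b g) }
  -- The inverse of the comparison morphism: quasi-coherence of `G` identifies `G_{(x,y')}` with a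
  -- base change, from which `ψ` extends linearly.
  let θ : ((X.prod X).stalk (pt x y')).obj G ⟶ sliceExt x G h :=
    inv (((X.prod X).tensorRes (homOfLE hp)).app G) ≫ bcLift ψ
  have hθ (m : (X.stalk y).obj ((slice x).obj G)) :
      sliceExtVal x G h (θ (sliceVal (res _ h m))) = extUnit _ h m := by
    have h1 : θ (((X.prod X).tensorRes (homOfLE hp)).app G (bcUnit _ _ (sliceVal m))) =
        bcLift ψ (bcUnit _ _ (sliceVal m)) := by
      change (((X.prod X).tensorRes (homOfLE hp)).app G ≫ θ) (bcUnit _ _ (sliceVal m)) = _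
      rw [IsIso.hom_inv_id_assoc]
    rw [tensorRes_bcUnit, bcLift_bcUnit] at h1
    exact congrArg (sliceExtVal x G h) h1
  have hτ (a : X.O.obj x) (t : ext ((X.stalk y).obj ((slice x).obj G)) h) :
      sliceVal ((X.tensorRes (homOfLE h)).app ((slice x).obj G) (sliceExtMul x G h a t)) =
      inclLeft x y' a • sliceVal ((X.tensorRes (homOfLE h)).app ((slice x).obj G) t) :=
    congrArg sliceVal (NatTrans.naturality_apply (X.tensorRes (homOfLE h)) (sliceMul G a) t)
  rw [ConcreteCategory.isIso_iff_bijective]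
  refine ⟨Function.LeftInverse.injective (g := fun m => sliceExtVal x G h (θ (sliceVal m)))
    fun t => ?_, fun m => ?_⟩
  · beta_reduce
    refine bc_induction t (fun n => ?_) (fun s t hs ht => ?_) (fun a t ht => ?_)
    · rw [tensorRes_bcUnit, hθ]
    · rw [map_add, map_add, map_add, map_add, hs, ht]
    · rw [map_smul, sliceVal_smul, map_smul]
      have h1 := sliceExtVal_smul x G h 1 a (θ (sliceVal ((X.tensorRes (homOfLE h)).app _ t)))
      rw [map_one, one_mul, map_one, ht] at h1
      exact h1
  · obtain ⟨t, ht⟩ := ((ConcreteCategory.isIso_iff_bijective _).1 hI).2 (sliceVal m)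
    suffices H : ∀ t, ∃ n, sliceVal ((X.tensorRes (homOfLE h)).app ((slice x).obj G) n) =
        ((X.prod X).tensorRes (homOfLE hp)).app G t by
      obtain ⟨n, hn⟩ := H t
      exact ⟨n, sliceVal.injective (hn.trans ht)⟩
    intro t
    refine bc_induction t (fun n => ?_) ?_ ?_
    · refine ⟨extUnit _ h (sliceVal.symm n), ?_⟩
      rw [tensorRes_bcUnit, tensorRes_bcUnit]
      rfl
    · rintro s t ⟨n, hn⟩ ⟨n', hn'⟩
      exact ⟨n + n', by rw [map_add, map_add, map_add, hn, hn']⟩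
    · rintro b t ⟨n, hn⟩
      refine prod_induction b (fun a s => ?_) ?_
      · refine ⟨sliceExtMul x G h a (s • n), ?_⟩
        rw [hτ, map_smul, sliceVal_smul, hn, map_smul, mul_smul]
      · rintro b c ⟨n, hn⟩ ⟨n', hn'⟩
        exact ⟨n + n', by rw [map_add, map_add, add_smul, map_add, hn, hn']⟩

end Slice

section Semiseparated

variable [X.IsSemiSeparated]

lemma isQcoh_nearby_structureModule (x : X.carrier) :
    X.IsQcoh ((nearby x).obj X.structureModule) :=
  isQcoh_slice x (isQcoh_pushforward_structureModule X)

omit [X.IsSemiSeparated] in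
lemma isIso_nearby_map_fromSpread_id {M : X.Mod}
    (hM : ∀ w (h : x ≤ w), IsIso ((X.tensorRes (homOfLE h)).app M)) :
    IsIso ((nearby x).map (fromSpread (𝟙 ((X.stalk x).obj M)))) :=
  isIso_nearby_map _ (bijective_fromSpread_id hM)

-- The comparison morphism `O_z ⊗ G(N)_y → G(N)_z` is natural in `N` between exact finitary functors
-- (flatness gives exactness of the first), so it suffices that it is an isomorphism at `N = R`.
omit [X.IsSemiSeparated] in
lemma isQcoh_obj_of_stalkFinitary [X.IsFiniteSpace] {R : Type u} [CommRing R]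
    {G : ModuleCat.{u} R ⥤ X.Mod} [G.Additive] (hG : StalkFinitary G)
    (eG : ∀ S : ShortComplex _, S.Exact → (S.map G).Exact)
    (h0 : X.IsQcoh (G.obj (ModuleCat.of R R))) (N : ModuleCat.{u} R) : X.IsQcoh (G.obj N) := by
  intro y z f
  have e1 (S : ShortComplex (ModuleCat.{u} R)) (hS : S.Exact) : (S.map (G ⋙ X.stalk y)).Exact :=
    (exact_iff_stalk _).1 (eG S hS) y
  have e2 (S : ShortComplex (ModuleCat.{u} R)) (hS : S.Exact) : (S.map (G ⋙ X.stalk z)).Exact :=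
    (exact_iff_stalk _).1 (eG S hS) z
  have e3 (S : ShortComplex (ModuleCat.{u} R)) (hS : S.Exact) :
      (S.map ((G ⋙ X.stalk y) ⋙ ModuleCat.extendScalars.{u, u, u} (X.O.map f).hom)).Exact :=
    ShortComplex.exact_map_comp (G ⋙ X.stalk y) _ S
      (extendScalars_map_exact f (S.map (G ⋙ X.stalk y)) (e1 S hS))
  exact Finitary.isIso ((hG y).comp_extendScalars) (hG z) e3 e2
    (Functor.whiskerLeft G (X.tensorRes f)) (h0 f) N

/-- For `N = O_x` this is the quasi-coherence half of semi-separatedness; exactness and finitarity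
of `j_*(O ⊗ -)` extend it to all `N`. -/
lemma isQcoh_nearby_spread (x : X.carrier) (N : ModuleCat.{u} (X.O.obj x)) :
    X.IsQcoh ((nearby x).obj ((spread x).obj N)) := by
  have := isIso_nearby_map_fromSpread_id (x := x) (M := X.structureModule)
    (fun w h => isQcoh_structureModule _)
  have h0 := (isQcoh_nearby_structureModule x).of_iso
    (asIso ((nearby x).map (fromSpread (𝟙 ((X.stalk x).obj X.structureModule))))).symm
  exact isQcoh_obj_of_stalkFinitary ((stalkFinitary_spread x).comp_nearby x)
    (spread_nearby_map_exact x) h0 N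

lemma isQcoh_nearby {M : X.Mod}
    (hM : ∀ w (h : x ≤ w), IsIso ((X.tensorRes (homOfLE h)).app M)) :
    X.IsQcoh ((nearby x).obj M) := by
  have := isIso_nearby_map_fromSpread_id hM
  exact (isQcoh_nearby_spread x _).of_iso
    (asIso ((nearby x).map (fromSpread (𝟙 ((X.stalk x).obj M)))))

lemma isGood_nearby {M : X.Mod}
    (hM : ∀ w (h : x ≤ w), IsIso ((X.tensorRes (homOfLE h)).app M)) :
    IsGood (nearby x) M :=
  (isGood_nearby_iff_spread hM).1 (isGood_nearby_spread x _)

end Semiseparated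

end FiniteRingedSpace
end

noncomputable section
namespace FiniteRingedSpace

variable {X : FiniteRingedSpace.{u}} {x : X.carrier}

/-! ### Coreflections in quasi-coherent modules, and the existence of `Qc`. -/

section Coreflection

/-- Morphisms from quasi-coherent modules to the target lift uniquely to the source. -/
def QcohLifting {A B : X.Mod} (f : A ⟶ B) : Prop :=
  ∀ ⦃G : X.Mod⦄, X.IsQcoh G → ∀ g : G ⟶ B, ∃! h : G ⟶ A, h ≫ f = g

lemma QcohLifting.hom_ext {A B G : X.Mod} {f : A ⟶ B} (hf : QcohLifting f) (hG : X.IsQcoh G)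
    {h h' : G ⟶ A} (e : h ≫ f = h' ≫ f) : h = h' :=
  (hf hG (h' ≫ f)).unique e rfl

lemma QcohLifting.comp_iso {A B C : X.Mod} {f : A ⟶ B} (hf : QcohLifting f) (e : B ⟶ C) [IsIso e] :
    QcohLifting (f ≫ e) := fun G hG g => by
  obtain ⟨h, hh, hu⟩ := hf hG (g ≫ inv e)
  refine ⟨h, ?_, fun h' hh' => hu h' ?_⟩
  · change h ≫ f ≫ e = g
    rw [← Category.assoc, hh, Category.assoc, IsIso.inv_hom_id, Category.comp_id]
  · change h' ≫ f = g ≫ inv e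
    rw [← hh', Category.assoc, Category.assoc, IsIso.hom_inv_id, Category.comp_id]

/-- The quasi-coherent modules over `M` have a terminal object. -/
def HasCoreflection (M : X.Mod) : Prop := ∃ (A : X.Mod) (f : A ⟶ M), X.IsQcoh A ∧ QcohLifting f

variable (x) in
/-- The value at `x` of a section of `j_* j^* M`. -/
def nearbyAt (M : X.Mod) : (X.stalk x).obj ((nearby x).obj M) ⟶ (X.stalk x).obj M :=
  ModuleCat.ofHom
    { toFun s := nearbyVal le_rfl le_rfl s
      map_add' s t := map_add (nearbyVal (M := M) (le_refl x) (le_refl x)) s t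
      map_smul' a s := by
        refine (nearbyVal_smul (M := M) (le_refl x) (le_refl x) a s).trans ?_
        rw [O_map_self]
        rfl }

variable (x) in
/-- The natural morphism from `j_* j^* M` to the skyscraper of `M_x` at `x`. -/
def nearbyToSky : nearby x ⟶ X.stalk x ⋙ sky X x where
  app M := toSky (nearbyAt x M)
  naturality M N g := by
    refine (comp_toSky _ _).trans ?_
    exact (toSky_comp_map (nearbyAt x M) ((X.stalk x).map g)).symm

variable (x) in
/-- The natural morphism `M → j_* j^* M`. -/
def toNearby (M : X.Mod) : M ⟶ (nearby x).obj M :=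
  homMk (fun y =>
    { toFun m := nearbyMk (fun w _ h => res M h m) (fun _ _ _ _ _ _ _ => res_res M _ _ _)
      map_add' m m' := nearby_ext fun w h h' => map_add (res M h') m m'
      map_smul' a m := nearby_ext fun w h h' => by
        refine (res_smul M h' a m).trans (nearbyVal_smul (M := M) h h' a (nearbyMk
          (fun w _ h => res M h m) (fun _ _ _ _ _ _ _ => res_res M _ _ _))).symm })
    (fun {y y'} h m => nearby_ext fun w _ h' => (res_res M h h' m).symm)

lemma toNearby_comp_nearbyToSky (M : X.Mod) :
    toNearby x M ≫ (nearbyToSky x).app M = toSky (𝟙 _) := by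
  refine (comp_toSky _ _).trans (congrArg toSky ?_)
  ext m
  exact res_self M _ m

lemma extLift_comp {N : ModuleCat.{u} (X.O.obj x)} {M M' : X.Mod} (φ : N ⟶ (X.stalk x).obj M)
    (ψ : (X.stalk x).obj M ⟶ (X.stalk x).obj M') (t : ext N (le_refl x)) :
    extLift (φ ≫ ψ) le_rfl t = ψ (extLift φ le_rfl t) := by
  refine bc_induction t (fun n => ?_) (fun s t hs ht => ?_) (fun a t ht => ?_)
  · rw [extLift_extUnit, extLift_extUnit, res_self, res_self]
    rfl
  · rw [map_add, map_add, map_add, hs, ht]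
  · rw [map_smul, map_smul, map_smul, ht]

lemma stalk_map_fromSpread {G M : X.Mod} (φ : (X.stalk x).obj G ⟶ (X.stalk x).obj M) :
    (X.stalk x).map (fromSpread φ) = (X.stalk x).map (fromSpread (𝟙 ((X.stalk x).obj G))) ≫ φ := by
  ext s
  refine (fromSpread_apply φ le_rfl s).trans (Eq.trans ?_
    (congrArg φ (fromSpread_apply (𝟙 _) le_rfl s)).symm)
  rw [← extLift_comp, Category.id_comp]

/-- The stalks of `G` on `U_x` are generated by the image of `G_x`, so `d` is determined by its
values at `x`. -/
lemma eq_zero_of_comp_nearbyToSky {G M : X.Mod} (hG : X.IsQcoh G) (d : G ⟶ (nearby x).obj M)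
    (hd : d ≫ (nearbyToSky x).app M = 0) : d = 0 := by
  have h0 (m : (X.stalk x).obj G) : nearbyVal le_rfl le_rfl ((X.stalk x).map d m) = 0 := by
    have h1 : (X.stalk x).map d ≫ nearbyAt x M = 0 := by
      rw [← fromSky_toSky ((X.stalk x).map d ≫ nearbyAt x M), ← comp_toSky]
      exact congrArg fromSky hd
    exact congr($h1 m)
  have h1 (w : X.carrier) (hw : x ≤ w) (t : ext ((X.stalk x).obj G) hw) :
      nearbyVal hw le_rfl ((X.stalk w).map d ((X.tensorRes (homOfLE hw)).app G t)) = 0 := by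
    refine bc_induction t (fun n => ?_) (fun s t hs ht => ?_) (fun a t ht => ?_)
    · rw [tensorRes_bcUnit, ← res_app, nearbyVal_res, ← res_nearbyVal le_rfl le_rfl hw, h0, map_zero]
    · rw [map_add, map_add, map_add, hs, ht, add_zero]
    · rw [map_smul, map_smul, nearbyVal_smul, ht, smul_zero]
  refine hom_ext_stalk fun y m => nearby_ext fun w h h' => ?_
  obtain ⟨t, ht⟩ := ((ConcreteCategory.isIso_iff_bijective _).1 (hG (homOfLE h))).2 (res G h' m)
  have h2 := h1 w h t
  rw [ht, ← res_app, nearbyVal_res] at h2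
  exact h2

/-- For quasi-coherent `G`, morphisms to `j_* j^* M` are morphisms `G|U_x → M|U_x`, hence linear
maps `G_x → M_x`, hence morphisms to the skyscraper of `M_x`. No quasi-coherence of `M` is involved.
-/
lemma qcohLifting_nearbyToSky (x : X.carrier) (M : X.Mod) :
    QcohLifting ((nearbyToSky x).app M) := by
  intro G hG g
  have hG' : ∀ w (h : x ≤ w), IsIso ((X.tensorRes (homOfLE h)).app G) := fun w h => hG _
  have := isIso_nearby_map_fromSpread_id hG'
  -- On `U_x`, `G` is the spread of `G_x`, so the linear map `G_x → M_x` given by `g` extends over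
  -- `U_x`.
  let h₀ : G ⟶ (nearby x).obj M := toNearby x G ≫ inv ((nearby x).map (fromSpread (𝟙 ((X.stalk x).obj G)))) ≫
    (nearby x).map (fromSpread (fromSky g))
  have hh₀ : h₀ ≫ (nearbyToSky x).app M = g := by
    have h1 : inv ((nearby x).map (fromSpread (𝟙 ((X.stalk x).obj G)))) ≫
        (nearby x).map (fromSpread (fromSky g)) ≫ (nearbyToSky x).app M =
          (nearbyToSky x).app G ≫ (sky X x).map (fromSky g) := by
      rw [IsIso.inv_comp_eq, (nearbyToSky x).naturality]
      rw [← Category.assoc, (nearbyToSky x).naturality, Category.assoc]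
      refine congrArg (_ ≫ ·) ?_
      refine (congrArg (sky X x).map (stalk_map_fromSpread (fromSky g))).trans ?_
      exact (sky X x).map_comp _ _
    change (_ ≫ _ ≫ _) ≫ _ = g
    rw [Category.assoc, Category.assoc, h1, ← Category.assoc, toNearby_comp_nearbyToSky,
      toSky_comp_map, Category.id_comp, toSky_fromSky]
  refine ⟨h₀, hh₀, fun h hh => sub_eq_zero.1 (eq_zero_of_comp_nearbyToSky hG _ ?_)⟩
  rw [Preadditive.sub_comp, hh₀, hh, sub_self]

/-- The canonical isomorphism `O_x ⊗ L → L`. -/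
def extSelf (L : ModuleCat.{u} (X.O.obj x)) : ext L (le_refl x) ⟶ L :=
  bcLift (ModuleCat.ofHom
    (Y := (ModuleCat.restrictScalars (X.O.map (homOfLE (le_refl x))).hom).obj L)
    { toFun n := n
      map_add' _ _ := rfl
      map_smul' a n := by
        change _ = (X.O.map (homOfLE (le_refl x))).hom a • n
        rw [O_map_self] })

lemma extSelf_extUnit (L : ModuleCat.{u} (X.O.obj x)) (n : L) :
    extSelf L (extUnit L (le_refl x) n) = n := bcLift_bcUnit _ n

/-- The canonical isomorphism `(O_x ⊗ L) → L`, from the stalk of `spread`. -/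
def spreadAt (L : ModuleCat.{u} (X.O.obj x)) : (X.stalk x).obj ((spread x).obj L) ⟶ L :=
  ModuleCat.ofHom
    { toFun s := extSelf L (spreadVal le_rfl s)
      map_add' s t := (congrArg (extSelf L) (map_add (spreadVal (N := L) (le_refl x)) s t)).trans
        (map_add (extSelf L).hom _ _)
      map_smul' a s := (congrArg (extSelf L) (spreadVal_smul (N := L) (le_refl x) a s)).trans
        (map_smul (extSelf L).hom _ _) }

instance (L : ModuleCat.{u} (X.O.obj x)) : IsIso (spreadAt L) := by
  rw [ConcreteCategory.isIso_iff_bijective]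
  have h1 (t : ext L (le_refl x)) : ∃ n, t = extUnit L (le_refl x) n := by
    refine bc_induction t (fun n => ⟨n, rfl⟩) ?_ ?_
    · rintro _ _ ⟨n, rfl⟩ ⟨n', rfl⟩
      exact ⟨n + n', (map_add _ _ _).symm⟩
    · rintro a _ ⟨n, rfl⟩
      refine ⟨a • n, ?_⟩
      rw [bcUnit_smul, O_map_self]
  have h2 (s : (X.stalk x).obj ((spread x).obj L)) :
      spreadAt L s = extSelf L (spreadVal le_rfl s) := rfl
  refine ⟨fun s t hst => spread_ext fun _ => ?_, fun n => ⟨spreadMk fun _ => extUnit L le_rfl n, ?_⟩⟩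
  · rw [h2, h2] at hst
    obtain ⟨n, hn⟩ := h1 (spreadVal le_rfl s)
    obtain ⟨n', hn'⟩ := h1 (spreadVal le_rfl t)
    rw [hn, hn', extSelf_extUnit, extSelf_extUnit] at hst
    rw [hn, hn', hst]
  · exact extSelf_extUnit L n

lemma spreadAt_naturality {L L' : ModuleCat.{u} (X.O.obj x)} (g : L ⟶ L') :
    (X.stalk x).map ((spread x).map g) ≫ spreadAt L' = spreadAt L ≫ g := by
  ext s
  have h (t : ext L (le_refl x)) : extSelf L' ((ModuleCat.extendScalars.{u, u, u} _).map g t) =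
      g (extSelf L t) := by
    refine bc_induction t (fun n => ?_) (fun s t hs ht => ?_) (fun a t ht => ?_)
    · rw [map_bcUnit, extSelf_extUnit, extSelf_extUnit]
    · rw [map_add, map_add, map_add, map_add, hs, ht]
    · rw [map_smul, map_smul, map_smul, map_smul, ht]
  exact h (spreadVal le_rfl s)

variable (x) in
/-- The natural coreflection of a skyscraper. -/
def spreadToSky : spread x ⋙ nearby x ⟶ sky X x where
  app L := (nearbyToSky x).app ((spread x).obj L) ≫ (sky X x).map (spreadAt L)
  naturality L L' g := by
    have h := (nearbyToSky x).naturality ((spread x).map g)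
    rw [Category.assoc, ← Functor.map_comp, ← spreadAt_naturality, Functor.map_comp,
      ← Category.assoc]
    refine (congrArg (· ≫ _) h).trans (Category.assoc _ _ _)

lemma qcohLifting_spreadToSky (L : ModuleCat.{u} (X.O.obj x)) :
    QcohLifting ((spreadToSky x).app L) :=
  (qcohLifting_nearbyToSky x ((spread x).obj L)).comp_iso _

lemma hasCoreflection_sky [X.IsSemiSeparated] (x : X.carrier) (L : ModuleCat.{u} (X.O.obj x)) :
    HasCoreflection ((sky X x).obj L) :=
  ⟨_, (spreadToSky x).app L, isQcoh_nearby_spread x L, qcohLifting_spreadToSky L⟩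

instance : HasFiniteBiproducts X.Mod := Abelian.hasFiniteBiproducts

lemma HasCoreflection.biproduct [X.IsFiniteSpace] {M : X.carrier → X.Mod} (h : ∀ z, HasCoreflection (M z)) :
    HasCoreflection (⨁ M) := by
  choose A f hA hf using h
  refine ⟨⨁ A, biproduct.map f, (X.IsQcoh.prop_product hA).of_iso (biproduct.isoProduct A).symm,
    fun G hG g => ?_⟩
  have h1 (z : X.carrier) := hf z hG (g ≫ biproduct.π M z)
  choose k hk hu using h1
  refine ⟨biproduct.lift k, ?_, fun k' hk' => biproduct.hom_ext _ _ fun z => ?_⟩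
  · refine biproduct.hom_ext _ _ fun z => ?_
    rw [Category.assoc, biproduct.map_π, ← Category.assoc, biproduct.lift_π]
    exact hk z
  · rw [biproduct.lift_π]
    refine hu z _ ?_
    change _ ≫ _ = _
    rw [← hk', Category.assoc, Category.assoc, biproduct.map_π]

/-- A right adjoint commutes with kernels, so the coreflection of `M` has to be the kernel of the
morphism that `u` induces between the coreflections; flatness makes this kernel quasi-coherent. -/
lemma HasCoreflection.of_kernel {M B C : X.Mod} [X.IsFiniteSpace] (i : M ⟶ B) (u : B ⟶ C) (w : i ≫ u = 0)
    (hi : IsLimit (KernelFork.ofι i w)) (hB : HasCoreflection B) (hC : HasCoreflection C) :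
    HasCoreflection M := by
  obtain ⟨A₁, f₁, hA₁, hf₁⟩ := hB
  obtain ⟨A₂, f₂, hA₂, hf₂⟩ := hC
  obtain ⟨v, hv, -⟩ := hf₂ hA₁ (f₁ ≫ u)
  change v ≫ f₂ = f₁ ≫ u at hv
  have := mono_of_isLimit_fork hi
  change Mono i at this
  obtain ⟨f, hf⟩ := KernelFork.IsLimit.lift' hi (kernel.ι v ≫ f₁) (by
    rw [Category.assoc, ← hv, kernel.condition_assoc, zero_comp])
  change f ≫ i = _ at hf
  refine ⟨kernel v, f, X.IsQcoh.prop_kernel v hA₁ hA₂, fun G hG g => ?_⟩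
  obtain ⟨h₁, hh₁, -⟩ := hf₁ hG (g ≫ i)
  change h₁ ≫ f₁ = g ≫ i at hh₁
  have h2 : h₁ ≫ v = 0 := hf₂.hom_ext hG (by
    rw [Category.assoc, hv, ← Category.assoc, hh₁, Category.assoc, w, comp_zero, zero_comp])
  refine ⟨kernel.lift v h₁ h2, ?_, fun h hh => ?_⟩
  · change _ ≫ f = g
    rw [← cancel_mono i, Category.assoc, hf, kernel.lift_ι_assoc, hh₁]
  · change h ≫ f = g at hh
    rw [← cancel_mono (kernel.ι v), kernel.lift_ι]
    refine hf₁.hom_ext hG ?_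
    rw [Category.assoc, ← hf, ← Category.assoc, hh, hh₁]

/-- The embedding of a module in a sum of skyscrapers. -/
def toSkySum (M : X.Mod) : M ⟶ ⨁ fun z => (sky X z).obj ((X.stalk z).obj M) :=
  biproduct.lift fun _ => toSky (𝟙 _)

instance (M : X.Mod) : Mono (toSkySum M) := by
  rw [mono_iff_stalk]
  intro y
  refine (injective_iff_map_eq_zero _).2 fun m hm => ?_
  have h : (X.stalk y).map (toSkySum M ≫ biproduct.π _ y) m = 0 := by
    refine (congrArg ((X.stalk y).map (biproduct.π _ y)) hm).trans (map_zero _)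
  rw [toSkySum, biproduct.lift_π] at h
  refine Eq.trans ?_ (congrArg (skyVal le_rfl) h)
  exact (res_self M le_rfl m).symm

/-- Embedding `M`, and then the cokernel, in finite sums of skyscrapers presents `M` as a kernel
between modules whose coreflections are known. -/
lemma hasCoreflection [X.IsSemiSeparated] (M : X.Mod) : HasCoreflection M := by
  let S := ShortComplex.mk (toSkySum M) (cokernel.π (toSkySum M) ≫ toSkySum _)
    (by rw [cokernel.condition_assoc, zero_comp])
  have hS : S.Exact := by
    let φ : ShortComplex.mk (toSkySum M) (cokernel.π (toSkySum M)) (by simp) ⟶ S :=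
      { τ₁ := 𝟙 _, τ₂ := 𝟙 _, τ₃ := toSkySum _ }
    have : Mono φ.τ₃ := inferInstanceAs (Mono (toSkySum (cokernel (toSkySum M))))
    exact (ShortComplex.exact_iff_of_epi_of_isIso_of_mono φ).1 (ShortComplex.exact_cokernel _)
  have : Mono S.f := inferInstanceAs (Mono (toSkySum M))
  exact HasCoreflection.of_kernel S.f S.g S.zero hS.fIsKernel
    (HasCoreflection.biproduct fun z => hasCoreflection_sky z _)
    (HasCoreflection.biproduct fun z => hasCoreflection_sky z _)

theorem nonempty_quasicoherator (X : FiniteRingedSpace.{u}) [X.IsSemiSeparated] :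
    Nonempty X.Quasicoherator := by
  choose A f hA hf using hasCoreflection (X := X)
  let e (G : X.Qcoh) (M : X.Mod) : (X.IsQcoh.ι.obj G ⟶ M) ≃ (G ⟶ ⟨A M, hA M⟩) :=
    { toFun g := X.IsQcoh.homMk (hf M G.property g).choose
      invFun h := h.hom ≫ f M
      left_inv g := (hf M G.property g).choose_spec.1
      right_inv h := by
        ext1
        exact (hf M).hom_ext G.property (hf M G.property (h.hom ≫ f M)).choose_spec.1 }
  exact ⟨⟨_, Adjunction.adjunctionOfEquivRight (F := X.IsQcoh.ι) (G_obj := fun M => ⟨A M, hA M⟩) e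
    (fun G' G M a g => by
      ext1
      refine (hf M).hom_ext G'.property ?_
      refine (hf M G'.property _).choose_spec.1.trans ?_
      refine Eq.trans ?_ (Category.assoc _ _ _).symm
      exact congrArg (a.hom ≫ ·) (hf M G.property g).choose_spec.1.symm)⟩⟩

end Coreflection
end FiniteRingedSpace
end

noncomputable section
namespace FiniteRingedSpace

variable {X : FiniteRingedSpace.{u}} {x : X.carrier}

/-! ### Permanence of goodness, and the embedding in the sum of the modules `j_* j^* M`. -/

section FunctorIso

variable {A : Type*} [Category* A] [Abelian A] {F F' : X.Mod ⥤ A} [F.Additive] [F'.Additive]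

lemma IsGood.of_functor_iso (e : F ≅ F') {M : X.Mod} (h : IsGood F M) : IsGood F' M where
  mono := by
    have := h.mono
    rw [← NatIso.naturality_1 e]
    infer_instance
  exact n := by
    refine (ShortComplex.exact_iff_of_iso (ShortComplex.isoMk (e.app _) (e.app _) (e.app _) ?_ ?_)).1
      (h.exact n)
    · exact (e.hom.naturality _).symm
    · exact (e.hom.naturality _).symm

lemma isGood_biproduct {M : X.carrier → X.Mod} (h : ∀ z, IsGood F (M z)) : IsGood F (⨁ M) := by
  have := Fintype.ofFinite X.carrier
  classical
  refine IsGood.of_id_eq_sum Finset.univ M (biproduct.π M) (biproduct.ι M)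
    (biproduct.hom_ext _ _ fun z => ?_) (fun z _ => h z)
  rw [Preadditive.sum_comp, Finset.sum_eq_single_of_mem z (Finset.mem_univ z), Category.assoc,
    biproduct.ι_π_self, Category.comp_id, Category.id_comp]
  intro z' _ hz
  rw [Category.assoc, biproduct.ι_π_ne _ hz, comp_zero]

lemma isGood_of_isZero {M : X.Mod} (h : IsZero M) : IsGood F M :=
  IsGood.of_id_eq_sum ∅ (fun e : PEmpty.{1} => e.elim) (fun e => e.elim) (fun e => e.elim)
    (h.eq_of_src _ _) (by simp)

lemma isGood_single {M : X.Mod} (h : IsGood F M) (n : ℤ) :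
    IsGood F (((CochainComplex.singleFunctor X.Mod 0).obj M).X n) := by
  by_cases hn : n = 0
  · subst hn
    exact h.of_iso (HomologicalComplex.singleObjXSelf (ComplexShape.up ℤ) 0 M).symm
  · exact isGood_of_isZero (HomologicalComplex.isZero_single_obj_X (ComplexShape.up ℤ) 0 M n hn)

lemma isGood_map_totalStandard {G : X.Mod ⥤ X.Mod} [G.Additive]
    (h : ∀ p M, IsGood F (G.obj ((standard X p).obj M))) (M : CochainComplex X.Mod ℤ) (n : ℤ) :
    IsGood F (G.obj ((X.totalStandard.obj M).X n)) := by
  refine IsGood.of_id_eq_sum (Finset.range (Nat.card X.carrier + 1))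
    (fun p => G.obj ((standard X p).obj (M.X (n - p))))
    (fun p => G.map (totalπ M p (n - p) n (by lia)))
    (fun p => G.map (totalι M p (n - p) n (by lia))) ?_ (fun p _ => h p _)
  rw [← CategoryTheory.Functor.map_id, ← sum_totalπ_totalι, Functor.map_sum]
  exact Finset.sum_congr rfl fun c _ => Functor.map_comp _ _ _

end FunctorIso

instance [X.IsFiniteSpace] : X.IsQcoh.ι.PreservesHomology where
  preservesKernels _ _ f := X.IsQcoh.preservesKernels_ι f
  preservesCokernels _ _ f := X.IsQcoh.preservesCokernels_ι f

lemma isQcoh_nearbySum [X.IsSemiSeparated] {M : X.Mod} (hM : X.IsQcoh M) :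
    X.IsQcoh (⨁ fun z => (nearby z).obj M) :=
  (X.IsQcoh.prop_product fun z => isQcoh_nearby (x := z) fun _ _ => hM _).of_iso
    (biproduct.isoProduct _).symm

/-- The embedding of a module in the sum of the modules `j_* j^* M`. -/
def toNearbySum (M : X.Mod) : M ⟶ ⨁ fun z => (nearby z).obj M :=
  biproduct.lift fun z => toNearby z M

instance (M : X.Mod) : Mono (toNearbySum M) := by
  rw [mono_iff_stalk]
  intro y
  refine (injective_iff_map_eq_zero _).2 fun m hm => ?_
  have h : (X.stalk y).map (toNearbySum M ≫ biproduct.π _ y) m = 0 :=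
    (congrArg ((X.stalk y).map (biproduct.π _ y)) hm).trans (map_zero _)
  rw [toNearbySum, biproduct.lift_π] at h
  refine Eq.trans ?_ ((congrArg (nearbyVal le_rfl le_rfl) h).trans (map_zero _))
  exact (res_self M le_rfl m).symm

lemma shortExact_toNearbySum (M : X.Mod) :
    (ShortComplex.mk (toNearbySum M) (cokernel.π (toNearbySum M))
      (cokernel.condition _)).ShortExact where
  exact := ShortComplex.exact_cokernel _
  mono_f := inferInstanceAs (Mono (toNearbySum M))
  epi_g := inferInstanceAs (Epi (cokernel.π (toNearbySum M)))

/-! ### Exactness of `Qc` on skyscrapers, and goodness of quasi-coherent modules for `Qc`. -/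

namespace Quasicoherator

section FiniteSpace
variable [X.IsFiniteSpace] (Qc : X.Quasicoherator)

instance : PreservesFiniteLimits Qc.functor :=
  (Qc.adj.rightAdjoint_preservesLimits :
    PreservesLimitsOfSize.{0, 0} Qc.functor).preservesFiniteLimits

omit [X.IsFiniteSpace] in
-- By adjunction and Yoneda, `Qc` sees modules only through morphisms from quasi-coherent ones. The
-- source of `f` need not be quasi-coherent.
lemma isIso_map {A B : X.Mod} {f : A ⟶ B} (hf : QcohLifting f) : IsIso (Qc.functor.map f) := by
  refine isIso_of_yoneda_map_bijective _ fun G => ⟨fun h h' e => ?_, fun g => ?_⟩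
  · refine (Qc.adj.homEquiv G A).symm.injective (hf.hom_ext G.property ?_)
    change h ≫ Qc.functor.map f = h' ≫ Qc.functor.map f at e
    rw [← Adjunction.homEquiv_naturality_right_symm, ← Adjunction.homEquiv_naturality_right_symm, e]
  · obtain ⟨h, hh, -⟩ := hf G.property ((Qc.adj.homEquiv G B).symm g)
    refine ⟨Qc.adj.homEquiv G A h, ?_⟩
    change _ ≫ Qc.functor.map f = g
    rw [← Adjunction.homEquiv_naturality_right]
    exact (congrArg (Qc.adj.homEquiv G B) hh).trans (Equiv.apply_symm_apply _ _)

/-- `Qc` is the identity on quasi-coherent modules. -/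
def unitIso : 𝟭 X.Qcoh ≅ X.IsQcoh.ι ⋙ Qc.functor := asIso Qc.adj.unit

/-- `Qc` restricted to quasi-coherent modules is isomorphic to the identity, although it is only
left exact on all modules. -/
lemma epi_map {A B : X.Mod} (hA : X.IsQcoh A) (hB : X.IsQcoh B) (f : A ⟶ B) [Epi f] :
    Epi (Qc.functor.map f) := by
  let f' : (⟨A, hA⟩ : X.Qcoh) ⟶ ⟨B, hB⟩ := X.IsQcoh.homMk f
  have : Epi (X.IsQcoh.ι.map f') := inferInstanceAs (Epi f)
  have : Epi f' := X.IsQcoh.ι.epi_of_epi_map this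
  have h : Qc.functor.map f = Qc.unitIso.inv.app ⟨A, hA⟩ ≫ f' ≫ Qc.unitIso.hom.app ⟨B, hB⟩ :=
    (NatIso.naturality_1 Qc.unitIso f').symm
  rw [h]
  infer_instance

end FiniteSpace

section SemiSeparated
variable [X.IsSemiSeparated] (Qc : X.Quasicoherator)

/-- The quasi-coherent module `j_* (O ⊗ L)`. -/
def spreadQcoh (x : X.carrier) : ModuleCat.{u} (X.O.obj x) ⥤ X.Qcoh :=
  X.IsQcoh.lift (spread x ⋙ nearby x) (isQcoh_nearby_spread x)

omit [X.IsSemiSeparated] in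
instance (x : X.carrier) : IsIso (Functor.whiskerRight (spreadToSky x) Qc.functor) := by
  have : ∀ L, IsIso ((Functor.whiskerRight (spreadToSky x) Qc.functor).app L) := fun L =>
    Qc.isIso_map (qcohLifting_spreadToSky L)
  exact NatIso.isIso_of_isIso_app _

/-- The value of `Qc` at a skyscraper. -/
def skyIso (x : X.carrier) : spreadQcoh x ≅ sky X x ⋙ Qc.functor :=
  Functor.isoWhiskerLeft (spreadQcoh x) Qc.unitIso ≪≫
    (show (spread x ⋙ nearby x) ⋙ Qc.functor ≅ sky X x ⋙ Qc.functor from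
      asIso (Functor.whiskerRight (spreadToSky x) Qc.functor))

instance (x : X.carrier) : (spreadQcoh x).Additive where
  map_add := by
    intros
    ext1
    exact (spread x ⋙ nearby x).map_add

/-- The value of `Qc` at the skyscraper of `L` at `x` is `j_*(O ⊗ L)`, which is exact in `L`. -/
lemma skyExact : SkyExact Qc.functor := by
  intro x S hS
  have h : (S.map (spreadQcoh x)).Exact := by
    rw [← ShortComplex.exact_map_iff_of_faithful _ X.IsQcoh.ι]
    exact spread_nearby_map_exact x S hS
  exact (ShortComplex.exact_iff_of_iso (S.mapNatIso (Qc.skyIso x))).1 h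

/-- `Qc(j_* j^* M) = Qc(sky_x M_x)` depends on `M` only through its stalk at `x`, where the standard
resolution is contractible. -/
lemma isGood_nearby_comp (x : X.carrier) (M : X.Mod) : IsGood (nearby x ⋙ Qc.functor) M := by
  have : ∀ M, IsIso ((Functor.whiskerRight (nearbyToSky x) Qc.functor).app M) := fun M =>
    Qc.isIso_map (qcohLifting_nearbyToSky x M)
  have := NatIso.isIso_of_isIso_app (Functor.whiskerRight (nearbyToSky x) Qc.functor)
  have h : IsGood (X.stalk x ⋙ (sky X x ⋙ Qc.functor)) M :=
    ((stalk_isContractible M x).comp (sky X x ⋙ Qc.functor)).isGood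
  exact h.of_functor_iso (asIso (Functor.whiskerRight (nearbyToSky x) Qc.functor)).symm

/-- Semi-separatedness makes `j_* j^* C^• M` a resolution of `j_* j^* M`. Its terms are sums of
skyscrapers, hence good, and it remains a resolution after `Qc` by `isGood_nearby_comp`. -/
lemma isGood_nearby {M : X.Mod} (hM : X.IsQcoh M) (x : X.carrier) :
    IsGood Qc.functor ((nearby x).obj M) := by
  let K := (CochainComplex.singleFunctor X.Mod 0).obj M
  let φ := ((nearby x).mapHomologicalComplex (ComplexShape.up ℤ)).map (X.toTotalStandard.app K)
  have hφ : QuasiIso φ := quasiIso_map_toTotalStandard K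
    (isGood_single (FiniteRingedSpace.isGood_nearby fun w h => hM _))
  have hφ' : QuasiIso ((Qc.functor.mapHomologicalComplex (ComplexShape.up ℤ)).map φ) :=
    quasiIso_map_toTotalStandard (F := nearby x ⋙ Qc.functor) K
      (isGood_single (Qc.isGood_nearby_comp x M))
  let e : (CochainComplex.singleFunctor X.Mod 0).obj ((nearby x).obj M) ≅
      ((nearby x).mapHomologicalComplex (ComplexShape.up ℤ)).obj K :=
    ((HomologicalComplex.singleMapHomologicalComplex (nearby x) (ComplexShape.up ℤ) 0).app M).symm
  refine Qc.skyExact.isGood_of_quasiIso (e.hom ≫ φ)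
    (isGood_map_totalStandard (fun p N => isGood_nearby_standard _ x N p) K) ?_
  rw [Functor.map_comp]
  infer_instance

lemma isGood_nearbySum {M : X.Mod} (hM : X.IsQcoh M) :
    IsGood Qc.functor (⨁ fun z => (nearby z).obj M) :=
  isGood_biproduct fun z => Qc.isGood_nearby hM z

/-- Dimension shifting along the embedding of `M` in the sum of the `j_* j^* M`, which is good; the
cokernel is again quasi-coherent. -/
lemma isGood_of_isQcoh {M : X.Mod} (hM : X.IsQcoh M) : IsGood Qc.functor M := by
  rw [isGood_iff_of_preservesFiniteLimits]
  intro j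
  induction j generalizing M with
  | zero =>
    have h0 := isGood_id (cokernel (toNearbySum M))
    have := h0.mono
    have h1 : ((augSc Qc.functor 0).obj (cokernel (toNearbySum M))).Exact :=
      (h0.exact 0).map_of_mono_of_preservesKernel Qc.functor this inferInstance
    refine Qc.skyExact.augSc_exact_of_sub (shortExact_toNearbySum M) 0
      ((Qc.isGood_nearbySum hM).exact 1) h1 ?_
    -- The lowest degree needs surjectivity in the augmentation degree, where exactness on
    -- skyscrapers says nothing; it holds because both modules are quasi-coherent. In higher degrees
    -- it comes from exactness of `C^j ⋙ Qc`.
    have h2 : Epi (Qc.functor.map (cokernel.π (toNearbySum M))) :=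
      Qc.epi_map (isQcoh_nearbySum hM) (X.IsQcoh.prop_cokernel _ hM (isQcoh_nearbySum hM)) _
    exact h2
  | succ j hj =>
    exact Qc.skyExact.augSc_exact_of_sub (shortExact_toNearbySum M) (j + 1)
      ((Qc.isGood_nearbySum hM).exact (j + 2))
      (hj (X.IsQcoh.prop_cokernel _ hM (isQcoh_nearbySum hM)))
      (Qc.skyExact.shortExact (shortExact_toNearbySum M) j).epi_g

end SemiSeparated
end Quasicoherator
end FiniteRingedSpace
end

noncomputable section

/-! ### A functorial acyclic resolution computes the right derived functor. -/

section Resolution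

variable {C D H : Type*} [Category* C] [Category* D] [Category* H] {L : C ⥤ D}
  {W : MorphismProperty C} [L.IsLocalization W] {Φ : C ⥤ H} {T : C ⥤ C} (η : 𝟭 C ⟶ T)

/-- The component at `M` must be `γ` at `T M` followed by the inverse of `E(L(η_M))`, which exists
because `η_M` lies in `W`. This is the initiality of `R` among extensions of `Φ` along `L`. -/
lemma CategoryTheory.Functor.existsUnique_desc_of_resolution (hη : ∀ M, W (η.app M))
    (hT : ∀ M, IsIso (Φ.map (η.app (T.obj M)))) {R : D ⥤ H} (e : L ⋙ R ≅ T ⋙ Φ)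
    (α : Φ ⟶ L ⋙ R) (hα : ∀ M, α.app M ≫ e.hom.app M = Φ.map (η.app M)) (E : D ⥤ H)
    (γ : Φ ⟶ L ⋙ E) : ∃! δ : R ⟶ E, α ≫ whiskerLeft L δ = γ := by
  have hL (M : C) : IsIso (L.map (η.app M)) := Localization.inverts L W _ (hη M)
  let i (M : C) : E.obj (L.obj M) ≅ E.obj (L.obj (T.obj M)) := asIso (E.map (L.map (η.app M)))
  have hi {M N : C} (f : M ⟶ N) : E.map (L.map f) ≫ (i N).hom =
      (i M).hom ≫ E.map (L.map (T.map f)) := by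
    have h : f ≫ η.app N = η.app M ≫ T.map f := η.naturality f
    change E.map (L.map f) ≫ E.map (L.map (η.app N)) = E.map (L.map (η.app M)) ≫ _
    rw [← E.map_comp, ← L.map_comp, h, L.map_comp, E.map_comp]
  have hγ {M N : C} (f : M ⟶ N) : Φ.map f ≫ γ.app N = γ.app M ≫ E.map (L.map f) := γ.naturality f
  let δ : T ⋙ Φ ⟶ L ⋙ E :=
    { app M := γ.app (T.obj M) ≫ (i M).inv
      naturality M N f := by
        change Φ.map (T.map f) ≫ _ = _ ≫ E.map (L.map f)
        rw [← Category.assoc, hγ, Iso.comp_inv_eq, Category.assoc, Category.assoc, hi,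
          Iso.inv_hom_id_assoc] }
  -- Whiskering with a localization functor is fully faithful, so transformations can be built and
  -- compared before passing to `D`.
  obtain ⟨δ', hδ'⟩ : ∃ δ' : R ⟶ E, whiskerLeft L δ' = e.hom ≫ δ := by
    have := Localization.full_whiskeringLeft L W H
    exact ((whiskeringLeft C D H).obj L).map_surjective (e.hom ≫ δ)
  have hδ (M : C) : Φ.map (η.app M) ≫ δ.app M = γ.app M := by
    change Φ.map (η.app M) ≫ γ.app (T.obj M) ≫ (i M).inv = γ.app M
    rw [← Category.assoc, hγ, Iso.comp_inv_eq]
    rfl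
  -- At `T M` the morphism `Φ(η)` is invertible, so `ε` and `ε'` agree there; naturality along `η_M`
  -- carries this back to `M`.
  have huniq (ε ε' : T ⋙ Φ ⟶ L ⋙ E)
      (h : ∀ M, Φ.map (η.app M) ≫ ε.app M = Φ.map (η.app M) ≫ ε'.app M) : ε = ε' := by
    ext M
    have h1 : Φ.map (T.map (η.app M)) ≫ ε.app (T.obj M) = ε.app M ≫ (i M).hom :=
      ε.naturality (η.app M)
    have h2 : Φ.map (T.map (η.app M)) ≫ ε'.app (T.obj M) = ε'.app M ≫ (i M).hom :=
      ε'.naturality (η.app M)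
    rw [← cancel_mono (i M).hom, ← h1, ← h2, (cancel_epi (Φ.map (η.app (T.obj M)))).1 (h (T.obj M))]
  have h₁ (δ₁ : R ⟶ E) (hδ₁ : α ≫ whiskerLeft L δ₁ = γ) (M : C) :
      Φ.map (η.app M) ≫ (e.inv ≫ whiskerLeft L δ₁).app M = γ.app M := by
    rw [← hα, ← hδ₁]
    change (_ ≫ e.hom.app M) ≫ e.inv.app M ≫ _ = _ ≫ _
    rw [Category.assoc, Iso.hom_inv_id_app_assoc]
  refine ⟨δ', ?_, fun δ₁ hδ₁ => ?_⟩
  · beta_reduce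
    rw [hδ']
    ext M
    change α.app M ≫ e.hom.app M ≫ δ.app M = γ.app M
    rw [← Category.assoc, hα, hδ]
  · have := Localization.faithful_whiskeringLeft L W H
    refine ((whiskeringLeft C D H).obj L).map_injective ?_
    change whiskerLeft L δ₁ = whiskerLeft L δ'
    rw [hδ', ← Iso.inv_comp_eq]
    refine huniq _ _ fun M => (h₁ δ₁ hδ₁ M).trans (hδ M).symm

/-- A functorial resolution by objects that are suitably acyclic computes the right derived
functor. -/
lemma CategoryTheory.Functor.isRightDerivedFunctor_of_resolution (hη : ∀ M, W (η.app M))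
    (hT : ∀ M, IsIso (Φ.map (η.app (T.obj M)))) {R : D ⥤ H} (e : L ⋙ R ≅ T ⋙ Φ)
    (α : Φ ⟶ L ⋙ R) (hα : ∀ M, α.app M ≫ e.hom.app M = Φ.map (η.app M)) :
    R.IsRightDerivedFunctor α W where
  isLeftKanExtension := by
    have h (E : L.LeftExtension Φ) := existsUnique_desc_of_resolution η hη hT e α hα E.right E.hom
    exact ⟨⟨IsInitial.ofUniqueHom (fun E => StructuredArrow.homMk (h E).choose (h E).choose_spec.1)
      fun E m => StructuredArrow.hom_ext _ _ ((h E).choose_spec.2 m.right m.w)⟩⟩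

end Resolution

namespace FiniteRingedSpace
variable {X : FiniteRingedSpace.{u}}

lemma isGood_totalStandard {A : Type*} [Category* A] [Abelian A] (F : X.Mod ⥤ A) [F.Additive]
    (M : CochainComplex X.Mod ℤ) (n : ℤ) : IsGood F ((X.totalStandard.obj M).X n) :=
  isGood_map_totalStandard (G := 𝟭 X.Mod) (fun p N => standard_isGood F N p) M n

end FiniteRingedSpace
end

theorem theorem3p1 (X : FiniteRingedSpace.{u}) [X.IsSemiSeparated]
    [HasDerivedCategory.{w₁} X.Mod] [HasDerivedCategory.{w₂} X.Qcoh] :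
    -- the functor `Qc` exists
    Nonempty X.Quasicoherator ∧
    ∀ Qc : X.Quasicoherator,
      -- `C^i M` is `Qc`-acyclic
      (∀ (M : X.Mod) (i j : ℕ), 0 < j →
        IsZero ((Qc.functor.rightDerived j).obj ((X.standard i).obj M))) ∧
      -- `R^i Qc (M) = 0` for `i > dim X`
      (∀ (M : X.Mod) (i : ℕ), Order.krullDim X.carrier < (i : WithBot ℕ∞) →
        IsZero ((Qc.functor.rightDerived i).obj M)) ∧
      -- the right derived functor `RQc : D(X) ⥤ DQcoh(X)` exists
      (Qc.onComplex ⋙ DerivedCategory.Q).HasRightDerivedFunctor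
        (HomologicalComplex.quasiIso X.Mod (ComplexShape.up ℤ)) ∧
      ∀ (RQc : DerivedCategory X.Mod ⥤ DerivedCategory X.Qcoh)
        (α : Qc.onComplex ⋙ DerivedCategory.Q ⟶ DerivedCategory.Q ⋙ RQc)
        [RQc.IsRightDerivedFunctor α
          (HomologicalComplex.quasiIso X.Mod (ComplexShape.up ℤ))],
        -- `RQc(M) ≅ Qc(C^• M)`, naturally in the complex `M` and compatibly with the natural
        -- morphisms from `Qc(M)`
        (∃ e : DerivedCategory.Q ⋙ RQc ≅ X.totalStandard ⋙ Qc.onComplex ⋙ DerivedCategory.Q,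
          ∀ M : CochainComplex X.Mod ℤ, α.app M ≫ e.hom.app M =
            DerivedCategory.Q.map (Qc.onComplex.map (X.toTotalStandard.app M))) ∧
        -- a complex `M` of quasi-coherent modules is `Qc`-acyclic: `Qc(M) ≅ RQc(M)`
        (∀ M : CochainComplex X.Mod ℤ, (∀ n, X.IsQcoh (M.X n)) → IsIso (α.app M)) ∧
        -- the natural morphism `M → Qc(M) → RQc(M)` is an isomorphism for such `M`
        (∀ M : CochainComplex X.Qcoh ℤ,
          IsIso (DerivedCategory.Q.map (Qc.unitComplex.app M) ≫
            α.app (X.inclusionComplex.obj M))) := by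
  refine ⟨FiniteRingedSpace.nonempty_quasicoherator X, fun Qc => ?_⟩
  have hF := Qc.skyExact
  refine ⟨fun M i j hj => hF.isZero_rightDerived_standard M i j hj,
    fun M i hi => hF.isZero_rightDerived_of_krullDim_lt M i hi, ?_⟩
  let W := HomologicalComplex.quasiIso X.Mod (ComplexShape.up ℤ)
  let Φ : CochainComplex X.Mod ℤ ⥤ DerivedCategory X.Qcoh := Qc.onComplex ⋙ DerivedCategory.Q
  -- Exactness of `Qc` on skyscrapers makes `Qc(C^• -)` descend to the derived category; the
  -- descended functor `R` is the candidate for the derived functor.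
  have hW : W.IsInvertedBy (X.totalStandard ⋙ Φ) := fun M N f hf => by
    have : QuasiIso f := hf
    exact (DerivedCategory.isIso_Q_map_iff_quasiIso _ _).2 (hF.quasiIso f)
  -- Used twice: for complexes `C^• M`, which makes `R` the derived functor, and for complexes of
  -- quasi-coherent modules.
  have hΦ (M : CochainComplex X.Mod ℤ) (hM : ∀ n, FiniteRingedSpace.IsGood Qc.functor (M.X n)) :
      IsIso (Φ.map (X.toTotalStandard.app M)) :=
    (DerivedCategory.isIso_Q_map_iff_quasiIso _ _).2
      (FiniteRingedSpace.quasiIso_map_toTotalStandard M hM)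
  let R : DerivedCategory X.Mod ⥤ DerivedCategory X.Qcoh :=
    Localization.lift (X.totalStandard ⋙ Φ) hW DerivedCategory.Q
  let eR : DerivedCategory.Q ⋙ R ≅ X.totalStandard ⋙ Φ :=
    Localization.fac (X.totalStandard ⋙ Φ) hW DerivedCategory.Q
  let α₀ : Φ ⟶ DerivedCategory.Q ⋙ R := Functor.whiskerRight X.toTotalStandard Φ ≫ eR.inv
  have hα₀ (M : CochainComplex X.Mod ℤ) :
      α₀.app M ≫ eR.hom.app M = Φ.map (X.toTotalStandard.app M) := by
    change (Φ.map (X.toTotalStandard.app M) ≫ eR.inv.app M) ≫ eR.hom.app M = _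
    rw [Category.assoc, Iso.inv_hom_id_app]
    exact Category.comp_id _
  have hR : R.IsRightDerivedFunctor α₀ W :=
    Functor.isRightDerivedFunctor_of_resolution X.toTotalStandard
      (fun M => FiniteRingedSpace.quasiIso_toTotalStandard M)
      (fun M => hΦ _ (FiniteRingedSpace.isGood_totalStandard Qc.functor M)) eR α₀ hα₀
  refine ⟨Functor.HasRightDerivedFunctor.mk' R α₀, fun RQc α hα => ?_⟩
  let e : DerivedCategory.Q ⋙ RQc ≅ X.totalStandard ⋙ Φ :=
    Functor.isoWhiskerLeft DerivedCategory.Q (Functor.rightDerivedUnique RQc R α α₀ W) ≪≫ eR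
  have he (M : CochainComplex X.Mod ℤ) :
      α.app M ≫ e.hom.app M = Φ.map (X.toTotalStandard.app M) := by
    have h := Functor.rightDerivedNatTrans_app RQc R α α₀ W (𝟙 Φ) M
    change α.app M ≫ (Functor.rightDerivedNatTrans RQc R α α₀ W (𝟙 Φ)).app _ ≫ eR.hom.app M = _
    rw [← Category.assoc, h, NatTrans.id_app, Category.id_comp, hα₀]
  -- Under `e`, the morphism `α` at `M` becomes `Qc(M) → Qc(C^• M)`, which is invertible because the
  -- terms of `M` are good.
  have hq (M : CochainComplex X.Mod ℤ) (hM : ∀ n, X.IsQcoh (M.X n)) : IsIso (α.app M) := by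
    have h := hΦ M fun n => Qc.isGood_of_isQcoh (hM n)
    rw [← he] at h
    exact IsIso.of_isIso_comp_right _ (e.hom.app M)
  refine ⟨⟨e, he⟩, hq, fun M => ?_⟩
  have h1 : IsIso (Qc.unitComplex.app M) := by
    have : ∀ n, IsIso ((Qc.unitComplex.app M).f n) := fun n =>
      inferInstanceAs (IsIso (Qc.adj.unit.app (M.X n)))
    exact HomologicalComplex.Hom.isIso_of_components _
  have h2 := hq (X.inclusionComplex.obj M) fun n => (M.X n).property
  infer_instance
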